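/- Let $\mathcal L$ be the set of (non-empty) oriented links in $\mathbb R^3$ up to isotopy, given by oriented link diagrams modulo the Reidemeister moves, and for $\mu\ge 1$ let $\mathcal L^{(\mu)}$ be the set of those with $\mu$ components. A link invariant $w:\mathcal L^{(\mu)}\to\mathbb Q$ is extended to $\mu$-component links with finitely many transverse self-intersections (singular crossings) by the rule $w(L_\times)=w(L_+)-w(L_-)$, where $L_+$ and $L_-$ are obtained from $L_\times$ by replacing one singular crossing by a positive, respectively negative, crossing; $w$ is a Vassiliev invariant if there is an $n\in\mathbb N$ such that this extension vanishes on all $\mu$-component links with $n+1$ singular crossings. There is exactly one map $P:\mathcal L\to\mathbb Z[v^{\pm1},z^{\pm1}]$, the HOMFLYPT polynomial, such that $P=1$ on the unknot and $v^{-1}P_{L_+}-vP_{L_-}=zP_{L_0}$ whenever $L_+,L_-,L_0$ have diagrams that differ only at one crossing, which is positive in $L_+$, negative in $L_-$ and smoothed compatibly with the orientations in $L_0$. Write $P_L(v,z)=\sum_{k,j\in\mathbb Z}a_{kj}(L)\,v^kz^j$ and put $$B_{mj}(L)=\sum_{k\in\mathbb Z}a_{kj}(L)\,\frac{k^m}{m!}\qquad(m\in\mathbb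 N,\ j\in\mathbb Z),$$ with the convention $0^0=1$. Then for all $\mu\ge1$, $m\in\mathbb N$ and $j\in\mathbb Z$ the restriction $B^\mu_{mj}$ of $B_{mj}$ to $\mathcal L^{(\mu)}$ is a Vassiliev invariant. -/

import Mathlib

/-!
# Oriented links, Vassiliev invariants and the HOMFLYPT polynomial

Links are link diagrams up to Reidemeister moves.  A diagram in general position with respect to the
height function of the plane is cut by horizontal lines into slices, each of which contains exactly
one minimum, maximum or crossing; it is recorded as the list of its slices, from bottom to top.
-/

namespace OrientedLinks

/-- The one part of a slice that is not a vertical strand. -/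
inductive Piece where
  /-- A minimum. `cup true` is traversed from right to left (its left leg points up, its right leg
  down), `cup false` from left to right. -/
  | cup (o : Bool)
  /-- A maximum. -/
  | cap
  /-- A crossing. `cross true`: the strand running from bottom left to top right passes over the
  other one; `cross false`: it passes under. -/
  | cross (b : Bool)
  /-- A singular crossing (a transverse double point). -/
  | double
  deriving DecidableEq

/-- A slice: `pos` vertical strands, then the piece, then further vertical strands. -/
structure Slice where
  pos : ℕ
  piece : Piece
  deriving DecidableEq

/-- The number of endpoints of a piece on its lower boundary line. -/
def Piece.bot : Piece → ℕ
  | cup _ => 0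
  | _ => 2

/-- The number of endpoints of a piece on its upper boundary line. -/
def Piece.top : Piece → ℕ
  | cap => 0
  | _ => 2

/-- The effect of a piece on the orientations (`true` = upwards) of the strands from its position
on: `none` if the piece does not fit, which for a maximum includes the case that the two strands it
joins are not oppositely oriented. -/
def Piece.act : Piece → List Bool → Option (List Bool)
  | cup o, l => some (o :: (!o) :: l)
  | cap, a :: b :: l => if b = !a then some l else none
  | cross _, a :: b :: l => some (b :: a :: l)
  | double, a :: b :: l => some (b :: a :: l)
  | _, _ => none

/-- The orientations of the strands above a slice, given those below it. -/
def Slice.act (x : Slice) (l : List Bool) : Option (List Bool) :=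
  if x.pos ≤ l.length then (x.piece.act (l.drop x.pos)).map (l.take x.pos ++ ·) else none

/-- The orientations of the strands above a stack of slices, given those below it. -/
def run : List Slice → List Bool → Option (List Bool)
  | [], l => some l
  | x :: w, l => (x.act l).bind (run w)

/-! ### Components -/

/-- A diagram traced up to some height: the names of the arcs to which the strands at that height
belong, the first name not used so far, and the number of components that are closed already. -/
structure Trace where
  arcs : List ℕ
  fresh : ℕ
  closed : ℕ

/-- A minimum starts a new arc; a maximum closes a component if it joins the two ends of one arc,
and otherwise merges two arcs into one; at a crossing the two strands change places. -/
def Trace.step (t : Trace) (x : Slice) : Trace :=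
  let l := t.arcs.take x.pos
  let r := t.arcs.drop x.pos
  match x.piece, r with
  | .cup _, r => ⟨l ++ t.fresh :: t.fresh :: r, t.fresh + 1, t.closed⟩
  | .cap, a :: b :: r =>
      if a = b then ⟨l ++ r, t.fresh, t.closed + 1⟩
      else ⟨(l ++ r).map (fun c => if c = b then a else c), t.fresh, t.closed⟩
  | .cross _, a :: b :: r => ⟨l ++ b :: a :: r, t.fresh, t.closed⟩
  | .double, a :: b :: r => ⟨l ++ b :: a :: r, t.fresh, t.closed⟩
  | _, _ => t

/-- The number of components of a (possibly singular) link diagram. -/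
def components (w : List Slice) : ℕ :=
  (w.foldl Trace.step ⟨[], 0, 0⟩).closed

/-- The number of singular crossings. -/
def doubleCount (w : List Slice) : ℕ :=
  w.countP (fun x => decide (x.piece = .double))

/-! ### Diagrams and links -/

/-- `w` is a diagram of an oriented link with `μ` components and possibly with singular crossings. -/
def IsSingularDiagram (μ : ℕ+) (w : List Slice) : Prop :=
  run w [] = some [] ∧ components w = μ

/-- `w` is a diagram of an oriented link with `μ` components. -/
def IsDiagram (μ : ℕ+) (w : List Slice) : Prop :=
  IsSingularDiagram μ w ∧ doubleCount w = 0

/-- The diagrams of oriented links with `μ` components. -/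
def Diagram (μ : ℕ+) : Type := {w : List Slice // IsDiagram μ w}

/-- The local moves: isotopies of the plane (`commute`, the two zigzags and the two slides) and the
Reidemeister moves. -/
inductive LocalMove : List Slice → List Slice → Prop
  /-- Two pieces side by side are moved past each other in height. -/
  | commute (i k : ℕ) (g h : Piece) :
      LocalMove [⟨i, g⟩, ⟨i + g.top + k, h⟩] [⟨i + g.bot + k, h⟩, ⟨i, g⟩]
  /-- A minimum and a maximum of one strand cancel. -/
  | zigzagLeft (i : ℕ) (o : Bool) : LocalMove [⟨i, .cup o⟩, ⟨i + 1, .cap⟩] []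
  | zigzagRight (i : ℕ) (o : Bool) : LocalMove [⟨i + 1, .cup o⟩, ⟨i, .cap⟩] []
  /-- A crossing is moved from one leg of a maximum to the other. -/
  | capSlide (i : ℕ) (b : Bool) :
      LocalMove [⟨i, .cross b⟩, ⟨i + 1, .cap⟩] [⟨i + 1, .cross (!b)⟩, ⟨i, .cap⟩]
  /-- A crossing is moved from one leg of a minimum to the other. -/
  | cupSlide (i : ℕ) (o b : Bool) :
      LocalMove [⟨i + 1, .cup o⟩, ⟨i, .cross b⟩] [⟨i, .cup o⟩, ⟨i + 1, .cross (!b)⟩]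
  /-- First Reidemeister move, at a maximum. -/
  | r1Cap (i : ℕ) (b : Bool) : LocalMove [⟨i, .cross b⟩, ⟨i, .cap⟩] [⟨i, .cap⟩]
  /-- First Reidemeister move, at a minimum. -/
  | r1Cup (i : ℕ) (o b : Bool) : LocalMove [⟨i, .cup o⟩, ⟨i, .cross b⟩] [⟨i, .cup (!o)⟩]
  /-- Second Reidemeister move. -/
  | r2 (i : ℕ) (b : Bool) : LocalMove [⟨i, .cross b⟩, ⟨i, .cross (!b)⟩] []
  /-- Third Reidemeister move, for all choices of the crossings for which the three strands lie
  one above the other (that is, all except the two cyclic ones). -/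
  | r3 (i : ℕ) (a b c : Bool) (h : b = a ∨ b = c) :
      LocalMove [⟨i, .cross a⟩, ⟨i + 1, .cross b⟩, ⟨i, .cross c⟩]
        [⟨i + 1, .cross c⟩, ⟨i, .cross b⟩, ⟨i + 1, .cross a⟩]

/-- A local move performed inside a diagram. -/
def Move (w w' : List Slice) : Prop :=
  ∃ p q u u' : List Slice, LocalMove u u' ∧ w = p ++ u ++ q ∧ w' = p ++ u' ++ q

/-- The oriented links with `μ` components: diagrams up to the equivalence relation generated by the
moves (none of which changes the number of components). -/
def Link (μ : ℕ+) : Type := Quot (fun D D' : Diagram μ => Move D.1 D'.1)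

/-- The link represented by a diagram. -/
def Link.mk {μ : ℕ+} (w : List Slice) (h : IsDiagram μ w) : Link μ :=
  Quot.mk _ ⟨w, h⟩

/-! ### Vassiliev invariants -/

/-- For strands with orientations `l`, the value `b` for which `cross b` at position `i` is a
positive crossing: for parallel strands (both up or both down) the strand from bottom left to top
right has to be the upper one, for antiparallel strands the other one. -/
def positiveType (l : List Bool) (i : ℕ) : Bool := decide (l[i]? = l[i + 1]?)

/-- The sum of the values `f` takes on the resolutions of all singular crossings of `w` (stacked on
the already resolved part `p`), each positive resolution taken with sign `+` and each negative one
with sign `-`: the function on singular diagrams that extends `f` and satisfies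
`f L_× = f L_+ - f L_-` at each singular crossing. -/
def extend (f : List Slice → ℚ) (p : List Slice) : List Slice → ℚ
  | [] => f p
  | ⟨i, .double⟩ :: w =>
      extend f (p ++ [⟨i, .cross (positiveType ((run p []).getD []) i)⟩]) w
        - extend f (p ++ [⟨i, .cross (!positiveType ((run p []).getD []) i)⟩]) w
  | x :: w => extend f (p ++ [x]) w

open Classical in
/-- An invariant of links with `μ` components as a function of their diagrams. -/
noncomputable def onDiagrams {μ : ℕ+} (v : Link μ → ℚ) (w : List Slice) : ℚ :=
  if h : IsDiagram μ w then v (Link.mk w h) else 0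

/-- `v` is a Vassiliev invariant of order at most `n` of oriented links with `μ` components: its
extension to singular links vanishes on all links with `n + 1` singular crossings. -/
def IsVassilievOfOrder {μ : ℕ+} (v : Link μ → ℚ) (n : ℕ) : Prop :=
  ∀ w, IsSingularDiagram μ w → doubleCount w = n + 1 → extend (onDiagrams v) [] w = 0

/-- `v` is a Vassiliev invariant of oriented links with `μ` components. -/
def IsVassiliev {μ : ℕ+} (v : Link μ → ℚ) : Prop := ∃ n, IsVassilievOfOrder v n

/-! ### The HOMFLYPT polynomial -/

/-- The Laurent polynomials in `v` and `z`; the coefficient of `v ^ k * z ^ j` in `p` is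
`p.coeff (k, j)`. -/
abbrev Laurent : Type := AddMonoidAlgebra ℤ (ℤ × ℤ)

/-- The monomial `v ^ k * z ^ j`. -/
noncomputable def monomial (k j : ℤ) : Laurent := AddMonoidAlgebra.single (k, j) 1

/-- What replaces a crossing at position `i` of strands with orientations `l` when it is smoothed
respecting the orientations: two vertical strands if the strands are parallel, and a maximum below a
minimum if they are antiparallel. -/
def smoothing (l : List Bool) (i : ℕ) : List Slice :=
  if l[i]? = l[i + 1]? then [] else [⟨i, .cap⟩, ⟨i, .cup (l.getD (i + 1) true)⟩]

/-- The three diagrams agree except at one crossing, which is positive in `wPos`, negative in `wNeg`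
and smoothed in `wZero`. -/
def IsSkeinTriple (wPos wNeg wZero : List Slice) : Prop :=
  ∃ (p q : List Slice) (l : List Bool) (i : ℕ), run p [] = some l ∧
    wPos = p ++ [⟨i, .cross (positiveType l i)⟩] ++ q ∧
    wNeg = p ++ [⟨i, .cross (!positiveType l i)⟩] ++ q ∧
    wZero = p ++ smoothing l i ++ q

/-- The unknot: one minimum and one maximum. -/
def unknot : Link 1 := Link.mk [⟨0, .cup true⟩, ⟨0, .cap⟩] (by
  refine ⟨⟨?_, ?_⟩, ?_⟩ <;> decide)

/-- `P` satisfies the axioms of the HOMFLYPT polynomial: `v⁻¹ P(L_+) - v P(L_-) = z P(L_0)`, and `P`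
is `1` on the unknot. -/
def IsHOMFLYPT (P : (μ : ℕ+) → Link μ → Laurent) : Prop :=
  (∀ (wPos wNeg wZero : List Slice), IsSkeinTriple wPos wNeg wZero →
    ∀ (μ μ₀ : ℕ+) (hPos : IsDiagram μ wPos) (hNeg : IsDiagram μ wNeg) (hZero : IsDiagram μ₀ wZero),
      monomial (-1) 0 * P μ (Link.mk wPos hPos) - monomial 1 0 * P μ (Link.mk wNeg hNeg)
        = monomial 0 1 * P μ₀ (Link.mk wZero hZero)) ∧
  P 1 unknot = 1

/-- `∑ k, a k j * k ^ m / m!` for the coefficients `a k j` of a Laurent polynomial. -/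
noncomputable def coeffB (p : Laurent) (m : ℕ) (j : ℤ) : ℚ :=
  ∑ k ∈ p.coeff.support.image Prod.fst, (p.coeff (k, j) : ℚ) * (k : ℚ) ^ m / (m.factorial : ℚ)

end OrientedLinks

namespace OrientedLinks

/-! ### Slices at shifted positions -/

/-! There are three claims: a polynomial with the skein relation exists, it is unique, and its
moments in `v` have finite order. A spanning statement about diagrams serves all three.

Spanning. Over the ring generated by `v`, `v⁻¹`, `z` and `δ = (v⁻¹ - v) / z`, take the free module
on words modulo the moves, the skein relation and the removal of a circle beside a strand. Every
piece without double point, put on top of a descending tangle, gives a combination of descending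
tangles (`closed_all`, `preserves_cup`): the leftmost arc lies above everything else, so the piece
can be slid below it or absorbed into it, and a crossing of the wrong sign is exchanged by the skein
relation at the cost of a smoothing. Without end points only the empty diagram and the circle are
left. Hence each diagram `w` has a coefficient `c` in this ring with `f w = c • f unknot` for every
invariant `f` in the sense of `SkeinRing.Invariant` (`SkeinRing.exists_coeff`). Applied to HOMFLYPT
polynomials this is uniqueness.

Existence. That `c` depends only on the link is read off from a family of state sums, those of the
R-matrix of the quantum group of `gl_N`, with `v = q ^ (-N)` and `z = q - q⁻¹`. They are unchanged
by the moves (`LocalMove.sameOp`) and satisfy the skein relation (`stateOp_skein`), so the state sum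
of `w` is the value of `c` times the state sum of the unknot, which is not zero. The values at all
`N ≥ 1` and `q > 1` determine a Laurent polynomial (`evalStateSums_injective`), so `c` inherits
invariance and the skein relation. The same state sum at `q = 1`, `N = 2` equals `2 ^ components`,
which is how the moves are seen to preserve the number of components.

Finite order. Substitute `v = exp h`; then `B_mj` is the coefficient of `h ^ m z ^ j`. Filter by
total degree in `h` and `z`. The ring above preserves the filtration, because `v⁻¹ - v` is divisible
by `h`, so `P` has degree at least `0`. The skein relation in the form `P(L_+) - P(L_-) = (v² - 1)
P(L_-) + v z P(L_0)` shows that each double point raises the degree by one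
(`extendLaurent_mem_filtration`). With `n + 1` double points all coefficients with `m + j ≤ n`
vanish. -/

/-- A stack of slices with `i` further strands on its left. -/
def lift (i : ℕ) (u : List Slice) : List Slice := u.map (fun x => ⟨i + x.pos, x.piece⟩)

theorem run_append (u u' : List Slice) (l : List Bool) :
    run (u ++ u') l = (run u l).bind (run u') := by
  induction u generalizing l with
  | nil => simp [run]
  | cons x u ih =>
    simp only [List.cons_append, run, Option.bind_assoc]
    congr 1
    funext l'
    exact ih l'

theorem act_lift (l₁ l : List Bool) (i : ℕ) (g : Piece) :
    (Slice.mk (l₁.length + i) g).act (l₁ ++ l) = ((Slice.mk i g).act l).map (l₁ ++ ·) := by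
  unfold Slice.act
  by_cases h : i ≤ l.length
  · have h1 : List.drop (l₁.length + i) l₁ = [] := List.drop_eq_nil_of_le (by omega)
    have h2 : List.take (l₁.length + i) l₁ = l₁ := List.take_of_length_le (by omega)
    simp [h, List.take_append, List.drop_append, Function.comp_def, h1, h2]
  · simp [h]

theorem run_lift (l₁ l : List Bool) (u : List Slice) :
    run (lift l₁.length u) (l₁ ++ l) = (run u l).map (l₁ ++ ·) := by
  induction u generalizing l with
  | nil => simp [lift, run]
  | cons x u ih =>
    simp only [lift, List.map_cons, run] at ih ⊢
    rw [act_lift]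
    cases h : Slice.act x l with
    | none => simp
    | some l' => simp [ih]

theorem pos_le_of_act {x : Slice} {l l' : List Bool} (h : x.act l = some l') :
    x.pos ≤ l.length := by
  unfold Slice.act at h
  split_ifs at h with h'
  exact h'

/-! ### Operators of the state sum -/

section Operators

open scoped Stream'

variable {N : ℕ}

/-- The linear operators on states, which are functions of the colors of the strands. (A sequence of
colors is continued arbitrarily beyond the last strand.) -/
abbrev Op (N : ℕ) : Type := Module.End ℝ (Stream' (Fin N) → ℝ)

/-- An operator acting on all strands but the first. -/
def shift (T : Op N) : Op N where
  toFun ψ c := T (fun c' => ψ (c.head :: c')) c.tail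
  map_add' ψ φ := by
    funext c
    exact congrFun (T.map_add (fun c' => ψ (c.head :: c')) (fun c' => φ (c.head :: c'))) c.tail
  map_smul' r ψ := by
    funext c
    exact congrFun (T.map_smul r (fun c' => ψ (c.head :: c'))) c.tail

@[simp] theorem shift_cons (T : Op N) (ψ : Stream' (Fin N) → ℝ) (a : Fin N) (c : Stream' (Fin N)) :
    shift T ψ (a :: c) = T (fun c' => ψ (a :: c')) c := rfl

theorem op_ext_cons {T U : Op N} (h : ∀ ψ x c, T ψ (x :: c) = U ψ (x :: c)) : T = U := by
  ext ψ c
  rw [← Stream'.eta c]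
  exact h _ _ _

theorem op_ext_cons_cons {T U : Op N} (h : ∀ ψ x y c, T ψ (x :: y :: c) = U ψ (x :: y :: c)) :
    T = U := by
  refine op_ext_cons fun ψ x c => ?_
  rw [← Stream'.eta c]
  exact h _ _ _ _

theorem op_ext_cons_cons_cons {T U : Op N}
    (h : ∀ ψ x y t c, T ψ (x :: y :: t :: c) = U ψ (x :: y :: t :: c)) : T = U := by
  refine op_ext_cons_cons fun ψ x y c => ?_
  rw [← Stream'.eta c]
  exact h _ _ _ _ _

theorem shift_one : shift (1 : Op N) = 1 :=
  op_ext_cons fun _ _ _ => rfl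

theorem shift_mul (T U : Op N) : shift (T * U) = shift T * shift U :=
  op_ext_cons fun _ _ _ => rfl

/-- The creation of two strands of equal colors. -/
def cupOp (k : Fin N → ℝ) : Op N where
  toFun ψ c := if c.head = c.tail.head then k c.head * ψ c.tail.tail else 0
  map_add' ψ φ := by
    funext c
    simp only [Pi.add_apply, mul_add]
    split_ifs <;> simp
  map_smul' r ψ := by
    funext c
    simp [mul_left_comm]

/-- The contraction of two strands of equal colors. -/
def capOp (k : Fin N → ℝ) : Op N where
  toFun ψ c := ∑ x, k x * ψ (x :: x :: c)
  map_add' ψ φ := by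
    funext c
    simp [mul_add, Finset.sum_add_distrib]
  map_smul' r ψ := by
    funext c
    simp [mul_left_comm, Finset.mul_sum]

/-- The operator on two strands with the given matrix. -/
def twoOp (W : Fin N → Fin N → Fin N → Fin N → ℝ) : Op N where
  toFun ψ c := ∑ s, ∑ t, W c.head c.tail.head s t * ψ (s :: t :: c.tail.tail)
  map_add' ψ φ := by
    funext c
    simp [mul_add, Finset.sum_add_distrib]
  map_smul' r ψ := by
    funext c
    simp [mul_left_comm, Finset.mul_sum]

theorem cupOp_apply (k : Fin N → ℝ) (ψ : Stream' (Fin N) → ℝ) (x y : Fin N)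
    (c : Stream' (Fin N)) :
    cupOp k ψ (x :: y :: c) = if x = y then k x * ψ c else 0 := rfl

theorem capOp_apply (k : Fin N → ℝ) (ψ : Stream' (Fin N) → ℝ) (c : Stream' (Fin N)) :
    capOp k ψ c = ∑ x, k x * ψ (x :: x :: c) := rfl

theorem twoOp_apply (W : Fin N → Fin N → Fin N → Fin N → ℝ) (ψ : Stream' (Fin N) → ℝ)
    (x y : Fin N) (c : Stream' (Fin N)) :
    twoOp W ψ (x :: y :: c) = ∑ s, ∑ t, W x y s t * ψ (s :: t :: c) := rfl

/-- Pieces side by side commute: `T` only sees the strands to the right of the piece, and by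
linearity it passes the scalar here and the finite sums in the two analogues for maxima and
crossings. -/
theorem shift_cupOp_comm (k : Fin N → ℝ) (T : Op N) :
    shift (shift T) * cupOp k = cupOp k * T := by
  refine op_ext_cons_cons fun ψ x y c => ?_
  simp only [Module.End.mul_apply, shift_cons, cupOp_apply]
  split_ifs with h
  · exact congrFun (T.map_smul (k x) ψ) c
  · exact congrFun T.map_zero c

theorem capOp_shift_comm (k : Fin N → ℝ) (T : Op N) :
    T * capOp k = capOp k * shift (shift T) := by
  ext ψ c
  simp only [Module.End.mul_apply, shift_cons, capOp_apply]
  have : capOp k ψ = ∑ x, k x • (fun c' => ψ (x :: x :: c')) := by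
    funext c
    simp [capOp_apply]
  rw [this]
  simp

theorem shift_twoOp_comm (W : Fin N → Fin N → Fin N → Fin N → ℝ) (T : Op N) :
    shift (shift T) * twoOp W = twoOp W * shift (shift T) := by
  refine op_ext_cons_cons fun ψ x y c => ?_
  simp only [Module.End.mul_apply, shift_cons, twoOp_apply]
  have : (fun c' => ∑ s, ∑ t, W x y s t * ψ (s :: t :: c'))
      = ∑ s, ∑ t, W x y s t • (fun c' => ψ (s :: t :: c')) := by
    funext c
    simp
  rw [this]
  simp

/-! ### Weights -/

/-- The variable `v` is specialised to `q ^ (-N)`. -/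
noncomputable def vval (N : ℕ) (q : ℝ) : ℝ := q ^ (-(N : ℤ))

/-- The correction by the writhe: a curl made of the bare R-matrix contributes a power of `v`, which
this factor cancels, so that the first Reidemeister move holds exactly. -/
noncomputable def crossUnit (N : ℕ) (q : ℝ) (b : Bool) : ℝ := if b then vval N q else (vval N q)⁻¹

/-- The entry of the R-matrix (`b = true`) or of its inverse for two equal colors; `theta` is the
coefficient of the term in which different colors are not exchanged. -/
noncomputable def diag (q : ℝ) (b : Bool) : ℝ := if b then q else q⁻¹

noncomputable def theta (q : ℝ) (b : Bool) (x y : Fin N) : ℝ :=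
  if b then (if x < y then q - q⁻¹ else 0) else (if y < x then -(q - q⁻¹) else 0)

/-- The weights of the quantum trace. The exponents run through `1 - N, 3 - N, …, N - 1`, and the
sum, the quantum dimension, is the state sum of the unknot. -/
noncomputable def kappa (q : ℝ) (x : Fin N) : ℝ := q ^ (1 - (N : ℤ) + 2 * (x : ℕ))

/-- The weights of minima and maxima are balanced so that they cancel along a zigzag, while a circle
retains a factor `kappa q x` or its inverse, according to its orientation. -/
noncomputable def cupWeight (q : ℝ) (o : Bool) (x : Fin N) : ℝ := if o then kappa q x else 1

noncomputable def capWeight (q : ℝ) (o : Bool) (x : Fin N) : ℝ := if o then 1 else (kappa q x)⁻¹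

/-- The weight of a pair of colors that is replaced by another one: `x` above and `s` below. -/
noncomputable def pairWeight (q : ℝ) (o b : Bool) (x s : Fin N) : ℝ :=
  if o then theta q b x s else theta q b s x * (kappa q x * (kappa q s)⁻¹)

/-- The matrix of a crossing of strands with orientations `a` and `c`. -/
noncomputable def crossWeight (q : ℝ) (a c b : Bool) (x y s t : Fin N) : ℝ :=
  if a = c then
    crossUnit N q b * ((if s = y ∧ t = x then (if x = y then diag q b else 1) else 0)
      + (if s = x ∧ t = y then (if a then theta q b x y else theta q b y x) else 0))
  else
    crossUnit N q (!b) * ((if s = y ∧ t = x then (if x = y then diag q (!b) else 1) else 0)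
      + (if x = y ∧ s = t then pairWeight q a (!b) x s else 0))

noncomputable def crossOp (N : ℕ) (q : ℝ) (a c b : Bool) : Op N := twoOp (crossWeight q a c b)

theorem crossOp_parallel (q : ℝ) (a b : Bool) (ψ : Stream' (Fin N) → ℝ) (x y : Fin N)
    (c : Stream' (Fin N)) :
    crossOp N q a a b ψ (x :: y :: c) = crossUnit N q b *
      ((if x = y then diag q b else 1) * ψ (y :: x :: c)
        + (if a then theta q b x y else theta q b y x) * ψ (x :: y :: c)) := by
  simp only [crossOp, twoOp_apply, crossWeight, if_true, ite_and, mul_add, add_mul,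
    Finset.sum_add_distrib, mul_ite, mul_zero, ite_mul, zero_mul, Finset.sum_ite_eq',
    Finset.mem_univ, Finset.sum_ite_irrel, Finset.sum_const_zero]
  simp [mul_assoc]

theorem crossOp_anti (q : ℝ) (a b : Bool) (ψ : Stream' (Fin N) → ℝ) (x y : Fin N)
    (c : Stream' (Fin N)) :
    crossOp N q a (!a) b ψ (x :: y :: c) = crossUnit N q (!b) *
      (if x = y then diag q (!b) * ψ (x :: x :: c)
          + ∑ s, pairWeight q a (!b) x s * ψ (s :: s :: c)
        else ψ (y :: x :: c)) := by
  have ha : ¬ (a = !a) := by cases a <;> simp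
  simp only [crossOp, twoOp_apply, crossWeight, if_neg ha, ite_and, mul_add, add_mul,
    Finset.sum_add_distrib, mul_ite, mul_zero, ite_mul, zero_mul, Finset.sum_ite_eq',
    Finset.sum_ite_eq, Finset.mem_univ, Finset.sum_ite_irrel, Finset.sum_const_zero]
  by_cases h : x = y
  · subst h; simp [mul_assoc, Finset.mul_sum]
  · simp [h]

end Operators

/-! ### The state sum -/

section StateSum

variable {N : ℕ}

/-- The operator of a piece at the leftmost position. -/
noncomputable def baseOp (N : ℕ) (q : ℝ) : Piece → List Bool → Op N
  | .cup o, _ => cupOp (cupWeight q o)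
  | .cap, a :: _ => capOp (capWeight q a)
  | .cross b, a :: c :: _ => crossOp N q a c b
  | .double, a :: c :: _ => crossOp N q a c true
  | _, _ => 0

noncomputable def sliceOp (N : ℕ) (q : ℝ) (g : Piece) : ℕ → List Bool → Op N
  | 0, l => baseOp N q g l
  | i + 1, _ :: l => shift (sliceOp N q g i l)
  | _ + 1, [] => 0

/-- The operator of a stack of slices on strands with the given orientations. -/
noncomputable def stateOp (N : ℕ) (q : ℝ) : List Slice → List Bool → Op N
  | [], _ => 1
  | x :: w, l => stateOp N q w ((x.act l).getD []) * sliceOp N q x.piece x.pos l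

theorem stateOp_append (q : ℝ) {u : List Slice} {l l' : List Bool} (h : run u l = some l')
    (u' : List Slice) : stateOp N q (u ++ u') l = stateOp N q u' l' * stateOp N q u l := by
  induction u generalizing l with
  | nil =>
    obtain rfl : l = l' := by simpa [run] using h
    simp [stateOp]
  | cons x u ih =>
    simp only [run, Option.bind_eq_some_iff] at h
    obtain ⟨l'', h1, h2⟩ := h
    simp only [List.cons_append, stateOp, h1, Option.getD_some, ih h2, mul_assoc]

theorem sliceOp_lift (q : ℝ) (g : Piece) (l₁ l : List Bool) (i : ℕ) :
    sliceOp N q g (l₁.length + i) (l₁ ++ l) = shift^[l₁.length] (sliceOp N q g i l) := by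
  induction l₁ with
  | nil => simp
  | cons a l₁ ih =>
    rw [List.length_cons, show l₁.length + 1 + i = (l₁.length + i) + 1 by omega,
      List.cons_append, sliceOp, ih, Function.iterate_succ_apply']

theorem iterate_shift_one (n : ℕ) : shift^[n] (1 : Op N) = 1 :=
  Function.iterate_fixed shift_one n

theorem iterate_shift_mul (n : ℕ) (T U : Op N) :
    shift^[n] (T * U) = shift^[n] T * shift^[n] U := by
  induction n with
  | zero => rfl
  | succ n ih => simp only [Function.iterate_succ_apply', ih, shift_mul]

theorem stateOp_lift (q : ℝ) (l₁ : List Bool) {l l' : List Bool} {u : List Slice}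
    (h : run u l = some l') :
    stateOp N q (lift l₁.length u) (l₁ ++ l) = shift^[l₁.length] (stateOp N q u l) := by
  induction u generalizing l with
  | nil => simp [lift, stateOp, iterate_shift_one]
  | cons x u ih =>
    simp only [run, Option.bind_eq_some_iff] at h
    obtain ⟨l'', h1, h2⟩ := h
    have := ih h2
    simp only [lift, List.map_cons, stateOp] at this ⊢
    rw [act_lift, show Slice.act ⟨x.pos, x.piece⟩ l = some l'' from h1]
    simp only [Option.map_some, Option.getD_some]
    rw [this, sliceOp_lift, iterate_shift_mul]

/-- Two stacks of slices have the same effect on orientations and states. -/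
def SameOp (N : ℕ) (q : ℝ) (l : List Bool) (u u' : List Slice) : Prop :=
  ∃ l', run u l = some l' ∧ run u' l = some l' ∧ stateOp N q u l = stateOp N q u' l

variable {q : ℝ}

theorem SameOp.lift {l : List Bool} {u u' : List Slice} (h : SameOp N q l u u')
    (l₁ : List Bool) : SameOp N q (l₁ ++ l) (lift l₁.length u) (lift l₁.length u') := by
  obtain ⟨l', h1, h2, h3⟩ := h
  refine ⟨l₁ ++ l', by simp [run_lift, h1], by simp [run_lift, h2], ?_⟩
  rw [stateOp_lift q l₁ h1, stateOp_lift q l₁ h2, h3]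

theorem SameOp.append {l l' : List Bool} {p u u' r : List Slice} (hp : run p l = some l')
    (h : SameOp N q l' u u') (hr : (run (p ++ u ++ r) l).isSome) :
    SameOp N q l (p ++ u ++ r) (p ++ u' ++ r) := by
  obtain ⟨l₂, h1, h2, h3⟩ := h
  obtain ⟨l₃, h4⟩ := Option.isSome_iff_exists.1 hr
  have e : run (p ++ u) l = some l₂ := by simp [run_append, hp, h1]
  have e' : run (p ++ u') l = some l₂ := by simp [run_append, hp, h2]
  rw [run_append, e] at h4
  refine ⟨l₃, by rw [run_append, e]; exact h4, by rw [run_append, e']; exact h4, ?_⟩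
  rw [stateOp_append q e, stateOp_append q e', stateOp_append q hp, stateOp_append q hp, h3]

end StateSum

/-! ### Identities between the weights -/

section Weights

variable {N : ℕ} {q : ℝ}

theorem vval_ne_zero (hq : q ≠ 0) : vval N q ≠ 0 := zpow_ne_zero _ hq

theorem kappa_ne_zero (hq : q ≠ 0) (x : Fin N) : kappa q x ≠ 0 := zpow_ne_zero _ hq

theorem crossUnit_mul_not (hq : q ≠ 0) (b : Bool) :
    crossUnit N q b * crossUnit N q (!b) = 1 := by
  have := vval_ne_zero (N := N) hq
  cases b <;> simp [crossUnit, this]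

theorem crossUnit_not_mul (hq : q ≠ 0) (b : Bool) :
    crossUnit N q (!b) * crossUnit N q b = 1 := by
  rw [mul_comm, crossUnit_mul_not hq]

theorem diag_mul_not (hq : q ≠ 0) (b : Bool) : diag q b * diag q (!b) = 1 := by
  cases b <;> simp [diag, hq]

theorem theta_self (b : Bool) (x : Fin N) : theta q b x x = 0 := by
  cases b <;> simp [theta]

theorem theta_not (b : Bool) (x y : Fin N) : theta q (!b) x y = -theta q b y x := by
  cases b <;> simp [theta] <;> split_ifs <;> simp

theorem sum_lt_of_sub (f g : ℕ → ℝ) (h : ∀ n, g (n + 1) - g n = f n) (x : Fin N) :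
    ∑ s : Fin N, (if s < x then f s else 0) = g x - g 0 := by
  simp only [Fin.lt_def]
  rw [Fin.sum_univ_eq_sum_range (fun s => if s < (x : ℕ) then f s else 0) N,
    ← Finset.sum_filter,
    show (Finset.range N).filter (· < (x : ℕ)) = Finset.range x by ext; simp; omega,
    ← Finset.sum_range_sub g]
  exact Finset.sum_congr rfl fun n _ => (h n).symm

theorem sum_gt_of_sub (f g : ℕ → ℝ) (h : ∀ n, g (n + 1) - g n = f n) (x : Fin N) :
    ∑ s : Fin N, (if x < s then f s else 0) = g N - g (x + 1) := by
  simp only [Fin.lt_def]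
  rw [Fin.sum_univ_eq_sum_range (fun s => if (x : ℕ) < s then f s else 0) N,
    ← Finset.sum_filter,
    show (Finset.range N).filter ((x : ℕ) < ·) = Finset.Ico ((x : ℕ) + 1) N by ext; simp; omega,
    ← Finset.sum_Ico_sub g (by omega)]
  exact Finset.sum_congr rfl fun n _ => (h n).symm

/-- A geometric series. With the diagonal term moved to the left, it says that the partial quantum
trace of the R-matrix is a scalar independent of the color `x`, which is what the first Reidemeister
move needs. -/
theorem sum_theta_mul_inv_kappa (hq : q ≠ 0) (b : Bool) (x : Fin N) :
    ∑ s, theta q b s x * (kappa q s)⁻¹ = crossUnit N q (!b) - diag q b * (kappa q x)⁻¹ := by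
  -- The summand is a difference of consecutive values of `-q ^ (N - 2 n)`, so sums over `s < x` and
  -- over `x < s` telescope.
  have h : ∀ n : ℕ, -q ^ ((N : ℤ) - 2 * ((n + 1 : ℕ) : ℤ)) - -q ^ ((N : ℤ) - 2 * (n : ℤ))
      = (q - q⁻¹) * (q ^ (1 - (N : ℤ) + 2 * (n : ℤ)))⁻¹ := by
    intro n
    rw [← zpow_neg, show -(1 - (N : ℤ) + 2 * (n : ℤ)) = N - 2 * n - 1 by ring,
      show (N : ℤ) - 2 * ((n + 1 : ℕ) : ℤ) = N - 2 * n - 1 - 1 by push_cast; ring,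
      show (N : ℤ) - 2 * (n : ℤ) = N - 2 * n - 1 + 1 by ring, zpow_sub_one₀ hq, zpow_add_one₀ hq]
    simp only [sub_add_cancel]
    ring
  cases b
  · have := sum_gt_of_sub (fun n => (q - q⁻¹) * (q ^ (1 - (N : ℤ) + 2 * (n : ℤ)))⁻¹)
      (fun n => -q ^ ((N : ℤ) - 2 * (n : ℤ))) h x
    beta_reduce at this
    simp only [theta, Bool.false_eq_true, if_false, ite_mul, zero_mul, neg_mul, crossUnit,
      Bool.not_false, if_true, diag]
    have e : ∀ s : Fin N, (if x < s then -((q - q⁻¹) * (kappa q s)⁻¹) else 0)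
        = -(if x < s then (q - q⁻¹) * (q ^ (1 - (N : ℤ) + 2 * ((s : ℕ) : ℤ)))⁻¹ else 0) := by
      intro s; split_ifs <;> simp [kappa]
    rw [Finset.sum_congr rfl fun s _ => e s, Finset.sum_neg_distrib, this, kappa, vval, ← zpow_neg,
      show -(1 - (N : ℤ) + 2 * ((x : ℕ) : ℤ)) = N - 2 * ((x + 1 : ℕ) : ℤ) + 1 by push_cast; ring,
      zpow_add_one₀ hq, show (N : ℤ) - 2 * N = -N by ring]
    field_simp
    ring
  · have := sum_lt_of_sub (fun n => (q - q⁻¹) * (q ^ (1 - (N : ℤ) + 2 * (n : ℤ)))⁻¹)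
      (fun n => -q ^ ((N : ℤ) - 2 * (n : ℤ))) h x
    beta_reduce at this
    simp only [theta, if_true, ite_mul, zero_mul, crossUnit,
      Bool.not_true, Bool.false_eq_true, if_false, diag]
    have e : ∀ s : Fin N, (if s < x then ((q - q⁻¹) * (kappa q s)⁻¹) else 0)
        = (if s < x then (q - q⁻¹) * (q ^ (1 - (N : ℤ) + 2 * ((s : ℕ) : ℤ)))⁻¹ else 0) := by
      intro s; rfl
    rw [Finset.sum_congr rfl fun s _ => e s, this, kappa, vval, ← zpow_neg, ← zpow_neg,
      show -(1 - (N : ℤ) + 2 * ((x : ℕ) : ℤ)) = N - 2 * (x : ℕ) - 1 by ring,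
      zpow_sub_one₀ hq]
    simp
    field_simp
    ring

theorem sum_theta_mul_kappa (hq : q ≠ 0) (b : Bool) (x : Fin N) :
    ∑ s, theta q b x s * kappa q s = crossUnit N q (!b) - diag q b * kappa q x := by
  have h : ∀ n : ℕ, q ^ (2 * ((n + 1 : ℕ) : ℤ) - N) - q ^ (2 * (n : ℤ) - N)
      = (q - q⁻¹) * (q ^ (1 - (N : ℤ) + 2 * (n : ℤ))) := by
    intro n
    rw [show 2 * ((n + 1 : ℕ) : ℤ) - N = 1 - N + 2 * n + 1 by push_cast; ring,
      show 2 * (n : ℤ) - N = 1 - N + 2 * n - 1 by ring, zpow_sub_one₀ hq, zpow_add_one₀ hq]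
    ring
  cases b
  · have := sum_lt_of_sub (fun n => (q - q⁻¹) * (q ^ (1 - (N : ℤ) + 2 * (n : ℤ))))
      (fun n => q ^ (2 * (n : ℤ) - N)) h x
    beta_reduce at this
    simp only [theta, Bool.false_eq_true, if_false, ite_mul, zero_mul, neg_mul, crossUnit,
      Bool.not_false, if_true, diag]
    have e : ∀ s : Fin N, (if s < x then -((q - q⁻¹) * (kappa q s)) else 0)
        = -(if s < x then (q - q⁻¹) * (q ^ (1 - (N : ℤ) + 2 * ((s : ℕ) : ℤ))) else 0) := by
      intro s; split_ifs <;> simp [kappa]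
    rw [Finset.sum_congr rfl fun s _ => e s, Finset.sum_neg_distrib, this, kappa, vval,
      show (1 - (N : ℤ) + 2 * ((x : ℕ) : ℤ)) = 2 * (x : ℕ) - N + 1 by ring, zpow_add_one₀ hq]
    simp
    field_simp
  · have := sum_gt_of_sub (fun n => (q - q⁻¹) * (q ^ (1 - (N : ℤ) + 2 * (n : ℤ))))
      (fun n => q ^ (2 * (n : ℤ) - N)) h x
    beta_reduce at this
    simp only [theta, if_true, ite_mul, zero_mul, crossUnit,
      Bool.not_true, Bool.false_eq_true, if_false, diag]
    have e : ∀ s : Fin N, (if x < s then ((q - q⁻¹) * (kappa q s)) else 0)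
        = (if x < s then (q - q⁻¹) * (q ^ (1 - (N : ℤ) + 2 * ((s : ℕ) : ℤ))) else 0) := by
      intro s; rfl
    rw [Finset.sum_congr rfl fun s _ => e s, this, kappa, vval, ← zpow_neg,
      show 2 * ((((x : ℕ) + 1 : ℕ) : ℤ)) - N = 1 - (N : ℤ) + 2 * ((x : ℕ) : ℤ) + 1 by
        push_cast; ring, zpow_add_one₀ hq, show 2 * (N : ℤ) - N = - -N by ring]
    ring

theorem sum_capWeight_mul_pairWeight (hq : q ≠ 0) (a b : Bool) (s : Fin N) :
    ∑ x, capWeight q (!a) x * pairWeight q a b x s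
      = crossUnit N q (!b) * capWeight q a s - diag q b * capWeight q (!a) s := by
  cases a
  · have e : ∀ x : Fin N, capWeight q (!false) x * pairWeight q false b x s
        = (theta q b s x * kappa q x) * (kappa q s)⁻¹ := by
      intro x; simp [capWeight, pairWeight, mul_assoc]
    have := kappa_ne_zero hq s
    simp only [e, ← Finset.sum_mul, sum_theta_mul_kappa hq]
    simp [capWeight]
    field_simp
  · have e : ∀ x : Fin N, capWeight q (!true) x * pairWeight q true b x s
        = (theta q b x s * (kappa q x)⁻¹) := by
      intro x; simp [capWeight, pairWeight, mul_comm]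
    simp only [e, sum_theta_mul_inv_kappa hq]
    simp [capWeight]

theorem sum_pairWeight_mul_cupWeight (hq : q ≠ 0) (o b : Bool) (x : Fin N) :
    ∑ s, pairWeight q o b x s * cupWeight q o s
      = crossUnit N q (!b) * cupWeight q (!o) x - diag q b * cupWeight q o x := by
  cases o
  · have e : ∀ s : Fin N, pairWeight q false b x s * cupWeight q false s
        = kappa q x * (theta q b s x * (kappa q s)⁻¹) := by
      intro x; simp [cupWeight, pairWeight]; ring
    have := kappa_ne_zero hq x
    simp only [e, ← Finset.mul_sum, sum_theta_mul_inv_kappa hq]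
    simp [cupWeight]
    field_simp
  · have e : ∀ s : Fin N, pairWeight q true b x s * cupWeight q true s
        = (theta q b x s * (kappa q s)) := by
      intro x; simp [cupWeight, pairWeight]
    simp only [e, sum_theta_mul_kappa hq]
    simp [cupWeight]

end Weights

/-! ### Identities between the operators -/

section Operators

open scoped Stream'

variable {N : ℕ} {q : ℝ}

theorem sliceOp_zero (g : Piece) (l : List Bool) : sliceOp N q g 0 l = baseOp N q g l := rfl

theorem sliceOp_succ (g : Piece) (i : ℕ) (a : Bool) (l : List Bool) :
    sliceOp N q g (i + 1) (a :: l) = shift (sliceOp N q g i l) := rfl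

theorem capWeight_not_mul_cupWeight (hq : q ≠ 0) (o : Bool) (x : Fin N) :
    capWeight q (!o) x * cupWeight q o x = 1 := by
  have := kappa_ne_zero hq x
  cases o <;> simp [capWeight, cupWeight, this]

/-- The product is supported on `s` strictly between `t` and `x`. Such an interval is the difference
of two rays with one end point removed; this splits the sum over `s` into the one-sided sums that
telescope. -/
theorem theta_mul_theta_left (b : Bool) (t s x : Fin N) :
    theta q b t s * theta q b s x
      = theta q b t x * (theta q b s x - theta q b s t - if s = t then theta q b t x else 0) := by
  cases b <;> simp only [theta, if_true, Bool.false_eq_true, if_false] <;> split_ifs <;>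
    first | omega | ring

theorem theta_mul_theta_right (b : Bool) (t s x : Fin N) :
    theta q b x s * theta q b s t
      = theta q b x t * (theta q b x s - theta q b t s - if s = t then theta q b x t else 0) := by
  cases b <;> simp only [theta, if_true, Bool.false_eq_true, if_false] <;> split_ifs <;>
    first | omega | ring

/-- Where `theta` does not vanish, this is `q - (q - q⁻¹) = q⁻¹` or the same with `q` and `q⁻¹`
exchanged. -/
theorem theta_mul_diag (b : Bool) (t x : Fin N) :
    theta q b t x * (diag q b - theta q b t x) = theta q b t x * diag q (!b) := by
  cases b <;> simp only [theta, diag, if_true, Bool.false_eq_true, if_false, Bool.not_true,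
    Bool.not_false] <;> split_ifs <;> ring

/-- The terms of the second Reidemeister move for antiparallel strands that replace a pair of equal
colors by another such pair: they have to cancel. -/
theorem sum_pairWeight_mul_pairWeight (hq : q ≠ 0) (a b : Bool) (x t : Fin N) :
    ∑ s, pairWeight q (!a) b x s * pairWeight q a (!b) s t
      + diag q b * pairWeight q a (!b) x t + diag q (!b) * pairWeight q (!a) b x t = 0 := by
  have hx := kappa_ne_zero hq x
  have ht := kappa_ne_zero hq t
  cases a
  · have e : ∀ s : Fin N, pairWeight q (!false) b x s * pairWeight q false (!b) s t
        = -(theta q b x s * theta q b s t * kappa q s) * (kappa q t)⁻¹ := by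
      intro s
      simp only [pairWeight, Bool.not_false, if_true, Bool.false_eq_true, if_false, theta_not b]
      ring
    simp only [e, ← Finset.sum_mul, Finset.sum_neg_distrib, theta_mul_theta_right, mul_assoc,
      ← Finset.mul_sum, sub_mul, Finset.sum_sub_distrib, sum_theta_mul_kappa hq, ite_mul, zero_mul,
      Finset.sum_ite_eq', Finset.mem_univ, if_true]
    simp only [pairWeight, Bool.not_false, if_true, Bool.false_eq_true, if_false, theta_not b]
    have := theta_mul_diag (q := q) b x t
    field_simp
    linear_combination (-kappa q t) * this
  · have e : ∀ s : Fin N, pairWeight q (!true) b x s * pairWeight q true (!b) s t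
        = -(theta q b t s * theta q b s x * (kappa q s)⁻¹) * (kappa q x) := by
      intro s
      simp only [pairWeight, Bool.not_true, if_true, Bool.false_eq_true, if_false, theta_not b]
      ring
    simp only [e, ← Finset.sum_mul, Finset.sum_neg_distrib, theta_mul_theta_left, mul_assoc,
      ← Finset.mul_sum, sub_mul, Finset.sum_sub_distrib, sum_theta_mul_inv_kappa hq, ite_mul,
      zero_mul, Finset.sum_ite_eq', Finset.mem_univ, if_true]
    simp only [pairWeight, Bool.not_true, if_true, Bool.false_eq_true, if_false, theta_not b]
    have := theta_mul_diag (q := q) b t x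
    field_simp
    linear_combination (-kappa q x) * this

theorem zigzagLeft_op (hq : q ≠ 0) (o : Bool) :
    shift (capOp (capWeight q (!o))) * cupOp (cupWeight q o) = (1 : Op N) := by
  refine op_ext_cons fun ψ x c => ?_
  simp only [Module.End.mul_apply, shift_cons, capOp_apply, cupOp_apply, mul_ite, mul_zero,
    Finset.sum_ite_eq, Finset.mem_univ, if_true, ← mul_assoc, capWeight_not_mul_cupWeight hq]
  simp

theorem zigzagRight_op (hq : q ≠ 0) (o : Bool) :
    capOp (capWeight q (!o)) * shift (cupOp (cupWeight q o)) = (1 : Op N) := by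
  refine op_ext_cons fun ψ x c => ?_
  simp only [Module.End.mul_apply, shift_cons, capOp_apply, cupOp_apply, mul_ite, mul_zero,
    Finset.sum_ite_eq', Finset.mem_univ, if_true, ← mul_assoc, capWeight_not_mul_cupWeight hq]
  simp

/-- Crossing symmetry: the matrices for the different orientations are quarter turns of each other,
with the weights of the extrema as correction, so a crossing slides along a maximum entry by entry.
The proof distinguishes all coincidences between the four colors. -/
theorem capWeight_mul_crossWeight (hq : q ≠ 0) (s t b : Bool) (x y p r : Fin N) :
    capWeight q s y * crossWeight q s t b x y p r
      = capWeight q s p * crossWeight q t (!s) (!b) p x r y := by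
  have hx := kappa_ne_zero hq x
  have hy := kappa_ne_zero hq y
  have hp := kappa_ne_zero hq p
  by_cases h1 : p = y <;> by_cases h2 : r = x <;> by_cases h3 : p = x <;> by_cases h4 : r = y <;>
    by_cases h5 : x = y <;> by_cases h6 : p = r <;>
    cases s <;> cases t <;> simp_all [crossWeight, capWeight, pairWeight, theta_self, eq_comm]
  all_goals
    have h7 := kappa_ne_zero hq y
    field_simp

theorem crossWeight_mul_cupWeight (hq : q ≠ 0) (s o b : Bool) (x y p w : Fin N) :
    crossWeight q s o b x y p w * cupWeight q o w
      = crossWeight q (!o) s (!b) y w x p * cupWeight q o x := by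
  have hx := kappa_ne_zero hq x
  have hy := kappa_ne_zero hq w
  by_cases h1 : p = y <;> by_cases h2 : w = x <;> by_cases h3 : p = x <;> by_cases h4 : w = y <;>
    by_cases h5 : x = y <;> by_cases h6 : p = w <;>
    cases s <;> cases o <;> simp_all [crossWeight, cupWeight, pairWeight, theta_self, eq_comm]
  · have h7 := kappa_ne_zero hq p
    field_simp
  · have h7 := kappa_ne_zero hq w
    field_simp

theorem capSlide_op (hq : q ≠ 0) (s t b : Bool) :
    shift (capOp (capWeight q s)) * crossOp N q s t b
      = capOp (capWeight q s) * shift (crossOp N q t (!s) (!b)) := by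
  refine op_ext_cons fun ψ x c => ?_
  simp only [Module.End.mul_apply, shift_cons, capOp_apply, crossOp, twoOp_apply,
    Finset.mul_sum, ← mul_assoc, capWeight_mul_crossWeight hq]
  rw [Finset.sum_comm]
  refine Finset.sum_congr rfl fun p _ => ?_
  rw [Finset.sum_comm]

theorem cupSlide_op (hq : q ≠ 0) (s o b : Bool) :
    crossOp N q s o b * shift (cupOp (cupWeight q o))
      = shift (crossOp N q (!o) s (!b)) * cupOp (cupWeight q o) := by
  refine op_ext_cons_cons_cons fun ψ x y w c => ?_
  simp only [Module.End.mul_apply, shift_cons, cupOp_apply, crossOp, twoOp_apply, mul_ite,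
    mul_zero, Finset.sum_ite_irrel, Finset.sum_const_zero, Finset.sum_ite_eq', Finset.mem_univ,
    if_true, Finset.sum_ite_eq, ← mul_assoc, crossWeight_mul_cupWeight hq]

/-- In the contraction the two diagonal terms cancel, and the scalar of the partial trace is inverse
to the factor `crossUnit` of the crossing. -/
theorem r1Cap_op (hq : q ≠ 0) (a b : Bool) :
    capOp (capWeight q (!a)) * crossOp N q a (!a) b = capOp (capWeight q a) := by
  ext ψ c
  simp only [Module.End.mul_apply, capOp_apply, crossOp_anti, if_true]
  simp only [mul_add, mul_left_comm _ (crossUnit N q (!b)), ← Finset.mul_sum,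
    Finset.sum_add_distrib]
  simp only [Finset.mul_sum]
  rw [Finset.sum_comm (γ := Fin N), ← Finset.sum_add_distrib]
  refine Finset.sum_congr rfl fun x _ => ?_
  simp only [← mul_assoc, ← Finset.sum_mul]
  simp only [mul_assoc (crossUnit N q (!b)), ← Finset.mul_sum,
    sum_capWeight_mul_pairWeight hq, Bool.not_not]
  linear_combination (capWeight q a x * ψ (x :: x :: c)) * crossUnit_not_mul (N := N) hq b

theorem r1Cup_op (hq : q ≠ 0) (o b : Bool) :
    crossOp N q o (!o) b * cupOp (cupWeight q o) = cupOp (cupWeight q (!o)) := by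
  refine op_ext_cons_cons fun ψ x y c => ?_
  simp only [Module.End.mul_apply, cupOp_apply, crossOp_anti, if_true]
  by_cases h : x = y
  · simp only [h, if_true, ← mul_assoc, ← Finset.sum_mul, sum_pairWeight_mul_cupWeight hq,
      Bool.not_not]
    linear_combination (cupWeight q (!o) y * ψ c) * crossUnit_not_mul (N := N) hq b
  · simp [h, Ne.symm h]

theorem r2_op_anti (hq : q ≠ 0) (a b : Bool) :
    crossOp N q (!a) a (!b) * crossOp N q a (!a) b = 1 := by
  refine op_ext_cons_cons fun ψ x y c => ?_
  rw [Module.End.mul_apply]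
  have e := crossOp_anti q (!a) (!b) (crossOp N q a (!a) b ψ) x y c
  rw [Bool.not_not, Bool.not_not] at e
  rw [e]
  by_cases h : x = y
  · subst h
    simp only [crossOp_anti, if_true, Module.End.one_apply]
    have h1 : ∑ s, pairWeight q (!a) b x s * ∑ t, pairWeight q a (!b) s t * ψ (t :: t :: c)
        = -∑ t, (diag q b * pairWeight q a (!b) x t + diag q (!b) * pairWeight q (!a) b x t)
            * ψ (t :: t :: c) := by
      rw [← Finset.sum_neg_distrib]
      simp only [Finset.mul_sum]
      rw [Finset.sum_comm]
      refine Finset.sum_congr rfl fun t _ => ?_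
      simp only [← mul_assoc, ← Finset.sum_mul]
      linear_combination ψ (t :: t :: c) * sum_pairWeight_mul_pairWeight hq a b x t
    simp only [mul_add, mul_left_comm _ (crossUnit N q (!b)), Finset.sum_add_distrib]
    simp only [← Finset.mul_sum, h1]
    simp only [add_mul, Finset.sum_add_distrib, Finset.mul_sum, mul_assoc]
    have h2 : ∀ f g : Fin N → ℝ, ∑ s, f s * (diag q (!b) * g s) = ∑ s, diag q (!b) * (f s * g s) := by
      intro f g
      exact Finset.sum_congr rfl fun s _ => mul_left_comm _ _ _
    simp only [h2, ← Finset.mul_sum, mul_neg]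
    have h3 := crossUnit_mul_not (N := N) hq b
    have h4 := diag_mul_not hq b
    linear_combination (ψ (x :: x :: c) * (diag q b * diag q (!b))) * h3 + ψ (x :: x :: c) * h4
  · simp only [h, if_false, crossOp_anti, Ne.symm h, Module.End.one_apply, ← mul_assoc,
      crossUnit_mul_not hq, one_mul]

theorem r2_op_parallel (hq : q ≠ 0) (a b : Bool) :
    crossOp N q a a (!b) * crossOp N q a a b = 1 := by
  refine op_ext_cons_cons fun ψ x y c => ?_
  have h3 := crossUnit_not_mul (N := N) hq b
  have h4 := diag_mul_not hq b
  rw [Module.End.mul_apply, crossOp_parallel, crossOp_parallel, crossOp_parallel]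
  by_cases h : x = y
  · subst h
    simp only [theta_self, if_true, ite_self, zero_mul, add_zero, Module.End.one_apply]
    linear_combination (ψ (x :: x :: c) * (diag q b * diag q (!b))) * h3 + ψ (x :: x :: c) * h4
  · have h5 : theta q b x y * theta q b y x = 0 := by
      cases b <;> simp only [theta, if_true, Bool.false_eq_true, if_false] <;> split_ifs <;>
        first | omega | simp
    simp only [h, Ne.symm h, if_false, theta_not b, Module.End.one_apply, one_mul]
    cases a <;> simp only [if_true, Bool.false_eq_true, if_false] <;>
    linear_combination (ψ (x :: y :: c)) * h3 -
      (crossUnit N q (!b) * crossUnit N q b * ψ (x :: y :: c)) * h5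

/-- The Yang–Baxter equation for upward strands and positive crossings. The weights depend only on
the relative order of the three colors, so every order is a polynomial identity in `q` and `q⁻¹`. -/
theorem r3_op (q : ℝ) (hq : q ≠ 0) :
    crossOp N q true true true * (shift (crossOp N q true true true) * crossOp N q true true true)
      = shift (crossOp N q true true true)
          * (crossOp N q true true true * shift (crossOp N q true true true)) := by
  refine op_ext_cons_cons_cons fun ψ x y w c => ?_
  simp only [Module.End.mul_apply, shift_cons, crossOp_parallel, if_true, diag, theta]
  rcases lt_trichotomy x y with h1 | h1 | h1 <;> rcases lt_trichotomy y w with h2 | h2 | h2 <;>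
    rcases lt_trichotomy x w with h3 | h3 | h3 <;>
    first
    | (exfalso; omega)
    | (try subst h1
       try subst h2
       try subst h3
       simp only [lt_irrefl, if_true, if_false, *, not_lt_of_gt, ne_of_lt, ne_of_gt]
       try field_simp
       try ring)

end Operators

/-! ### The third Reidemeister move for all orientations -/

section ThirdMove

variable {N : ℕ} {q : ℝ}

theorem r2_op (hq : q ≠ 0) (a c b : Bool) :
    crossOp N q c a (!b) * crossOp N q a c b = 1 := by
  by_cases h : c = a
  · subst h
    exact r2_op_parallel hq c b
  · obtain rfl : c = !a := by cases a <;> cases c <;> simp_all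
    exact r2_op_anti hq a b

/-- The third Reidemeister move for strands with orientations `o₁`, `o₂`, `o₃`. -/
def R3 (N : ℕ) (q : ℝ) (o₁ o₂ o₃ a b c : Bool) : Prop :=
  crossOp N q o₂ o₃ c * (shift (crossOp N q o₁ o₃ b) * crossOp N q o₁ o₂ a)
    = shift (crossOp N q o₁ o₂ a) * (crossOp N q o₁ o₃ b * shift (crossOp N q o₂ o₃ c))

/-- Multiplying the third move on both sides by a crossing of the first two strands and cancelling
with `r2_op` gives the third move with these strands exchanged and this crossing inverted. -/
theorem R3.swap_left (hq : q ≠ 0) {o₁ o₂ o₃ a b c : Bool} (h : R3 N q o₂ o₁ o₃ (!a) c b) :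
    R3 N q o₁ o₂ o₃ a b c := by
  unfold R3 at h ⊢
  have h1 := r2_op (N := N) hq o₁ o₂ a
  have h2 : shift (crossOp N q o₁ o₂ a) * shift (crossOp N q o₂ o₁ (!a)) = 1 := by
    have := r2_op (N := N) hq o₂ o₁ (!a)
    rw [Bool.not_not] at this
    rw [← shift_mul, this, shift_one]
  have h3 := congrArg (fun T => shift (crossOp N q o₁ o₂ a) * (T * crossOp N q o₁ o₂ a)) h
  simp only [mul_assoc, h1, mul_one] at h3
  rw [h3, ← mul_assoc (shift _) (shift _), h2, one_mul]

theorem R3.swap_right (hq : q ≠ 0) {o₁ o₂ o₃ a b c : Bool} (h : R3 N q o₁ o₃ o₂ b a (!c)) :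
    R3 N q o₁ o₂ o₃ a b c := by
  unfold R3 at h ⊢
  have h1 : shift (crossOp N q o₃ o₂ (!c)) * shift (crossOp N q o₂ o₃ c) = 1 := by
    rw [← shift_mul, r2_op hq o₂ o₃ c, shift_one]
  have h2 : crossOp N q o₂ o₃ c * crossOp N q o₃ o₂ (!c) = 1 := by
    have := r2_op (N := N) hq o₃ o₂ (!c)
    rwa [Bool.not_not] at this
  have h3 := congrArg
    (fun T => crossOp N q o₂ o₃ c * (T * shift (crossOp N q o₂ o₃ c))) h
  simp only [mul_assoc, h1, mul_one] at h3
  rw [← h3, ← mul_assoc (crossOp N q o₂ o₃ c) (crossOp N q o₃ o₂ (!c)), h2, one_mul]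

/-- The picture of the third move is turned: its last strand is bent back by a minimum on the right
and a maximum on the left, becoming the first strand with reversed orientation. The crossings slide
along the bends, and the zigzag then straightens. -/
theorem R3.rotate (hq : q ≠ 0) {o₁ o₂ o₃ a b c : Bool} (h : R3 N q o₂ o₃ (!o₁) c (!a) (!b)) :
    R3 N q o₁ o₂ o₃ a b c := by
  unfold R3 at h ⊢
  set K : Op N := capOp (capWeight q o₁) with hK
  set U : Op N := cupOp (cupWeight q (!o₁)) with hU
  have slideCap : ∀ t b', K * shift (crossOp N q t (!o₁) (!b')) = shift K * crossOp N q o₁ t b' :=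
    fun t b' => (capSlide_op hq o₁ t b').symm
  have slideCup : ∀ s b', crossOp N q s (!o₁) (!b') * shift U = shift (crossOp N q o₁ s b') * U := by
    intro s b'
    have := cupSlide_op (N := N) hq s (!o₁) (!b')
    rwa [Bool.not_not, Bool.not_not] at this
  have zig : K * shift U = 1 := by
    have := zigzagRight_op (N := N) hq (!o₁)
    rwa [Bool.not_not] at this
  have far : ∀ s t b' T, crossOp N q s t b' * shift (shift T) = shift (shift T) * crossOp N q s t b' :=
    fun s t b' T => (shift_twoOp_comm _ _).symm
  have farCap : ∀ T : Op N, K * shift (shift T) = T * K := fun T => (capOp_shift_comm _ _).symm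
  have key := congrArg (fun T => K * (shift T * shift (shift (shift U)))) h
  simp only [shift_mul] at key
  have e1 : K * (shift (crossOp N q o₃ (!o₁) (!b)) * (shift (shift (crossOp N q o₂ (!o₁) (!a)))
      * shift (crossOp N q o₂ o₃ c)) * shift (shift (shift U)))
      = shift (crossOp N q o₁ o₂ a) * (crossOp N q o₁ o₃ b * shift (crossOp N q o₂ o₃ c)) := by
    calc _ = K * shift (crossOp N q o₃ (!o₁) (!b)) * (shift (shift (crossOp N q o₂ (!o₁) (!a)))
            * shift (crossOp N q o₂ o₃ c * shift (shift U))) := by simp only [shift_mul, mul_assoc]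
      _ = shift K * crossOp N q o₁ o₃ b * (shift (shift (crossOp N q o₂ (!o₁) (!a) * shift U))
            * shift (crossOp N q o₂ o₃ c)) := by
          rw [slideCap, far]; simp only [shift_mul, mul_assoc]
      _ = shift K * (crossOp N q o₁ o₃ b * shift (shift (shift (crossOp N q o₁ o₂ a) * U)))
            * shift (crossOp N q o₂ o₃ c) := by
          rw [slideCup]; simp only [mul_assoc]
      _ = shift (K * shift (shift (crossOp N q o₁ o₂ a)) * shift U) * crossOp N q o₁ o₃ b
            * shift (crossOp N q o₂ o₃ c) := by
          rw [far]; simp only [shift_mul, mul_assoc]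
      _ = _ := by
          rw [farCap, mul_assoc _ K, zig, mul_one, mul_assoc]
  have e2 : K * (shift (shift (crossOp N q o₂ o₃ c)) * (shift (crossOp N q o₂ (!o₁) (!a))
      * shift (shift (crossOp N q o₃ (!o₁) (!b)))) * shift (shift (shift U)))
      = crossOp N q o₂ o₃ c * (shift (crossOp N q o₁ o₃ b) * crossOp N q o₁ o₂ a) := by
    calc _ = K * shift (shift (crossOp N q o₂ o₃ c)) * (shift (crossOp N q o₂ (!o₁) (!a))
            * shift (shift (crossOp N q o₃ (!o₁) (!b) * shift U))) := by
          simp only [shift_mul, mul_assoc]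
      _ = crossOp N q o₂ o₃ c * (K * shift (crossOp N q o₂ (!o₁) (!a)))
            * shift (shift (shift (crossOp N q o₁ o₃ b) * U)) := by
          rw [farCap, slideCup]; simp only [mul_assoc]
      _ = crossOp N q o₂ o₃ c * shift K
            * (crossOp N q o₁ o₂ a * shift (shift (shift (crossOp N q o₁ o₃ b) * U))) := by
          rw [slideCap]; simp only [mul_assoc]
      _ = crossOp N q o₂ o₃ c * (shift (K * shift (shift (crossOp N q o₁ o₃ b)) * shift U)
            * crossOp N q o₁ o₂ a) := by
          rw [far]; simp only [shift_mul, mul_assoc]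
      _ = _ := by
          rw [farCap, mul_assoc _ K, zig, mul_one]
  rw [← e1, ← e2]
  exact key.symm

/-- For upward strands, `swap_left` and `swap_right` carry the all-positive case to all six sign
patterns that are not cyclic. -/
theorem R3.up (hq : q ≠ 0) (a b c : Bool) (h : b = a ∨ b = c) : R3 N q true true true a b c := by
  have ttt : R3 N q true true true true true true := r3_op q hq
  have ftt : R3 N q true true true false true true := R3.swap_left hq ttt
  have ttf : R3 N q true true true true true false := R3.swap_right hq ttt
  have tff : R3 N q true true true true false false := R3.swap_right hq ftt
  have fft : R3 N q true true true false false true := R3.swap_left hq ttf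
  have fff : R3 N q true true true false false false := R3.swap_left hq tff
  cases a <;> cases b <;> cases c <;> first | assumption | simp at h

/-- Turning and swapping preserve the condition on the signs, and starting from three upward strands
they reach all eight orientations. -/
theorem R3.all (hq : q ≠ 0) (o₁ o₂ o₃ a b c : Bool) (h : b = a ∨ b = c) :
    R3 N q o₁ o₂ o₃ a b c := by
  let Good (o₁ o₂ o₃ : Bool) : Prop := ∀ a b c, (b = a ∨ b = c) → R3 N q o₁ o₂ o₃ a b c
  have rotate : ∀ o₁ o₂ o₃, Good o₂ o₃ (!o₁) → Good o₁ o₂ o₃ := fun o₁ o₂ o₃ g a b c h =>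
    R3.rotate hq (g _ _ _ (by revert a b c; decide))
  have left : ∀ o₁ o₂ o₃, Good o₂ o₁ o₃ → Good o₁ o₂ o₃ := fun o₁ o₂ o₃ g a b c h =>
    R3.swap_left hq (g _ _ _ (by revert a b c; decide))
  have right : ∀ o₁ o₂ o₃, Good o₁ o₃ o₂ → Good o₁ o₂ o₃ := fun o₁ o₂ o₃ g a b c h =>
    R3.swap_right hq (g _ _ _ (by revert a b c; decide))
  have uuu : Good true true true := R3.up hq
  have duu : Good false true true := rotate _ _ _ uuu
  have udu : Good true false true := left _ _ _ duu
  have uud : Good true true false := right _ _ _ udu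
  have ddu : Good false false true := rotate _ _ _ duu
  have dud : Good false true false := right _ _ _ ddu
  have udd : Good true false false := left _ _ _ dud
  have ddd : Good false false false := rotate _ _ _ ddu
  have all : Good o₁ o₂ o₃ := by
    cases o₁ <;> cases o₂ <;> cases o₃ <;> assumption
  exact all a b c h

end ThirdMove

/-! ### Invariance of the state sum -/

section Invariance

variable {N : ℕ} {q : ℝ}

theorem pos_le_of_run {x : Slice} {u : List Slice} {l l' : List Bool}
    (h : run (x :: u) l = some l') : x.pos ≤ l.length := by
  simp only [run, Option.bind_eq_some_iff] at h
  obtain ⟨l'', h1, -⟩ := h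
  exact pos_le_of_act h1

theorem act_zero (g : Piece) (l : List Bool) : (Slice.mk 0 g).act l = g.act l := by
  simp [Slice.act]

theorem act_succ (g : Piece) (i : ℕ) (a : Bool) (l : List Bool) :
    (Slice.mk (i + 1) g).act (a :: l) = ((Slice.mk i g).act l).map (a :: ·) := by
  have := act_lift [a] l i g
  rwa [List.length_singleton, add_comm] at this

theorem act_succ_nil (g : Piece) (i : ℕ) : (Slice.mk (i + 1) g).act [] = none := by
  simp [Slice.act]

/-- The stacks agree wherever both of them fit. -/
def SameOpWhereDefined (N : ℕ) (q : ℝ) (u u' : List Slice) : Prop :=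
  ∀ l l' l'', run u l = some l' → run u' l = some l'' → SameOp N q l u u'

theorem SameOpWhereDefined.lift {u u' : List Slice} (h : SameOpWhereDefined N q u u')
    {i : ℕ} {l l' l'' : List Bool} (hi : i ≤ l.length) (h1 : run (lift i u) l = some l')
    (h2 : run (OrientedLinks.lift i u') l = some l'') :
    SameOp N q l (OrientedLinks.lift i u) (OrientedLinks.lift i u') := by
  obtain ⟨l₁, l₂, rfl, rfl⟩ : ∃ l₁ l₂, l = l₁ ++ l₂ ∧ i = l₁.length :=
    ⟨l.take i, l.drop i, by simp, by simp [hi]⟩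
  rw [run_lift, Option.map_eq_some_iff] at h1 h2
  obtain ⟨m, h1, -⟩ := h1
  obtain ⟨m', h2, -⟩ := h2
  exact (h l₂ m m' h1 h2).lift l₁

theorem sameOp_commute (g h : Piece) (k : ℕ) :
    SameOpWhereDefined N q [⟨0, g⟩, ⟨g.top + k, h⟩] [⟨g.bot + k, h⟩, ⟨0, g⟩] := by
  intro l l' l'' h1 h2
  cases g with
  | cup o =>
    simp only [run, Piece.top, act_zero, Piece.act, Option.bind_some,
      Option.bind_eq_some_iff, add_comm 2 k, act_succ] at h1
    obtain ⟨m, h1, -⟩ := h1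
    simp only [Option.map_eq_some_iff] at h1
    obtain ⟨m', ⟨m'', h1, rfl⟩, rfl⟩ := h1
    refine ⟨o :: (!o) :: m'', ?_, ?_, ?_⟩
    · simp [run, act_zero, Piece.act, Piece.top, add_comm 2 k, act_succ, h1]
    · simp [run, act_zero, Piece.act, Piece.bot, h1]
    · simp only [stateOp, Piece.top, Piece.bot, act_zero, Piece.act, Option.getD_some,
        add_comm 2 k, sliceOp_succ, sliceOp_zero, baseOp, one_mul, zero_add]
      exact shift_cupOp_comm _ _
  | cap =>
    rcases l with _ | ⟨a, _ | ⟨c, l⟩⟩ <;>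
      simp only [run, Piece.top, act_zero, Piece.act, Option.bind_none, reduceCtorEq]
        at h1
    by_cases hc : c = !a
    · subst hc
      simp only [if_true, Option.bind_some, zero_add, Option.bind_eq_some_iff] at h1
      obtain ⟨m, h1, -⟩ := h1
      refine ⟨m, ?_, ?_, ?_⟩
      · simp [run, act_zero, Piece.act, Piece.top, h1]
      · simp [run, act_zero, Piece.act, Piece.bot, add_comm 2 k, act_succ, h1]
      · simp only [stateOp, Piece.top, Piece.bot, act_zero, Piece.act, Option.getD_some,
          add_comm 2 k, sliceOp_succ, sliceOp_zero, baseOp, one_mul, zero_add, act_succ, h1,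
          Option.map_some, if_true]
        exact capOp_shift_comm _ _
    · simp [hc] at h1
  | cross b =>
    rcases l with _ | ⟨a, _ | ⟨c, l⟩⟩ <;>
      simp only [run, Piece.top, act_zero, Piece.act, Option.bind_none, reduceCtorEq,
        add_comm 2 k, act_succ, Option.bind_some, Option.bind_eq_some_iff, Option.map_eq_some_iff]
        at h1
    obtain ⟨m, ⟨-, ⟨m', h1, rfl⟩, rfl⟩, -⟩ := h1
    refine ⟨c :: a :: m', ?_, ?_, ?_⟩
    · simp [run, act_zero, Piece.act, Piece.top, add_comm 2 k, act_succ, h1]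
    · simp [run, act_zero, Piece.act, Piece.bot, add_comm 2 k, act_succ, h1]
    · simp only [stateOp, Piece.top, Piece.bot, act_zero, Piece.act, Option.getD_some,
        add_comm 2 k, sliceOp_succ, sliceOp_zero, baseOp, one_mul, act_succ, h1, Option.map_some]
      exact shift_twoOp_comm _ _
  | double =>
    rcases l with _ | ⟨a, _ | ⟨c, l⟩⟩ <;>
      simp only [run, Piece.top, act_zero, Piece.act, Option.bind_none, reduceCtorEq,
        add_comm 2 k, act_succ, Option.bind_some, Option.bind_eq_some_iff, Option.map_eq_some_iff]
        at h1
    obtain ⟨m, ⟨-, ⟨m', h1, rfl⟩, rfl⟩, -⟩ := h1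
    refine ⟨c :: a :: m', ?_, ?_, ?_⟩
    · simp [run, act_zero, Piece.act, Piece.top, add_comm 2 k, act_succ, h1]
    · simp [run, act_zero, Piece.act, Piece.bot, add_comm 2 k, act_succ, h1]
    · simp only [stateOp, Piece.top, Piece.bot, act_zero, Piece.act, Option.getD_some,
        add_comm 2 k, sliceOp_succ, sliceOp_zero, baseOp, one_mul, act_succ, h1, Option.map_some]
      exact shift_twoOp_comm _ _

theorem sameOp_zigzagLeft (hq : q ≠ 0) (o : Bool) :
    SameOpWhereDefined N q [⟨0, .cup o⟩, ⟨1, .cap⟩] [] := by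
  intro l l' l'' h1 h2
  rcases l with _ | ⟨a, l⟩
  · simp [run, act_zero, Piece.act, act_succ] at h1
  · simp [run, act_zero, Piece.act, act_succ] at h1
    obtain ⟨rfl, -⟩ := h1
    refine ⟨a :: l, ?_, rfl, ?_⟩
    · simp [run, act_zero, Piece.act, act_succ]
    · simp [stateOp, act_zero, Piece.act, sliceOp_succ, sliceOp_zero, baseOp,
        zigzagLeft_op hq]

theorem sameOp_zigzagRight (hq : q ≠ 0) (o : Bool) :
    SameOpWhereDefined N q [⟨1, .cup o⟩, ⟨0, .cap⟩] [] := by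
  intro l l' l'' h1 h2
  rcases l with _ | ⟨a, l⟩
  · simp [run, act_succ_nil] at h1
  · simp [run, act_zero, Piece.act, act_succ] at h1
    obtain ⟨h, -⟩ := h1
    obtain rfl : a = !o := by simp [h]
    refine ⟨(!o) :: l, ?_, rfl, ?_⟩
    · simp [run, act_zero, Piece.act, act_succ]
    · simp [stateOp, act_zero, Piece.act, act_succ, sliceOp_succ, sliceOp_zero, baseOp,
        zigzagRight_op hq]

theorem sameOp_capSlide (hq : q ≠ 0) (b : Bool) :
    SameOpWhereDefined N q [⟨0, .cross b⟩, ⟨1, .cap⟩] [⟨1, .cross (!b)⟩, ⟨0, .cap⟩] := by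
  intro l l' l'' h1 h2
  rcases l with _ | ⟨a, _ | ⟨c, _ | ⟨d, l⟩⟩⟩ <;> simp [run, act_zero, Piece.act, act_succ] at h1
  obtain ⟨rfl, rfl⟩ := h1
  refine ⟨c :: l, ?_, ?_, ?_⟩
  · simp [run, act_zero, Piece.act, act_succ]
  · simp [run, act_zero, Piece.act, act_succ]
  · simp [stateOp, act_zero, Piece.act, act_succ, sliceOp_succ, sliceOp_zero, baseOp,
        capSlide_op hq]

theorem sameOp_cupSlide (hq : q ≠ 0) (o b : Bool) :
    SameOpWhereDefined N q [⟨1, .cup o⟩, ⟨0, .cross b⟩] [⟨0, .cup o⟩, ⟨1, .cross (!b)⟩] := by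
  intro l l' l'' h1 h2
  rcases l with _ | ⟨a, l⟩ <;> simp [run, act_zero, Piece.act, act_succ, act_succ_nil] at h1
  refine ⟨o :: a :: (!o) :: l, ?_, ?_, ?_⟩
  · simp [run, act_zero, Piece.act, act_succ]
  · simp [run, act_zero, Piece.act, act_succ]
  · simp [stateOp, act_zero, Piece.act, act_succ, sliceOp_succ, sliceOp_zero, baseOp,
        cupSlide_op hq]

theorem sameOp_r1Cap (hq : q ≠ 0) (b : Bool) :
    SameOpWhereDefined N q [⟨0, .cross b⟩, ⟨0, .cap⟩] [⟨0, .cap⟩] := by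
  intro l l' l'' h1 h2
  rcases l with _ | ⟨a, _ | ⟨c, l⟩⟩ <;> simp [run, act_zero, Piece.act] at h2
  obtain ⟨rfl, rfl⟩ := h2
  refine ⟨l, ?_, ?_, ?_⟩
  · simp [run, act_zero, Piece.act]
  · simp [run, act_zero, Piece.act]
  · simp [stateOp, act_zero, Piece.act, sliceOp_zero, baseOp, r1Cap_op hq]

theorem sameOp_r1Cup (hq : q ≠ 0) (o b : Bool) :
    SameOpWhereDefined N q [⟨0, .cup o⟩, ⟨0, .cross b⟩] [⟨0, .cup (!o)⟩] := by
  intro l l' l'' h1 h2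
  refine ⟨(!o) :: o :: l, ?_, ?_, ?_⟩
  · simp [run, act_zero, Piece.act]
  · simp [run, act_zero, Piece.act]
  · simp [stateOp, act_zero, Piece.act, sliceOp_zero, baseOp, r1Cup_op hq]

theorem sameOp_r2 (hq : q ≠ 0) (b : Bool) :
    SameOpWhereDefined N q [⟨0, .cross b⟩, ⟨0, .cross (!b)⟩] [] := by
  intro l l' l'' h1 h2
  rcases l with _ | ⟨a, _ | ⟨c, l⟩⟩ <;> simp [run, act_zero, Piece.act] at h1
  refine ⟨a :: c :: l, ?_, rfl, ?_⟩
  · simp [run, act_zero, Piece.act]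
  · simp [stateOp, act_zero, Piece.act, sliceOp_zero, baseOp, r2_op hq]

theorem sameOp_r3 (hq : q ≠ 0) (a b c : Bool) (h : b = a ∨ b = c) :
    SameOpWhereDefined N q [⟨0, .cross a⟩, ⟨1, .cross b⟩, ⟨0, .cross c⟩]
      [⟨1, .cross c⟩, ⟨0, .cross b⟩, ⟨1, .cross a⟩] := by
  intro l l' l'' h1 h2
  rcases l with _ | ⟨o₁, _ | ⟨o₂, _ | ⟨o₃, l⟩⟩⟩ <;>
    simp [run, act_zero, Piece.act, act_succ] at h1
  refine ⟨o₃ :: o₂ :: o₁ :: l, ?_, ?_, ?_⟩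
  · simp [run, act_zero, Piece.act, act_succ]
  · simp [run, act_zero, Piece.act, act_succ]
  · have := R3.all (N := N) hq o₁ o₂ o₃ a b c h
    simp [stateOp, act_zero, Piece.act, act_succ, sliceOp_succ, sliceOp_zero, baseOp]
    simpa [R3, mul_assoc] using this

/-- Strands to the left are only carried along by `shift`, so every move reduces to position `0`,
where it is one of the operator identities above. -/
theorem LocalMove.sameOp (hq : q ≠ 0) {u u' : List Slice} (h : LocalMove u u') :
    SameOpWhereDefined N q u u' := by
  intro l l' l'' h1 h2
  have key : ∀ (i : ℕ) (w w' : List Slice), SameOpWhereDefined N q w w' → u = lift i w →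
      u' = lift i w' → i ≤ l.length → SameOp N q l u u' := by
    rintro i w w' hw rfl rfl hi
    exact hw.lift hi h1 h2
  cases h with
  | commute i k g h =>
    exact key i _ _ (sameOp_commute g h k) (by simp [lift, add_assoc]) (by simp [lift, add_assoc])
      (pos_le_of_run h1)
  | zigzagLeft i o =>
    exact key i _ _ (sameOp_zigzagLeft hq o) (by simp [lift]) (by simp [lift])
      (pos_le_of_run h1)
  | zigzagRight i o =>
    exact key i _ _ (sameOp_zigzagRight hq o) (by simp [lift]) (by simp [lift])
      ((Nat.le_succ i).trans (pos_le_of_run h1))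
  | capSlide i b =>
    exact key i _ _ (sameOp_capSlide hq b) (by simp [lift]) (by simp [lift]) (pos_le_of_run h1)
  | cupSlide i o b =>
    exact key i _ _ (sameOp_cupSlide hq o b) (by simp [lift]) (by simp [lift])
      ((Nat.le_succ i).trans (pos_le_of_run h1))
  | r1Cap i b =>
    exact key i _ _ (sameOp_r1Cap hq b) (by simp [lift]) (by simp [lift]) (pos_le_of_run h1)
  | r1Cup i o b =>
    exact key i _ _ (sameOp_r1Cup hq o b) (by simp [lift]) (by simp [lift]) (pos_le_of_run h1)
  | r2 i b =>
    exact key i _ _ (sameOp_r2 hq b) (by simp [lift]) (by simp [lift]) (pos_le_of_run h1)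
  | r3 i a b c h =>
    exact key i _ _ (sameOp_r3 hq a b c h) (by simp [lift]) (by simp [lift]) (pos_le_of_run h1)

end Invariance

/-! ### The skein relation for the state sum -/

section Skein

variable {N : ℕ} {q : ℝ}

theorem exists_split {l : List Bool} {i : ℕ} (hi : i + 1 < l.length) :
    ∃ l₁ a c l₂, l = l₁ ++ a :: c :: l₂ ∧ i = l₁.length := by
  refine ⟨l.take i, l[i], l[i + 1], l.drop (i + 2), ?_, ?_⟩
  · rw [List.cons_getElem_drop_succ (n := i + 1), List.cons_getElem_drop_succ,
      List.take_append_drop]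
  · simp; omega

theorem positiveType_append (l₁ l₂ : List Bool) (a c : Bool) :
    positiveType (l₁ ++ a :: c :: l₂) l₁.length = decide (a = c) := by
  simp [positiveType]

theorem smoothing_append (l₁ l₂ : List Bool) (a c : Bool) :
    smoothing (l₁ ++ a :: c :: l₂) l₁.length
      = lift l₁.length (if a = c then [] else [⟨0, .cap⟩, ⟨0, .cup c⟩]) := by
  simp only [smoothing]
  split_ifs with h h' h' <;> simp_all [lift]

theorem run_cross (l₁ l₂ : List Bool) (a c b : Bool) :
    run [⟨l₁.length, .cross b⟩] (l₁ ++ a :: c :: l₂) = some (l₁ ++ c :: a :: l₂) := by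
  simpa [lift, run, act_zero, Piece.act] using run_lift l₁ (a :: c :: l₂) [⟨0, .cross b⟩]

theorem run_smoothing (l₁ l₂ : List Bool) (a c : Bool) :
    run (smoothing (l₁ ++ a :: c :: l₂) l₁.length) (l₁ ++ a :: c :: l₂)
      = some (l₁ ++ c :: a :: l₂) := by
  rw [smoothing_append, run_lift]
  by_cases h : a = c
  · simp [h, run]
  · have h' : c = !a := by cases a <;> cases c <;> simp_all
    simp [run, act_zero, Piece.act, h']

theorem iterate_shift_sub (n : ℕ) (T U : Op N) :
    shift^[n] (T - U) = shift^[n] T - shift^[n] U := by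
  induction n with
  | zero => rfl
  | succ n ih => rw [Function.iterate_succ_apply', ih]; simp only [Function.iterate_succ_apply']; rfl

theorem iterate_shift_smul (n : ℕ) (r : ℝ) (T : Op N) :
    shift^[n] (r • T) = r • shift^[n] T := by
  induction n with
  | zero => rfl
  | succ n ih => rw [Function.iterate_succ_apply', ih]; simp only [Function.iterate_succ_apply']; rfl

/-- The Hecke relation: the R-matrix minus its inverse is the scalar `q - q⁻¹`. The writhe factors
are cancelled by the coefficients. -/
theorem crossOp_skein_parallel (hq : q ≠ 0) (a : Bool) :
    (vval N q)⁻¹ • crossOp N q a a true - vval N q • crossOp N q a a false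
      = (q - q⁻¹) • (1 : Op N) := by
  have h := vval_ne_zero (N := N) hq
  refine op_ext_cons_cons fun ψ x y c => ?_
  simp only [LinearMap.sub_apply, LinearMap.smul_apply, Pi.sub_apply, Pi.smul_apply,
    crossOp_parallel, smul_eq_mul, crossUnit, if_true, Bool.false_eq_true, if_false,
    ← mul_assoc, inv_mul_cancel₀ h, mul_inv_cancel₀ h, one_mul, Module.End.one_apply]
  by_cases hxy : x = y
  · subst hxy
    simp [theta_self, diag, sub_mul]
  · simp only [hxy, if_false, theta, if_true, Bool.false_eq_true]
    cases a <;> simp only [if_true, Bool.false_eq_true, if_false] <;> split_ifs <;>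
      first | omega | ring

theorem crossOp_skein_anti (hq : q ≠ 0) (a : Bool) :
    (vval N q)⁻¹ • crossOp N q a (!a) false - vval N q • crossOp N q a (!a) true
      = (q - q⁻¹) • (cupOp (cupWeight q (!a)) * capOp (capWeight q a) : Op N) := by
  have h := vval_ne_zero (N := N) hq
  refine op_ext_cons_cons fun ψ x y c => ?_
  simp only [LinearMap.sub_apply, LinearMap.smul_apply, Pi.sub_apply, Pi.smul_apply,
    crossOp_anti, smul_eq_mul, crossUnit, if_true, Bool.false_eq_true, if_false, Bool.not_true,
    Bool.not_false, ← mul_assoc, inv_mul_cancel₀ h, mul_inv_cancel₀ h, one_mul,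
    Module.End.mul_apply, cupOp_apply, capOp_apply]
  by_cases hxy : x = y
  · subst hxy
    simp only [if_true, diag, Bool.false_eq_true, if_false]
    rw [add_sub_add_comm, ← sub_mul, ← Finset.sum_sub_distrib]
    have h1 : ∀ s, pairWeight q a true x s * ψ (Stream'.cons s (Stream'.cons s c))
        - pairWeight q a false x s * ψ (Stream'.cons s (Stream'.cons s c))
        = (q - q⁻¹) * cupWeight q (!a) x
            * (capWeight q a s * ψ (Stream'.cons s (Stream'.cons s c)))
          - if x = s then (q - q⁻¹) * ψ (Stream'.cons s (Stream'.cons s c)) else 0 := by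
      -- For `x ≠ s` only one of the two pair weights is nonzero, and each sign gives the product of
      -- the weights of a minimum and a maximum; for `x = s` both vanish, and the missing entry is
      -- supplied by the diagonal term `q - q⁻¹`.
      intro s
      have hx := kappa_ne_zero hq x
      rcases lt_trichotomy x s with h2 | h2 | h2
      · have h3 := not_lt_of_gt h2
        have h4 := ne_of_lt h2
        cases a <;> simp [pairWeight, theta, cupWeight, capWeight, h2, h3, h4] <;> ring
      · subst h2
        cases a <;> simp [pairWeight, theta_self, cupWeight, capWeight]
        field_simp
        ring
      · have h3 := not_lt_of_gt h2
        have h4 := ne_of_gt h2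
        cases a <;> simp [pairWeight, theta, cupWeight, capWeight, h2, h3, h4] <;> ring
    rw [Finset.sum_congr rfl fun s _ => h1 s, Finset.sum_sub_distrib]
    simp [Finset.mul_sum, mul_assoc]
  · simp [hxy]

theorem stateOp_skein (hq : q ≠ 0) {l : List Bool} {i : ℕ} (hi : i + 1 < l.length) :
    (vval N q)⁻¹ • stateOp N q [⟨i, .cross (positiveType l i)⟩] l
        - vval N q • stateOp N q [⟨i, .cross (!positiveType l i)⟩] l
      = (q - q⁻¹) • stateOp N q (smoothing l i) l := by
  obtain ⟨l₁, a, c, l₂, rfl, rfl⟩ := exists_split hi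
  have h1 : ∀ b, stateOp N q [⟨l₁.length, .cross b⟩] (l₁ ++ a :: c :: l₂)
      = shift^[l₁.length] (crossOp N q a c b) := by
    intro b
    simpa [lift, stateOp, sliceOp_zero, baseOp] using
      stateOp_lift (N := N) q l₁ (u := [⟨0, .cross b⟩]) (l := a :: c :: l₂) (by rfl)
  rw [h1, h1, smoothing_append, positiveType_append]
  by_cases h : a = c
  · subst h
    rw [stateOp_lift (l := a :: a :: l₂) q l₁ (by simp; rfl)]
    simp only [← iterate_shift_smul, ← iterate_shift_sub, decide_true, Bool.not_true,
      crossOp_skein_parallel hq, if_true, stateOp]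
  · obtain rfl : c = !a := by cases a <;> cases c <;> simp_all
    rw [stateOp_lift (l := a :: (!a) :: l₂) (l' := (!a) :: a :: l₂) q l₁
      (by simp [run, act_zero, Piece.act])]
    simp only [← iterate_shift_smul, ← iterate_shift_sub, h, decide_false, Bool.not_false,
      crossOp_skein_anti hq, if_false, stateOp]
    simp [sliceOp_zero, baseOp, act_zero, Piece.act]

end Skein

/-! ### The number of components -/

section Components

open scoped Stream'

/-- The sequence `c` starts with the values of `g` at the given arcs. -/
def Agrees (g : ℕ → Fin 2) (arcs : List ℕ) (c : Stream' (Fin 2)) : Prop :=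
  c.take arcs.length = arcs.map g

theorem agrees_append (g : ℕ → Fin 2) (l r : List ℕ) (cl : List (Fin 2)) (c : Stream' (Fin 2))
    (h : cl.length = l.length) :
    Agrees g (l ++ r) (cl ++ₛ c) ↔ cl = l.map g ∧ Agrees g r c := by
  induction l generalizing cl with
  | nil =>
    obtain rfl : cl = [] := by simpa using h
    simp [Agrees]
  | cons a l ih =>
    rcases cl with _ | ⟨x, cl⟩
    · simp at h
    · have := ih cl (by simpa using h)
      simp only [Agrees] at this ⊢
      simp [Stream'.cons_append_stream, Stream'.take_succ, and_assoc]
      intro _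
      simpa using this

theorem agrees_cons (g : ℕ → Fin 2) (a : ℕ) (r : List ℕ) (x : Fin 2) (c : Stream' (Fin 2)) :
    Agrees g (a :: r) (x :: c) ↔ x = g a ∧ Agrees g r c := by
  simp [Agrees, Stream'.take_succ]

theorem agrees_congr {g g' : ℕ → Fin 2} {r : List ℕ} (h : ∀ a ∈ r, g a = g' a)
    (c : Stream' (Fin 2)) : Agrees g r c ↔ Agrees g' r c := by
  rw [Agrees, Agrees, List.map_congr_left h]

theorem agrees_map (g : ℕ → Fin 2) (f : ℕ → ℕ) (r : List ℕ) (c : Stream' (Fin 2)) :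
    Agrees g (r.map f) c ↔ Agrees (g ∘ f) r c := by
  simp [Agrees]

theorem Agrees.eq {g g' : ℕ → Fin 2} {r : List ℕ} {c : Stream' (Fin 2)} (h : Agrees g r c)
    (h' : Agrees g' r c) : ∀ a ∈ r, g a = g' a := by
  rw [Agrees] at h h'
  rw [h] at h'
  simpa using h'

open Classical in
/-- The state that records which colorings are constant on arcs. -/
noncomputable def Trace.state (t : Trace) : Stream' (Fin 2) → ℝ :=
  fun c => if ∃ g, Agrees g t.arcs c then 2 ^ t.closed else 0

/-- Every arc has two ends, and the names of the arcs are less than `t.fresh`. -/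
structure Trace.Good (t : Trace) : Prop where
  count : ∀ a ∈ t.arcs, t.arcs.count a = 2
  lt : ∀ a ∈ t.arcs, a < t.fresh

theorem iterate_shift_apply {N : ℕ} (T : Op N) (ψ : Stream' (Fin N) → ℝ) (cl : List (Fin N))
    (c : Stream' (Fin N)) :
    shift^[cl.length] T ψ (cl ++ₛ c) = T (fun c' => ψ (cl ++ₛ c')) c := by
  induction cl generalizing ψ with
  | nil => rfl
  | cons x cl ih =>
    rw [List.length_cons, Function.iterate_succ_apply', Stream'.cons_append_stream, shift_cons, ih]
    rfl

/-- At `q = 1` the R-matrix is the flip and all extrema have weight `1`. The state sum then counts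
the colorings that are constant on components. -/
theorem crossOp_one (a c b : Bool) (ψ : Stream' (Fin 2) → ℝ) (x y : Fin 2)
    (d : Stream' (Fin 2)) : crossOp 2 1 a c b ψ (x :: y :: d) = ψ (y :: x :: d) := by
  have h1 : ∀ b, crossUnit 2 1 b = 1 := by intro b; cases b <;> simp [crossUnit, vval]
  have h2 : ∀ b, diag 1 b = 1 := by intro b; cases b <;> simp [diag]
  have h3 : ∀ b, ∀ x y : Fin 2, theta 1 b x y = 0 := by intro b x y; cases b <;> simp [theta]
  by_cases h : a = c
  · subst h
    simp [crossOp_parallel, h1, h2, h3]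
  · obtain rfl : c = !a := by cases a <;> cases c <;> simp_all
    simp only [crossOp_anti, h1, h2, h3, pairWeight]
    split_ifs with h <;> simp [h]

theorem cupWeight_one (o : Bool) (x : Fin 2) : cupWeight 1 o x = 1 := by
  cases o <;> simp [cupWeight, kappa]

theorem capWeight_one (o : Bool) (x : Fin 2) : capWeight 1 o x = 1 := by
  cases o <;> simp [capWeight, kappa]

end Components

/-! ### Comparison of tracing a diagram with the state sum at `q = 1`, `N = 2`. -/

section Components

theorem Trace.step_append (A B : List ℕ) (f k : ℕ) (g : Piece) :
    Trace.step ⟨A ++ B, f, k⟩ ⟨A.length, g⟩ = match g, B with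
      | .cup _, r => ⟨A ++ f :: f :: r, f + 1, k⟩
      | .cap, a :: b :: r =>
          if a = b then ⟨A ++ r, f, k + 1⟩
          else ⟨(A ++ r).map (fun c => if c = b then a else c), f, k⟩
      | .cross _, a :: b :: r => ⟨A ++ b :: a :: r, f, k⟩
      | .double, a :: b :: r => ⟨A ++ b :: a :: r, f, k⟩
      | _, _ => ⟨A ++ B, f, k⟩ := by
  cases g <;> rcases B with _ | ⟨a, _ | ⟨b, r⟩⟩ <;> simp [Trace.step]

open scoped Stream'

theorem sliceOp_apply_append {N : ℕ} (q : ℝ) (g : Piece) (l₁ l₂ : List Bool)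
    (ψ : Stream' (Fin N) → ℝ) (cl : List (Fin N)) (h : cl.length = l₁.length) (c : Stream' (Fin N)) :
    sliceOp N q g l₁.length (l₁ ++ l₂) ψ (cl ++ₛ c)
      = baseOp N q g l₂ (fun c' => ψ (cl ++ₛ c')) c := by
  have := sliceOp_lift (N := N) q g l₁ l₂ 0
  rw [add_zero] at this
  rw [this, ← h, iterate_shift_apply]
  rfl

theorem exists_append_eq (n : ℕ) (c : Stream' (Fin 2)) :
    ∃ cl c', cl.length = n ∧ c = cl ++ₛ c' :=
  ⟨c.take n, c.drop n, by simp, (Stream'.append_take_drop n c).symm⟩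

theorem exists_cons_cons_eq (c : Stream' (Fin 2)) : ∃ (x y : Fin 2) (c' : Stream' (Fin 2)), c = x :: y :: c' :=
  ⟨c.head, c.tail.head, c.tail.tail, by rw [Stream'.eta, Stream'.eta]⟩

theorem Trace.Good.cup {A B : List ℕ} {f k : ℕ} (h : Trace.Good ⟨A ++ B, f, k⟩) :
    Trace.Good ⟨A ++ f :: f :: B, f + 1, k⟩ := by
  have hf : ∀ a ∈ A ++ B, a < f := h.lt
  have hf' : f ∉ A ++ B := fun h' => lt_irrefl _ (hf f h')
  constructor
  · intro a ha
    simp only [List.count_append, List.count_cons]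
    have h1 := List.count_eq_zero_of_not_mem hf'
    rw [List.count_append] at h1
    by_cases e : f = a
    · subst e
      simp; omega
    · have h2 := h.count a (by simp at ha ⊢; grind)
      rw [List.count_append] at h2
      simp [e]; omega
  · intro a ha
    have : a = f ∨ a ∈ A ++ B := by simp at ha ⊢; grind
    rcases this with rfl | h'
    · simp
    · exact (hf a h').trans (Nat.lt_succ_self f)

theorem Trace.Good.swap {A B : List ℕ} {a b f k : ℕ} (h : Trace.Good ⟨A ++ a :: b :: B, f, k⟩) :
    Trace.Good ⟨A ++ b :: a :: B, f, k⟩ := by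
  have hp : (A ++ b :: a :: B).Perm (A ++ a :: b :: B) :=
    (List.Perm.swap _ _ _).append_left A
  exact ⟨fun x hx => (hp.count_eq x).trans (h.count x (hp.mem_iff.1 hx)),
    fun x hx => h.lt x (hp.mem_iff.1 hx)⟩

theorem Trace.Good.close {A B : List ℕ} {a f k : ℕ} (h : Trace.Good ⟨A ++ a :: a :: B, f, k⟩) :
    Trace.Good ⟨A ++ B, f, k + 1⟩ ∧ a ∉ A ++ B := by
  have h1 := h.count a (by simp)
  simp only [List.count_append, List.count_cons_self] at h1
  have h2 : a ∉ A ++ B := by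
    rw [← List.count_eq_zero, List.count_append]; omega
  refine ⟨⟨fun x hx => ?_, fun x hx => h.lt x (by simp at hx ⊢; tauto)⟩, h2⟩
  have h3 := h.count x (by simp at hx ⊢; tauto)
  have h4 : a ≠ x := by rintro rfl; exact h2 hx
  simpa [List.count_append, List.count_cons, h4] using h3

theorem Trace.Good.merge {A B : List ℕ} {a b f k : ℕ} (hab : a ≠ b)
    (h : Trace.Good ⟨A ++ a :: b :: B, f, k⟩) :
    Trace.Good ⟨(A ++ B).map (fun c => if c = b then a else c), f, k⟩ ∧ a ∈ A ++ B := by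
  have ha := h.count a (by simp)
  have hb := h.count b (by simp)
  simp only [List.count_append, List.count_cons, beq_self_eq_true, if_true, beq_iff_eq, hab,
    hab.symm, if_false] at ha hb
  have h1 : a ∈ A ++ B := by
    rw [← List.count_pos_iff, List.count_append]; omega
  refine ⟨⟨?_, ?_⟩, h1⟩
  · have key : ∀ (x : ℕ) (L : List ℕ), (L.map (fun c => if c = b then a else c)).count x
        = if x = a then L.count a + L.count b else if x = b then 0 else L.count x := by
      intro x L
      induction L with
      | nil => simp
      | cons y L ih =>
        rw [List.map_cons, List.count_cons, ih]
        simp only [List.count_cons, beq_iff_eq]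
        grind
    intro x hx
    obtain ⟨y, hy, hyx⟩ := List.mem_map.1 hx
    show List.count x ((A ++ B).map _) = 2
    rw [key]
    by_cases hxa : x = a
    · simp only [hxa, if_true, List.count_append]; omega
    · have hxb : x ≠ b := by
        rintro rfl
        split_ifs at hyx with h'
        · exact hab hyx
        · exact h' hyx
      have hy' : y = x := by
        split_ifs at hyx with h'
        · exact absurd hyx.symm hxa
        · exact hyx
      subst hy'
      have h3 := h.count y (by simp at hy ⊢; tauto)
      simpa [List.count_append, List.count_cons, hxa, hxb, Ne.symm hxa, Ne.symm hxb] using h3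
  · intro x hx
    obtain ⟨y, hy, hyx⟩ := List.mem_map.1 hx
    split_ifs at hyx
    · subst hyx; exact h.lt _ (by simp)
    · subst hyx; exact h.lt _ (by simp at hy ⊢; tauto)

theorem Trace.state_apply (A B : List ℕ) (f k : ℕ) (cl : List (Fin 2)) (h : cl.length = A.length)
    (c : Stream' (Fin 2)) (p : Prop) [Decidable p]
    (hp : (∃ g, cl = A.map g ∧ Agrees g B c) ↔ p) :
    Trace.state ⟨A ++ B, f, k⟩ (cl ++ₛ c) = if p then 2 ^ k else 0 := by
  classical
  simp only [Trace.state, agrees_append _ A B cl c h, hp]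

theorem map_update_of_notMem {A : List ℕ} {g : ℕ → Fin 2} {a : ℕ} (x : Fin 2) (h : a ∉ A) :
    A.map (Function.update g a x) = A.map g :=
  List.map_congr_left fun y hy => by
    rw [Function.update_of_ne]; rintro rfl; exact h hy

theorem agrees_update_of_notMem {B : List ℕ} {g : ℕ → Fin 2} {a : ℕ} (x : Fin 2)
    (h : a ∉ B) (c : Stream' (Fin 2)) : Agrees (Function.update g a x) B c ↔ Agrees g B c :=
  agrees_congr (fun y hy => by
    rw [Function.update_of_ne]; rintro rfl; exact h hy) c

theorem state_cup {A B : List ℕ} {f k : ℕ} (h : Trace.Good ⟨A ++ B, f, k⟩) (o : Bool)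
    (l₁ l₂ : List Bool) (hl : A.length = l₁.length) :
    sliceOp 2 1 (.cup o) l₁.length (l₁ ++ l₂) (Trace.state ⟨A ++ B, f, k⟩)
      = Trace.state ⟨A ++ f :: f :: B, f + 1, k⟩ := by
  classical
  have hf : f ∉ A ++ B := fun h' => lt_irrefl _ (h.lt f h')
  simp only [List.mem_append, not_or] at hf
  funext c
  obtain ⟨cl, c, hcl, rfl⟩ := exists_append_eq l₁.length c
  obtain ⟨x, y, c, rfl⟩ := exists_cons_cons_eq c
  rw [sliceOp_apply_append 1 _ _ _ _ _ hcl, baseOp, cupOp_apply, cupWeight_one, one_mul,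
    Trace.state_apply A B f k cl (hcl.trans hl.symm) c _ Iff.rfl,
    Trace.state_apply A (f :: f :: B) (f + 1) k cl (hcl.trans hl.symm) _
      (x = y ∧ ∃ g, cl = A.map g ∧ Agrees g B c), ite_and]
  constructor
  · rintro ⟨g, hg, h1⟩
    rw [agrees_cons, agrees_cons] at h1
    exact ⟨h1.1.trans h1.2.1.symm, g, hg, h1.2.2⟩
  · rintro ⟨rfl, g, hg, h1⟩
    refine ⟨Function.update g f x, ?_, ?_⟩
    · rw [map_update_of_notMem x hf.1, hg]
    · rw [agrees_cons, agrees_cons, agrees_update_of_notMem x hf.2]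
      simpa using h1

theorem state_swap {A B : List ℕ} {a b f k : ℕ} (o₁ o₂ o₃ : Bool)
    (l₁ l₂ : List Bool) (hl : A.length = l₁.length) (p : Piece)
    (hp : baseOp 2 1 p (o₁ :: o₂ :: l₂) = crossOp 2 1 o₁ o₂ o₃) :
    sliceOp 2 1 p l₁.length (l₁ ++ o₁ :: o₂ :: l₂) (Trace.state ⟨A ++ a :: b :: B, f, k⟩)
      = Trace.state ⟨A ++ b :: a :: B, f, k⟩ := by
  classical
  funext c
  obtain ⟨cl, c, hcl, rfl⟩ := exists_append_eq l₁.length c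
  obtain ⟨x, y, c, rfl⟩ := exists_cons_cons_eq c
  rw [sliceOp_apply_append 1 _ _ _ _ _ hcl, hp, crossOp_one,
    Trace.state_apply A (b :: a :: B) f k cl (hcl.trans hl.symm) _ _ Iff.rfl,
    Trace.state_apply A (a :: b :: B) f k cl (hcl.trans hl.symm) (y :: x :: c)
      (∃ g, cl = A.map g ∧ Agrees g (b :: a :: B) (x :: y :: c))]
  simp only [agrees_cons]
  exact exists_congr fun g => by tauto

/-- The arc `a` has no ends other than the two that are joined, so both of its colors contribute
equally: a factor `2` for the closed component. -/
theorem state_close {A B : List ℕ} {a f k : ℕ} (h : Trace.Good ⟨A ++ a :: a :: B, f, k⟩)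
    (o : Bool) (l₁ l₂ : List Bool) (hl : A.length = l₁.length) :
    sliceOp 2 1 .cap l₁.length (l₁ ++ o :: l₂) (Trace.state ⟨A ++ a :: a :: B, f, k⟩)
      = Trace.state ⟨A ++ B, f, k + 1⟩ := by
  classical
  have ha := h.close.2
  simp only [List.mem_append, not_or] at ha
  funext c
  obtain ⟨cl, c, hcl, rfl⟩ := exists_append_eq l₁.length c
  rw [sliceOp_apply_append 1 _ _ _ _ _ hcl, baseOp, capOp_apply,
    Trace.state_apply A B f (k + 1) cl (hcl.trans hl.symm) _ _ Iff.rfl]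
  have : ∀ x : Fin 2, Trace.state ⟨A ++ a :: a :: B, f, k⟩ (cl ++ₛ (x :: x :: c))
      = if ∃ g, cl = A.map g ∧ Agrees g B c then 2 ^ k else 0 := by
    intro x
    refine Trace.state_apply A _ f k cl (hcl.trans hl.symm) _ _ ?_
    simp only [agrees_cons]
    constructor
    · rintro ⟨g, hg, -, -, h1⟩
      exact ⟨g, hg, h1⟩
    · rintro ⟨g, hg, h1⟩
      refine ⟨Function.update g a x, ?_, ?_⟩
      · rw [map_update_of_notMem x ha.1, hg]
      · rw [agrees_update_of_notMem x ha.2]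
        simpa using h1
  simp only [capWeight_one, one_mul, this]
  simp [pow_succ, mul_comm]

/-- The arc `a` has another end among the remaining strands, whose color fixes the summation
variable, so at most one color contributes and no factor appears. -/
theorem state_merge {A B : List ℕ} {a b f k : ℕ} (hab : a ≠ b)
    (h : Trace.Good ⟨A ++ a :: b :: B, f, k⟩)
    (o : Bool) (l₁ l₂ : List Bool) (hl : A.length = l₁.length) :
    sliceOp 2 1 .cap l₁.length (l₁ ++ o :: l₂) (Trace.state ⟨A ++ a :: b :: B, f, k⟩)
      = Trace.state ⟨(A ++ B).map (fun c => if c = b then a else c), f, k⟩ := by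
  classical
  have ha := (h.merge hab).2
  funext c
  obtain ⟨cl, c, hcl, rfl⟩ := exists_append_eq l₁.length c
  have hcl' := hcl.trans hl.symm
  rw [sliceOp_apply_append 1 _ _ _ _ _ hcl, baseOp, capOp_apply, List.map_append,
    Trace.state_apply _ _ f k cl (by simpa using hcl') _ _ Iff.rfl]
  have e : ∀ x : Fin 2, Trace.state ⟨A ++ a :: b :: B, f, k⟩ (cl ++ₛ (x :: x :: c))
      = if ∃ g, cl = A.map g ∧ x = g a ∧ x = g b ∧ Agrees g B c then 2 ^ k else 0 := by
    intro x
    refine Trace.state_apply A _ f k cl hcl' _ _ ?_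
    simp only [agrees_cons]
  simp only [capWeight_one, one_mul, e]
  set ρ : ℕ → ℕ := fun c => if c = b then a else c with hρ
  have hρa : ρ a = a := by simp [hρ]
  have hρb : ρ b = a := by simp [hρ]
  split_ifs with h1
  · obtain ⟨g, hg, h1⟩ := h1
    rw [agrees_map] at h1
    rw [List.map_map] at hg
    have hx : ∀ x, (∃ g', cl = A.map g' ∧ x = g' a ∧ x = g' b ∧ Agrees g' B c) ↔ x = g a := by
      intro x
      constructor
      · rintro ⟨g', hg', rfl, -, h1'⟩
        have h2 := (agrees_append g' A B cl c hcl').2 ⟨hg', h1'⟩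
        have h3 := (agrees_append (g ∘ ρ) A B cl c hcl').2 ⟨hg, h1⟩
        have := h2.eq h3 a ha
        rwa [Function.comp_apply, hρa] at this
      · rintro rfl
        exact ⟨g ∘ ρ, hg, by simp [hρa], by simp [hρb], h1⟩
    simp only [hx, Finset.sum_ite_eq', Finset.mem_univ, if_true]
  · refine Finset.sum_eq_zero fun x _ => if_neg ?_
    rintro ⟨g, hg, hga, hgb, h2⟩
    refine h1 ⟨g, ?_, ?_⟩
    · rw [List.map_map, hg]
      refine List.map_congr_left fun y _ => ?_
      by_cases hy : y = b
      · subst hy; simp [hρb, ← hga, ← hgb]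
      · simp [hρ, hy]
    · rw [agrees_map]
      refine (agrees_congr (fun y _ => ?_) c).1 h2
      by_cases hy : y = b
      · subst hy; simp [hρb, ← hga, ← hgb]
      · simp [hρ, hy]

/-- The last clause ensures that a nonempty word without end points has at least one component. -/
theorem Trace.step_spec {t : Trace} (ht : t.Good) {x : Slice} {l l' : List Bool}
    (hl : t.arcs.length = l.length) (h : x.act l = some l') :
    (t.step x).Good ∧ (t.step x).arcs.length = l'.length
      ∧ sliceOp 2 1 x.piece x.pos l t.state = (t.step x).state
      ∧ (t.step x).arcs.length + (t.step x).closed ≠ 0 := by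
  obtain ⟨i, g⟩ := x
  obtain ⟨arcs, f, k⟩ := t
  have hi : i ≤ l.length := pos_le_of_act h
  obtain ⟨l₁, l₂, rfl, rfl⟩ : ∃ l₁ l₂, l = l₁ ++ l₂ ∧ i = l₁.length :=
    ⟨l.take i, l.drop i, by simp, by simp [hi]⟩
  obtain ⟨A, B, rfl, hA⟩ : ∃ A B, arcs = A ++ B ∧ A.length = l₁.length :=
    ⟨arcs.take l₁.length, arcs.drop l₁.length, by simp, by simp at hl ⊢; omega⟩
  have hB : B.length = l₂.length := by simp at hl; omega
  have h' := act_lift l₁ l₂ 0 g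
  rw [add_zero, h, act_zero] at h'
  have hstep := Trace.step_append A B f k g
  rw [hA] at hstep
  cases g with
  | cup o =>
    simp only at hstep
    rw [hstep]
    simp only [Piece.act, Option.map_some, Option.some.injEq] at h'
    subst h'
    exact ⟨ht.cup, by simp [hA, hB], state_cup ht o l₁ l₂ hA, by simp⟩
  | cross b =>
    rcases l₂ with _ | ⟨o₁, _ | ⟨o₂, l₂⟩⟩ <;> simp [Piece.act] at h'
    rcases B with _ | ⟨a, _ | ⟨a', B⟩⟩ <;> simp at hB
    simp only at hstep
    rw [hstep]
    subst h'
    exact ⟨ht.swap, by simp [hA, hB], state_swap o₁ o₂ b l₁ l₂ hA _ rfl, by simp⟩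
  | double =>
    rcases l₂ with _ | ⟨o₁, _ | ⟨o₂, l₂⟩⟩ <;> simp [Piece.act] at h'
    rcases B with _ | ⟨a, _ | ⟨a', B⟩⟩ <;> simp at hB
    simp only at hstep
    rw [hstep]
    subst h'
    exact ⟨ht.swap, by simp [hA, hB], state_swap o₁ o₂ true l₁ l₂ hA _ rfl, by simp⟩
  | cap =>
    rcases l₂ with _ | ⟨o₁, _ | ⟨o₂, l₂⟩⟩ <;> simp [Piece.act] at h'
    rcases B with _ | ⟨a, _ | ⟨a', B⟩⟩ <;> simp at hB
    obtain ⟨-, rfl⟩ := h'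
    simp only at hstep
    rw [hstep]
    split_ifs with haa
    · subst haa
      exact ⟨ht.close.1, by simp [hA, hB], state_close ht o₁ l₁ _ hA, by simp⟩
    · refine ⟨(ht.merge haa).1, by simp [hA, hB], state_merge haa ht o₁ l₁ _ hA, ?_⟩
      have := (ht.merge haa).2
      have := List.length_pos_of_mem this
      simp only [List.length_map]
      omega

theorem foldl_step_spec {w : List Slice} {t : Trace} (ht : t.Good) {l l' : List Bool}
    (hl : t.arcs.length = l.length) (h : run w l = some l') :
    (w.foldl Trace.step t).arcs.length = l'.length
      ∧ stateOp 2 1 w l t.state = (w.foldl Trace.step t).state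
      ∧ (w ≠ [] → (w.foldl Trace.step t).arcs.length + (w.foldl Trace.step t).closed ≠ 0) := by
  induction w generalizing t l with
  | nil =>
    obtain rfl : l = l' := by simpa [run] using h
    exact ⟨hl, rfl, fun h => absurd rfl h⟩
  | cons x w ih =>
    simp only [run, Option.bind_eq_some_iff] at h
    obtain ⟨m, h1, h2⟩ := h
    obtain ⟨h3, h4, h5, h6⟩ := Trace.step_spec ht hl h1
    obtain ⟨h7, h8, h9⟩ := ih h3 h4 h2
    refine ⟨h7, ?_, fun _ => ?_⟩
    · rw [stateOp, h1, Option.getD_some, Module.End.mul_apply, h5, List.foldl_cons, h8]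
    · by_cases hw : w = []
      · subst hw; exact h6
      · exact h9 hw

theorem trace_nil_good : Trace.Good ⟨[], 0, 0⟩ := ⟨by simp, by simp⟩

theorem components_pos {w : List Slice} (h : run w [] = some []) (hw : w ≠ []) :
    0 < components w := by
  obtain ⟨h1, -, h2⟩ := foldl_step_spec trace_nil_good rfl h
  have := h2 hw
  simp only [h1, List.length_nil, components] at this ⊢
  omega

theorem stateOp_eq_two_pow {w : List Slice} (h : run w [] = some []) (c : Stream' (Fin 2)) :
    stateOp 2 1 w [] (fun _ => 1) c = 2 ^ components w := by
  obtain ⟨h1, h2, -⟩ := foldl_step_spec trace_nil_good rfl h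
  have h3 : Trace.state ⟨[], 0, 0⟩ = fun _ => 1 := by
    funext c; simp [Trace.state, Agrees]
  rw [h3] at h2
  rw [h2, Trace.state, components, if_pos]
  simp [Agrees, List.eq_nil_of_length_eq_zero h1]

/-- Both state sums are powers of `2` with the numbers of components as exponents. -/
theorem components_eq_of_sameOp {w w' : List Slice} (h : SameOp 2 1 [] w w')
    (hw : run w [] = some []) : components w = components w' := by
  obtain ⟨l, h1, h2, h3⟩ := h
  obtain rfl : l = [] := by simpa [hw] using h1.symm
  have h4 := stateOp_eq_two_pow h1 (Stream'.const 0)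
  rw [h3, stateOp_eq_two_pow h2] at h4
  exact_mod_cast (pow_right_injective₀ (two_pos) (by norm_num) h4).symm

end Components

/-! ### Local moves and orientations -/

/-- Wherever `u` fits, `u'` fits as well and has the same effect on orientations. -/
def RunLe (u u' : List Slice) : Prop := ∀ l l', run u l = some l' → run u' l = some l'

theorem RunLe.lift {u u' : List Slice} (h : RunLe u u') {i : ℕ} {l l' : List Bool}
    (hi : i ≤ l.length) (h1 : run (lift i u) l = some l') :
    run (OrientedLinks.lift i u') l = some l' := by
  obtain ⟨l₁, l₂, rfl, rfl⟩ : ∃ l₁ l₂, l = l₁ ++ l₂ ∧ i = l₁.length :=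
    ⟨l.take i, l.drop i, by simp, by simp [hi]⟩
  rw [run_lift, Option.map_eq_some_iff] at h1 ⊢
  obtain ⟨m, h1, h2⟩ := h1
  exact ⟨m, h _ _ h1, h2⟩

theorem runLe_commute (g h : Piece) (k : ℕ) :
    RunLe [⟨0, g⟩, ⟨g.top + k, h⟩] [⟨g.bot + k, h⟩, ⟨0, g⟩] := by
  intro l l' h1
  cases g <;> rcases l with _ | ⟨a, _ | ⟨c, l⟩⟩ <;>
    simp [run, Piece.top, Piece.bot, act_zero, Piece.act, add_comm 2 k, act_succ,
      Option.bind_eq_some_iff] at h1 ⊢ <;> grind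

theorem runLe_commute' (g h : Piece) (k : ℕ) :
    RunLe [⟨g.bot + k, h⟩, ⟨0, g⟩] [⟨0, g⟩, ⟨g.top + k, h⟩] := by
  intro l l' h1
  cases g <;> rcases l with _ | ⟨a, _ | ⟨c, l⟩⟩ <;>
    simp [run, Piece.top, Piece.bot, act_zero, Piece.act, add_comm 2 k, act_succ, act_succ_nil,
      Option.bind_eq_some_iff] at h1 ⊢ <;> grind

theorem LocalMove.run_eq {u u' : List Slice} (h : LocalMove u u') {l l' : List Bool}
    (h1 : run u l = some l') : run u' l = some l' := by
  have key : ∀ (i : ℕ) (w w' : List Slice), RunLe w w' → u = lift i w → u' = lift i w' →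
      i ≤ l.length → run u' l = some l' := by
    rintro i w w' hw rfl rfl hi
    exact hw.lift hi h1
  cases h with
  | commute i k g h =>
    exact key i _ _ (runLe_commute g h k) (by simp [lift, add_assoc]) (by simp [lift, add_assoc])
      (pos_le_of_run h1)
  | zigzagLeft i o =>
    refine key i [⟨0, .cup o⟩, ⟨1, .cap⟩] [] ?_ (by simp [lift]) (by simp [lift])
      (pos_le_of_run h1)
    intro l l' h
    rcases l with _ | ⟨a, l⟩ <;> simp [run, act_zero, Piece.act, act_succ] at h ⊢
    rw [h.1, h.2]
  | zigzagRight i o =>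
    refine key i [⟨1, .cup o⟩, ⟨0, .cap⟩] [] ?_ (by simp [lift]) (by simp [lift])
      ((Nat.le_succ i).trans (pos_le_of_run h1))
    intro l l' h
    rcases l with _ | ⟨a, l⟩ <;> simp [run, act_zero, Piece.act, act_succ, act_succ_nil] at h ⊢
    rw [← h.2, h.1, Bool.not_not]
  | capSlide i b =>
    refine key i [⟨0, .cross b⟩, ⟨1, .cap⟩] [⟨1, .cross (!b)⟩, ⟨0, .cap⟩] ?_ (by simp [lift])
      (by simp [lift]) (pos_le_of_run h1)
    intro l l' h
    rcases l with _ | ⟨a, _ | ⟨c, _ | ⟨d, l⟩⟩⟩ <;>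
      simp [run, act_zero, Piece.act, act_succ] at h ⊢
    exact h
  | cupSlide i o b =>
    refine key i [⟨1, .cup o⟩, ⟨0, .cross b⟩] [⟨0, .cup o⟩, ⟨1, .cross (!b)⟩] ?_ (by simp [lift])
      (by simp [lift]) ((Nat.le_succ i).trans (pos_le_of_run h1))
    intro l l' h
    rcases l with _ | ⟨a, l⟩ <;> simp [run, act_zero, Piece.act, act_succ, act_succ_nil] at h ⊢
    exact h
  | r1Cap i b =>
    refine key i [⟨0, .cross b⟩, ⟨0, .cap⟩] [⟨0, .cap⟩] ?_ (by simp [lift])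
      (by simp [lift]) (pos_le_of_run h1)
    intro l l' h
    rcases l with _ | ⟨a, _ | ⟨c, l⟩⟩ <;> simp [run, act_zero, Piece.act] at h ⊢
    exact ⟨by simp [h.1], h.2⟩
  | r1Cup i o b =>
    refine key i [⟨0, .cup o⟩, ⟨0, .cross b⟩] [⟨0, .cup (!o)⟩] ?_ (by simp [lift])
      (by simp [lift]) (pos_le_of_run h1)
    intro l l' h
    simp [run, act_zero, Piece.act] at h ⊢
    exact h
  | r2 i b =>
    refine key i [⟨0, .cross b⟩, ⟨0, .cross (!b)⟩] [] ?_ (by simp [lift])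
      (by simp [lift]) (pos_le_of_run h1)
    intro l l' h
    rcases l with _ | ⟨a, _ | ⟨c, l⟩⟩ <;> simp [run, act_zero, Piece.act] at h ⊢
    exact h
  | r3 i a b c h =>
    refine key i [⟨0, .cross a⟩, ⟨1, .cross b⟩, ⟨0, .cross c⟩]
      [⟨1, .cross c⟩, ⟨0, .cross b⟩, ⟨1, .cross a⟩] ?_ (by simp [lift])
      (by simp [lift]) (pos_le_of_run h1)
    intro l l' h
    rcases l with _ | ⟨a, _ | ⟨c, _ | ⟨d, l⟩⟩⟩ <;>
      simp [run, act_zero, Piece.act, act_succ] at h ⊢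
    exact h

/-- The right side of a move may fit where the left side does not (an empty stack fits everywhere),
so a move applied backwards needs a separate check that the result fits. -/
theorem run_commute_symm {i k : ℕ} {g h : Piece} {l l' : List Bool}
    (h1 : run [⟨i + g.bot + k, h⟩, ⟨i, g⟩] l = some l') :
    run [⟨i, g⟩, ⟨i + g.top + k, h⟩] l = some l' := by
  have hi : i ≤ l.length := by have := pos_le_of_run h1; simp at this; omega
  have := (runLe_commute' g h k).lift (i := i) hi (l' := l')
  simp only [lift, List.map_cons, List.map_nil, add_zero, ← add_assoc] at this
  exact this h1

theorem run_cupSlide_symm {i : ℕ} {o b : Bool} {l l' : List Bool}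
    (h1 : run [⟨i, .cup o⟩, ⟨i + 1, .cross b⟩] l = some l') :
    run [⟨i + 1, .cup o⟩, ⟨i, .cross (!b)⟩] l = some l' := by
  have hw : RunLe [⟨0, .cup o⟩, ⟨1, .cross b⟩] [⟨1, .cup o⟩, ⟨0, .cross (!b)⟩] := by
    intro l l' h
    rcases l with _ | ⟨a, l⟩ <;> simp [run, act_zero, Piece.act, act_succ] at h ⊢
    exact h
  have := hw.lift (i := i) (pos_le_of_run h1) (l' := l')
  simp only [lift, List.map_cons, List.map_nil, add_zero] at this
  exact this h1

theorem run_r1Cup_symm {i : ℕ} {o b : Bool} {l l' : List Bool}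
    (h1 : run [⟨i, .cup o⟩] l = some l') :
    run [⟨i, .cup (!o)⟩, ⟨i, .cross b⟩] l = some l' := by
  have hw : RunLe [⟨0, .cup o⟩] [⟨0, .cup (!o)⟩, ⟨0, .cross b⟩] := by
    intro l l' h
    simp [run, act_zero, Piece.act] at h ⊢
    exact h
  have := hw.lift (i := i) (pos_le_of_run h1) (l' := l')
  simp only [lift, List.map_cons, List.map_nil, add_zero] at this
  exact this h1

/-! ### The skein module -/

/-- A commutative ring with the elements that occur in the skein relation. -/
structure SkeinRing (A : Type) [CommRing A] where
  v : A
  vInv : A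
  z : A
  δ : A
  vInv_mul : vInv * v = 1
  z_mul : z * δ = vInv - v

variable {A : Type} [CommRing A]

/-- The word `w` as an element of the free module on all words. -/
noncomputable def word (A : Type) [CommRing A] (w : List Slice) : List Slice →₀ A :=
  Finsupp.single w 1

/-- The relations of the skein module: moves, the skein relation, and the removal of a small circle
next to another strand. -/
inductive SkeinRing.Rel (K : SkeinRing A) : (List Slice →₀ A) → Prop
  | move (p u u' r : List Slice) (l l' : List Bool) : run p [] = some l → LocalMove u u' →
      run u l = some l' → Rel K (word A (p ++ u ++ r) - word A (p ++ u' ++ r))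
  | skein (p r : List Slice) (l : List Bool) (i : ℕ) : run p [] = some l → i + 1 < l.length →
      Rel K (K.vInv • word A (p ++ [⟨i, .cross (positiveType l i)⟩] ++ r)
        - K.v • word A (p ++ [⟨i, .cross (!positiveType l i)⟩] ++ r)
        - K.z • word A (p ++ smoothing l i ++ r))
  | circle (p r : List Slice) (l : List Bool) : run p [] = some l → l ≠ [] →
      Rel K (word A (p ++ [⟨0, .cup true⟩, ⟨0, .cap⟩] ++ r) - K.δ • word A (p ++ r))

/-- The submodule generated by the relations. -/
noncomputable def SkeinRing.relations (K : SkeinRing A) : Submodule A (List Slice →₀ A) :=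
  Submodule.span A {x | K.Rel x}

/-- The skein module of tangles without lower end points. -/
abbrev SkeinRing.Skein (K : SkeinRing A) : Type := (List Slice →₀ A) ⧸ K.relations

namespace SkeinRing

variable (K : SkeinRing A)

/-- The class of a word. -/
noncomputable def cls (w : List Slice) : K.Skein := K.relations.mkQ (word A w)

/-- Putting further slices on top. -/
noncomputable def app (u : List Slice) : K.Skein →ₗ[A] K.Skein :=
  Submodule.mapQ _ _ (Finsupp.lmapDomain A A (· ++ u)) (by
    rw [relations, Submodule.span_le]
    intro x hx
    have hw : ∀ w, Finsupp.mapDomain (· ++ u) (word A w) = word A (w ++ u) := fun w => by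
      rw [word, Finsupp.mapDomain_single, word]
    have hsub : ∀ x y : List Slice →₀ A, Finsupp.mapDomain (· ++ u) (x - y)
        = Finsupp.mapDomain (· ++ u) x - Finsupp.mapDomain (· ++ u) y :=
      (Finsupp.lmapDomain A A (· ++ u)).map_sub
    have hsmul : ∀ (a : A) (x : List Slice →₀ A), Finsupp.mapDomain (· ++ u) (a • x)
        = a • Finsupp.mapDomain (· ++ u) x :=
      (Finsupp.lmapDomain A A (· ++ u)).map_smul
    -- Each relation allows an arbitrary top part `r`, so putting `u` on top yields a relation of
    -- the same kind.
    refine Submodule.subset_span ?_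
    cases hx with
    | move p w w' r l l' h1 h2 h3 =>
      simp only [Finsupp.lmapDomain_apply, hsub, hw, List.append_assoc]
      simpa using Rel.move (K := K) p w w' (r ++ u) l l' h1 h2 h3
    | skein p r l i h1 h2 =>
      simp only [Finsupp.lmapDomain_apply, hsub, hsmul, hw, List.append_assoc]
      simpa using Rel.skein (K := K) p (r ++ u) l i h1 h2
    | circle p r l h1 h2 =>
      simp only [Finsupp.lmapDomain_apply, hsub, hsmul, hw, List.append_assoc]
      simpa using Rel.circle (K := K) p (r ++ u) l h1 h2)

@[simp] theorem app_cls (u w : List Slice) : K.app u (K.cls w) = K.cls (w ++ u) := by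
  simp only [app, cls, Submodule.mkQ_apply, Submodule.mapQ_apply, Finsupp.lmapDomain_apply, word,
    Finsupp.mapDomain_single]

theorem linearMap_ext {M : Type*} [AddCommGroup M] [Module A M] {f g : K.Skein →ₗ[A] M}
    (h : ∀ w, f (K.cls w) = g (K.cls w)) : f = g := by
  refine Submodule.linearMap_qext _ (Finsupp.lhom_ext' fun w => LinearMap.ext_ring ?_)
  exact h w

theorem app_nil (s : K.Skein) : K.app [] s = s := by
  have : K.app [] = LinearMap.id := K.linearMap_ext fun w => by simp
  rw [this]; rfl

theorem app_append (u u' : List Slice) (s : K.Skein) :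
    K.app (u ++ u') s = K.app u' (K.app u s) := by
  have : K.app (u ++ u') = K.app u' ∘ₗ K.app u := K.linearMap_ext fun w => by simp
  rw [this]; rfl

/-- The tangles whose upper ends have the given orientations. -/
noncomputable def typed (l : List Bool) : Submodule A K.Skein :=
  Submodule.span A {s | ∃ p, run p [] = some l ∧ s = K.cls p}

variable {K}

theorem cls_mem_typed {p : List Slice} {l : List Bool} (h : run p [] = some l) :
    K.cls p ∈ K.typed l :=
  Submodule.subset_span ⟨p, h, rfl⟩

theorem app_eq_of_typed {M : Type*} [AddCommGroup M] [Module A M] {l : List Bool}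
    {f g : K.Skein →ₗ[A] M} (h : ∀ p, run p [] = some l → f (K.cls p) = g (K.cls p)) {s : K.Skein}
    (hs : s ∈ K.typed l) : f s = g s := by
  refine LinearMap.eqOn_span (f := f) (g := g) ?_ hs
  rintro _ ⟨p, hp, rfl⟩
  exact h p hp

theorem app_mem_typed {u : List Slice} {l l' : List Bool} (h : run u l = some l') {s : K.Skein}
    (hs : s ∈ K.typed l) : K.app u s ∈ K.typed l' := by
  have : K.typed l ≤ (K.typed l').comap (K.app u) := by
    rw [typed, Submodule.span_le]
    rintro _ ⟨p, hp, rfl⟩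
    simp only [Submodule.comap_coe, Set.mem_preimage, SetLike.mem_coe, app_cls]
    exact cls_mem_typed (by simp [run_append, hp, h])
  exact this hs

theorem cls_eq_of_rel {x y : List Slice →₀ A} (h : K.Rel (x - y)) :
    K.relations.mkQ x = K.relations.mkQ y := by
  rw [← sub_eq_zero, ← map_sub, Submodule.mkQ_apply, Submodule.Quotient.mk_eq_zero]
  exact Submodule.subset_span h

theorem app_skein {l : List Bool} {i : ℕ} (hi : i + 1 < l.length) {s : K.Skein}
    (hs : s ∈ K.typed l) :
    K.vInv • K.app [⟨i, .cross (positiveType l i)⟩] s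
      = K.v • K.app [⟨i, .cross (!positiveType l i)⟩] s + K.z • K.app (smoothing l i) s := by
  refine app_eq_of_typed (f := K.vInv • K.app [⟨i, .cross (positiveType l i)⟩])
    (g := K.v • K.app [⟨i, .cross (!positiveType l i)⟩] + K.z • K.app (smoothing l i)) ?_ hs
  intro p hp
  have h := Rel.skein (K := K) p [] l i hp hi
  rw [sub_sub] at h
  have := cls_eq_of_rel h
  simp only [map_add, map_smul, List.append_nil] at this
  simp only [LinearMap.add_apply, LinearMap.smul_apply, app_cls]
  exact this

theorem app_circle {l : List Bool} (hl : l ≠ []) {s : K.Skein} (hs : s ∈ K.typed l) :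
    K.app [⟨0, .cup true⟩, ⟨0, .cap⟩] s = K.δ • s := by
  refine app_eq_of_typed (f := K.app [⟨0, .cup true⟩, ⟨0, .cap⟩])
    (g := K.δ • LinearMap.id) ?_ hs
  intro p hp
  have := cls_eq_of_rel (Rel.circle (K := K) p [] l hp hl)
  simp only [map_smul, List.append_nil] at this
  simp only [LinearMap.smul_apply, LinearMap.id_apply, app_cls]
  exact this

/-- Wherever the stack `u` fits, `u'` fits as well and has the same effect. -/
def Rewrites (K : SkeinRing A) (u u' : List Slice) : Prop :=
  ∀ l l', run u l = some l' → run u' l = some l' ∧ ∀ s ∈ K.typed l, K.app u s = K.app u' s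

theorem Rewrites.refl (u : List Slice) : Rewrites K u u := fun _ _ h => ⟨h, fun _ _ => rfl⟩

theorem Rewrites.trans {u u' u'' : List Slice} (h : Rewrites K u u') (h' : Rewrites K u' u'') :
    Rewrites K u u'' := fun l l' h1 => by
  obtain ⟨h2, h3⟩ := h l l' h1
  obtain ⟨h4, h5⟩ := h' l l' h2
  exact ⟨h4, fun s hs => (h3 s hs).trans (h5 s hs)⟩

theorem Rewrites.context {u u' : List Slice} (h : Rewrites K u u') (p r : List Slice) :
    Rewrites K (p ++ u ++ r) (p ++ u' ++ r) := fun l l' h1 => by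
  rw [List.append_assoc, run_append, Option.bind_eq_some_iff] at h1
  obtain ⟨m, h1, h2⟩ := h1
  rw [run_append, Option.bind_eq_some_iff] at h2
  obtain ⟨m', h2, h3⟩ := h2
  obtain ⟨h4, h5⟩ := h _ _ h2
  refine ⟨by simp [run_append, h1, h4, h3], fun s hs => ?_⟩
  simp only [app_append]
  rw [h5 _ (app_mem_typed h1 hs)]

theorem Rewrites.of_move {u u' : List Slice} (h : LocalMove u u') : Rewrites K u u' :=
  fun l l' h1 => by
    refine ⟨h.run_eq h1, fun s hs => app_eq_of_typed (fun p hp => ?_) hs⟩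
    have := cls_eq_of_rel (Rel.move (K := K) p u u' [] l l' hp h h1)
    simp only [List.append_nil] at this
    simp only [app_cls]
    exact this

theorem Rewrites.of_move_symm {u u' : List Slice} (h : LocalMove u u')
    (h' : ∀ l l', run u' l = some l' → run u l = some l') : Rewrites K u' u :=
  fun l l' h1 => ⟨h' l l' h1, fun s hs => ((of_move h l l' (h' l l' h1)).2 s hs).symm⟩

theorem Rewrites.commute (i k : ℕ) (g h : Piece) :
    Rewrites K [⟨i, g⟩, ⟨i + g.top + k, h⟩] [⟨i + g.bot + k, h⟩, ⟨i, g⟩] :=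
  of_move (.commute i k g h)

theorem Rewrites.commute_symm (i k : ℕ) (g h : Piece) :
    Rewrites K [⟨i + g.bot + k, h⟩, ⟨i, g⟩] [⟨i, g⟩, ⟨i + g.top + k, h⟩] :=
  of_move_symm (.commute i k g h) fun _ _ => run_commute_symm

theorem Rewrites.cupSlide_symm (i : ℕ) (o b : Bool) :
    Rewrites K [⟨i, .cup o⟩, ⟨i + 1, .cross b⟩] [⟨i + 1, .cup o⟩, ⟨i, .cross (!b)⟩] := by
  have h := LocalMove.cupSlide i o (!b)
  rw [Bool.not_not] at h
  exact of_move_symm h fun _ _ => run_cupSlide_symm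

/-! ### Strands passing over a piece -/

/-- A strand passes over `k` other strands, starting at position `m`. -/
def overpass (m k : ℕ) : List Slice := (List.range k).map fun t => ⟨m + t, .cross true⟩

/-- A new arc starting at the left that passes over `j` strands. -/
def arcWord (a : Bool) (j : ℕ) : List Slice := ⟨0, .cup a⟩ :: overpass 1 j

theorem overpass_succ (m k : ℕ) : overpass m (k + 1) = overpass m k ++ [⟨m + k, .cross true⟩] := by
  simp [overpass, List.range_succ]

theorem overpass_succ' (m k : ℕ) : overpass m (k + 1) = ⟨m, .cross true⟩ :: overpass (m + 1) k := by
  simp [overpass, List.range_succ_eq_map, Function.comp_def, add_assoc, add_comm 1]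

theorem arcWord_succ (a : Bool) (j : ℕ) :
    arcWord a (j + 1) = arcWord a j ++ [⟨j + 1, .cross true⟩] := by
  simp [arcWord, overpass_succ, add_comm 1]

theorem overpass_add (m j k : ℕ) : overpass m (j + k) = overpass m j ++ overpass (m + j) k := by
  simp [overpass, List.range_add, Function.comp_def, add_assoc]

theorem arcWord_add (a : Bool) (j k : ℕ) : arcWord a (j + k) = arcWord a j ++ overpass (j + 1) k := by
  simp [arcWord, overpass_add, add_comm 1]

theorem run_arcWord (a : Bool) (j : ℕ) (l : List Bool) (hj : j ≤ l.length) :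
    run (arcWord a j) l = some (a :: (l.take j ++ (!a) :: l.drop j)) := by
  induction j with
  | zero => simp [arcWord, overpass, run, act_zero, Piece.act]
  | succ j ih =>
    rw [arcWord_succ, run_append, ih (by omega), Option.bind_some]
    have h := run_cross (a :: l.take j) (l.drop (j + 1)) (!a) l[j] true
    have hlen : (a :: l.take j).length = j + 1 := by simp; omega
    rw [hlen] at h
    rw [List.take_succ_eq_append_getElem (by omega), List.drop_eq_getElem_cons (by omega)]
    simpa only [List.cons_append, List.append_assoc, List.nil_append] using h

/-- A relation between stacks of slices that is compatible with stacking. -/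
structure IsStackRelation (R : List Slice → List Slice → Prop) : Prop where
  trans : ∀ {u u' u''}, R u u' → R u' u'' → R u u''
  context : ∀ {u u'}, R u u' → ∀ p r, R (p ++ u ++ r) (p ++ u' ++ r)
  commute : ∀ i k g h, R [⟨i, g⟩, ⟨i + g.top + k, h⟩] [⟨i + g.bot + k, h⟩, ⟨i, g⟩]
  commute_symm : ∀ i k g h, R [⟨i + g.bot + k, h⟩, ⟨i, g⟩] [⟨i, g⟩, ⟨i + g.top + k, h⟩]

-- `Rewrites` is not symmetric, since fitting is only inherited in one direction. The sliding of
-- pieces past arcs is therefore proved for an abstract stack relation and used for `Rewrites` and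
-- for its converse.
variable (K) in
theorem rewrites_isStackRelation : IsStackRelation (Rewrites K) :=
  ⟨Rewrites.trans, Rewrites.context, Rewrites.commute, Rewrites.commute_symm⟩

variable (K) in
theorem rewrites_symm_isStackRelation : IsStackRelation (fun u u' => Rewrites K u' u) :=
  ⟨fun h h' => h'.trans h, fun h => h.context, Rewrites.commute_symm, Rewrites.commute⟩

variable {R : List Slice → List Slice → Prop}

/-- A piece to the right of an arc is moved below it. -/
theorem IsStackRelation.slide_right (hR : IsStackRelation R) (a : Bool) (j k : ℕ) (g : Piece) :
    R (arcWord a j ++ [⟨j + k + 2, g⟩]) (⟨j + k, g⟩ :: arcWord a j) := by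
  induction j generalizing k with
  | zero =>
    have := hR.commute 0 k (.cup a) g
    simpa [Piece.top, Piece.bot, arcWord, overpass, add_comm 2 k] using this
  | succ j ih =>
    have h1 := hR.context (hR.commute (j + 1) k (.cross true) g) (arcWord a j) []
    have h2 := hR.context (ih (k + 1)) [] [⟨j + 1, .cross true⟩]
    simp only [Piece.top, Piece.bot, List.append_nil, List.nil_append, List.append_assoc,
      List.cons_append] at h1 h2
    rw [arcWord_succ, List.append_assoc]
    rw [show j + 1 + 2 + k = j + (k + 1) + 2 by omega] at h1
    rw [show j + 1 + k + 2 = j + (k + 1) + 2 by omega, show j + 1 + k = j + (k + 1) by omega]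
    exact hR.trans h1 h2

/-- A piece is moved below an arc that passes over it. -/
theorem IsStackRelation.slide_left (hR : IsStackRelation R) (a : Bool) (i k : ℕ) (g : Piece)
    (hg : R (overpass (i + 1) g.bot ++ [⟨i + 1, g⟩]) (⟨i + 2, g⟩ :: overpass (i + 1) g.top)) :
    R (arcWord a (i + g.bot + k) ++ [⟨i + 1, g⟩]) (⟨i, g⟩ :: arcWord a (i + g.top + k)) := by
  induction k with
  | zero =>
    have h1 := hR.context hg (arcWord a i) []
    have h2 := hR.context (hR.slide_right a i 0 g) [] (overpass (i + 1) g.top)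
    simp only [add_zero, arcWord_add]
    simp only [List.append_nil, List.nil_append, List.append_assoc, List.cons_append, add_zero]
      at h1 h2 ⊢
    exact hR.trans h1 h2
  | succ k ih =>
    have h1 := hR.context (hR.commute_symm (i + 1) k g (.cross true))
      (arcWord a (i + g.bot + k)) []
    have h2 := hR.context ih [] [⟨i + 1 + g.top + k, .cross true⟩]
    rw [← add_assoc, ← add_assoc, arcWord_succ, arcWord_succ]
    simp only [List.append_nil, List.nil_append, List.append_assoc, List.cons_append] at h1 h2 ⊢
    rw [show i + 1 + g.bot + k = i + g.bot + k + 1 by omega] at h1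
    rw [show i + 1 + g.top + k = i + g.top + k + 1 by omega] at h1 h2
    exact hR.trans h1 h2

end SkeinRing

/-! ### Descending tangles span the skein module -/

namespace SkeinRing

variable {A : Type} [CommRing A] {K : SkeinRing A}

/-- Linear combinations of descending tangles: each of the arcs, ordered by their left ends, lies
above all the following ones. Without end points, these are the empty diagram and the circle. -/
inductive Descending (K : SkeinRing A) : List Bool → K.Skein → Prop
  | zero (l : List Bool) : Descending K l 0
  | add {l : List Bool} {s t : K.Skein} : Descending K l s → Descending K l t →
      Descending K l (s + t)
  | smul {l : List Bool} (a : A) {s : K.Skein} : Descending K l s → Descending K l (a • s)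
  | empty : Descending K [] (K.cls [])
  | circle : Descending K [] (K.cls [⟨0, .cup true⟩, ⟨0, .cap⟩])
  | arc (a : Bool) (j : ℕ) {l l' : List Bool} {s : K.Skein} : Descending K l s →
      run (arcWord a j) l = some l' → Descending K l' (K.app (arcWord a j) s)

theorem Descending.mem_typed {l : List Bool} {s : K.Skein} (h : Descending K l s) :
    s ∈ K.typed l := by
  induction h with
  | zero => exact zero_mem _
  | add _ _ h h' => exact add_mem h h'
  | smul a _ h => exact Submodule.smul_mem _ a h
  | empty => exact cls_mem_typed rfl
  | circle => exact cls_mem_typed (by decide)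
  | arc a j _ h h' => exact app_mem_typed h h'

/-- The stack `u`, put on strands with orientations `l`, preserves descending tangles. -/
def Preserves (K : SkeinRing A) (u : List Slice) (l : List Bool) : Prop :=
  ∀ s l', Descending K l s → run u l = some l' → Descending K l' (K.app u s)

theorem Preserves.append {u u' : List Slice} {l : List Bool} (h : Preserves K u l)
    (h' : ∀ l', run u l = some l' → Preserves K u' l') : Preserves K (u ++ u') l := by
  intro s l'' hs h1
  rw [run_append, Option.bind_eq_some_iff] at h1
  obtain ⟨l', h1, h2⟩ := h1
  rw [app_append]
  exact h' l' h1 _ _ (h s l' hs h1) h2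

theorem Preserves.nil (l : List Bool) : Preserves K [] l := by
  intro s l' hs h
  obtain rfl : l = l' := by simpa [run] using h
  rwa [app_nil]

theorem Preserves.arc (a : Bool) (j : ℕ) (l : List Bool) : Preserves K (arcWord a j) l :=
  fun _ _ hs h => hs.arc a j h

theorem Preserves.of_rewrites {u u' : List Slice} {l : List Bool} (h : Rewrites K u u')
    (h' : Preserves K u' l) : Preserves K u l := by
  intro s l' hs h1
  obtain ⟨h2, h3⟩ := h l l' h1
  rw [h3 s hs.mem_typed]
  exact h' s l' hs h2

/-- It suffices to consider the diagrams that generate the descending tangles. -/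
theorem preserves_of_arcs {u : List Slice} {l₀ : List Bool}
    (h1 : l₀ = [] → ∀ l', run u [] = some l' → Descending K l' (K.app u (K.cls [])) ∧
      Descending K l' (K.app u (K.cls [⟨0, .cup true⟩, ⟨0, .cap⟩])))
    (h2 : ∀ a j l, run (arcWord a j) l = some l₀ → Preserves K (arcWord a j ++ u) l) :
    Preserves K u l₀ := by
  intro s l' hs hu
  induction hs with
  | zero => rw [map_zero]; exact .zero _
  | add _ _ ih ih' => rw [map_add]; exact (ih h1 h2 hu).add (ih' h1 h2 hu)
  | smul a _ ih => rw [map_smul]; exact (ih h1 h2 hu).smul a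
  | empty => exact (h1 rfl l' hu).1
  | circle => exact (h1 rfl l' hu).2
  | arc a j hs h =>
    rw [← app_append]
    exact h2 a j _ h _ _ hs (by simp [run_append, h, hu])

theorem length_of_run_cross {i : ℕ} {b : Bool} {l l' : List Bool}
    (h : run [⟨i, .cross b⟩] l = some l') : i + 1 < l.length ∧ l'.length = l.length := by
  simp only [run, Option.bind_eq_some_iff, Slice.act] at h
  obtain ⟨m, h, h1⟩ := h
  obtain rfl : m = l' := by simpa using h1
  split_ifs at h with h2
  rcases h3 : l.drop i with _ | ⟨x, _ | ⟨y, r⟩⟩ <;> simp [h3, Piece.act] at h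
  have h4 := congrArg List.length h3
  simp at h4
  refine ⟨by omega, ?_⟩
  rw [← h]
  simp
  omega

theorem le_length_of_run_arcWord {a : Bool} {j : ℕ} {l l' : List Bool}
    (h : run (arcWord a j) l = some l') : j ≤ l.length ∧ l'.length = l.length + 2 := by
  induction j generalizing l' with
  | zero =>
    simp [arcWord, overpass, run, act_zero, Piece.act] at h
    simp [← h]
  | succ j ih =>
    rw [arcWord_succ, run_append, Option.bind_eq_some_iff] at h
    obtain ⟨m, h1, h2⟩ := h
    have := ih h1
    have := length_of_run_cross h2
    omega

theorem eq_of_run_arcWord {a : Bool} {j : ℕ} {l l' : List Bool}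
    (h : run (arcWord a j) l = some l') : l' = a :: (l.take j ++ (!a) :: l.drop j) := by
  rw [run_arcWord a j l (le_length_of_run_arcWord h).1] at h
  exact (Option.some.inj h).symm

/-! ### New minima -/

theorem run_cup (i : ℕ) (o : Bool) {l : List Bool} (h : i ≤ l.length) :
    run [⟨i, .cup o⟩] l = some (l.take i ++ o :: (!o) :: l.drop i) := by
  simp [run, Slice.act, h, Piece.act]

theorem pass_cup (m : ℕ) (o : Bool) :
    Rewrites K (⟨m + 1, .cup o⟩ :: overpass m 2) [⟨m, .cup o⟩] := by
  have h1 := (Rewrites.of_move (K := K) (.cupSlide m o true)).context [] [⟨m + 1, .cross true⟩]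
  have h2 := (Rewrites.of_move (K := K) (.r2 (m + 1) false)).context [⟨m, .cup o⟩] []
  simp only [List.nil_append, List.append_nil, List.cons_append, Bool.not_true, Bool.not_false]
    at h1 h2
  exact h1.trans h2

/-- At position `0` a minimum is a new uppermost arc. Otherwise it is pushed below the last arc,
onto a tangle with two strands fewer. -/
theorem preserves_cup (i : ℕ) (o : Bool) (l : List Bool) : Preserves K [⟨i, .cup o⟩] l := by
  induction hn : l.length using Nat.strong_induction_on generalizing i l with
  | _ n ih =>
  cases i with
  | zero => exact Preserves.arc o 0 l
  | succ i =>
    refine preserves_of_arcs ?_ ?_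
    · rintro rfl l' h
      simp [run, act_succ_nil] at h
    · intro a j l₁ h
      obtain ⟨hj, hlen⟩ := le_length_of_run_arcWord h
      have ih' := fun i => ih l₁.length (by omega) i l₁ rfl
      rcases le_or_gt i j with hij | hij
      · obtain ⟨k, rfl⟩ := Nat.exists_eq_add_of_le hij
        -- The rewriting removes a pair of crossings, so it leads from the wanted descending form to
        -- the given stack; it is read backwards once the descending form is known to fit.
        have h1 : Rewrites K (⟨i, .cup o⟩ :: arcWord a (i + 2 + k))
            (arcWord a (i + k) ++ [⟨i + 1, .cup o⟩]) :=
          (rewrites_symm_isStackRelation K).slide_left a i k (.cup o) (pass_cup (i + 1) o)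
        have h2 : ∃ m, run (⟨i, .cup o⟩ :: arcWord a (i + 2 + k)) l₁ = some m := by
          have h3 := run_cup i o (l := l₁) (by omega)
          have h4 := run_append [⟨i, .cup o⟩] (arcWord a (i + 2 + k)) l₁
          rw [List.singleton_append, h3, Option.bind_some, run_arcWord] at h4
          · exact ⟨_, h4⟩
          · simp; omega
        obtain ⟨m, h2⟩ := h2
        obtain ⟨h3, h4⟩ := h1 _ _ h2
        intro s l' hs h5
        rw [h3] at h5
        obtain rfl := Option.some.inj h5
        rw [← h4 s hs.mem_typed]
        exact Preserves.append (u := [⟨i, .cup o⟩]) (ih' i) (fun _ _ => Preserves.arc _ _ _)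
          s m hs h2
      · obtain ⟨k, rfl⟩ := Nat.exists_eq_add_of_lt hij
        have h1 := (rewrites_isStackRelation K).slide_right a j k (.cup o)
        exact .of_rewrites h1 (.append (u := [⟨j + k, .cup o⟩]) (ih' _) fun _ _ => .arc _ _ _)

/-! ### New maxima -/

theorem Descending.nil {s : K.Skein} (h : Descending K [] s) :
    ∃ x y : A, s = x • K.cls [] + y • K.cls [⟨0, .cup true⟩, ⟨0, .cap⟩] := by
  generalize hl : ([] : List Bool) = l at h
  induction h with
  | zero => exact ⟨0, 0, by simp⟩
  | add _ _ h h' =>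
    obtain ⟨x, y, rfl⟩ := h hl
    obtain ⟨x', y', rfl⟩ := h' hl
    exact ⟨x + x', y + y', by module⟩
  | smul a _ h =>
    obtain ⟨x, y, rfl⟩ := h hl
    exact ⟨a * x, a * y, by module⟩
  | empty => exact ⟨1, 0, by simp⟩
  | circle => exact ⟨0, 1, by simp⟩
  | arc a j _ h _ =>
    subst hl
    simpa using eq_of_run_arcWord h

/-- A curl is created at the minimum and undone at the maximum, which reverses the orientation of
the circle. -/
theorem circle_orientation (i : ℕ) (o : Bool) :
    Rewrites K [⟨i, .cup o⟩, ⟨i, .cap⟩] [⟨i, .cup (!o)⟩, ⟨i, .cap⟩] := by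
  have h := LocalMove.r1Cup i (!o) true
  rw [Bool.not_not] at h
  have h1 := (Rewrites.of_move_symm (K := K) h fun _ _ => run_r1Cup_symm).context [] [⟨i, .cap⟩]
  have h2 := (Rewrites.of_move (K := K) (.r1Cap i true)).context [⟨i, .cup (!o)⟩] []
  exact h1.trans h2

theorem preserves_circle (o : Bool) (l : List Bool) :
    Preserves K [⟨0, .cup o⟩, ⟨0, .cap⟩] l := by
  have key : Preserves K [⟨0, .cup true⟩, ⟨0, .cap⟩] l := by
    intro s l' hs h
    obtain rfl : l = l' := by simpa [run, act_zero, Piece.act] using h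
    by_cases hl : l = []
    · subst hl
      obtain ⟨x, y, rfl⟩ := hs.nil
      -- The circle relation requires another strand. Of two circles, one is moved to the height at
      -- which the other is still open, to the left of its strands.
      have h1 : Rewrites K ([⟨0, .cup true⟩, ⟨0, .cap⟩] ++ [⟨0, .cup true⟩, ⟨0, .cap⟩])
          ([⟨0, .cup true⟩] ++ [⟨0, .cup true⟩, ⟨0, .cap⟩] ++ [⟨0, .cap⟩]) := by
        have h1 := (Rewrites.commute_symm (K := K) 0 0 (.cup true) .cap).context
          [⟨0, .cup true⟩] [⟨0, .cap⟩]
        have h2 := (Rewrites.commute_symm (K := K) 0 0 .cap .cap).context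
          [⟨0, .cup true⟩, ⟨0, .cup true⟩] []
        exact h1.trans h2
      have h2 := (h1 [] [] (by decide)).2 (K.cls []) (cls_mem_typed rfl)
      simp only [app_append] at h2
      have h3 : K.app [⟨0, .cup true⟩] (K.cls []) ∈ K.typed [true, false] :=
        app_mem_typed (l := []) rfl (cls_mem_typed rfl)
      rw [app_circle (by simp) h3, map_smul, ← app_append] at h2
      simp only [app_cls, List.nil_append, List.singleton_append] at h2
      rw [map_add, map_smul, map_smul, app_cls, app_cls, h2]
      exact (Descending.circle.smul x).add ((Descending.circle.smul K.δ).smul y)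
    · rw [app_circle hl hs.mem_typed]
      exact hs.smul _
  cases o
  · exact .of_rewrites (circle_orientation 0 false) key
  · exact key

end SkeinRing

/-! ### Maxima and crossings on top of a descending tangle. -/

namespace SkeinRing

variable {A : Type} [CommRing A] {K : SkeinRing A}

theorem pass_cap (m : ℕ) : Rewrites K (overpass m 2 ++ [⟨m, .cap⟩]) [⟨m + 1, .cap⟩] := by
  have h : Rewrites K [⟨m + 1, .cross true⟩, ⟨m, .cap⟩] [⟨m, .cross false⟩, ⟨m + 1, .cap⟩] :=
    Rewrites.of_move_symm (.capSlide m false) fun l l' h => by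
      have hw : RunLe [⟨1, .cross true⟩, ⟨0, .cap⟩] [⟨0, .cross false⟩, ⟨1, .cap⟩] := by
        intro l l' h
        rcases l with _ | ⟨a, _ | ⟨c, _ | ⟨d, l⟩⟩⟩ <;>
          simp [run, act_zero, Piece.act, act_succ, act_succ_nil] at h ⊢
        exact h
      have hi := pos_le_of_run h
      have := hw.lift (i := m) (Nat.le_of_succ_le hi) (l' := l')
      simp only [OrientedLinks.lift, List.map_cons, List.map_nil, add_zero] at this
      exact this h
  have h1 := h.context [⟨m, .cross true⟩] []
  have h2 := (Rewrites.of_move (K := K) (.r2 m true)).context [] [⟨m + 1, .cap⟩]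
  exact h1.trans h2

theorem pass_cross (m : ℕ) (b : Bool) :
    Rewrites K (overpass m 2 ++ [⟨m, .cross b⟩]) (⟨m + 1, .cross b⟩ :: overpass m 2) :=
  Rewrites.of_move (.r3 m true true b (Or.inl rfl))

/-- A strand passes over `k` other strands from right to left, ending at position `0`. -/
def overpassLeft : ℕ → List Slice
  | 0 => []
  | k + 1 => ⟨k, .cross false⟩ :: overpassLeft k

/-- The arc only prolongs the strand that the maximum attaches to its right end. Pulled tight, this
strand runs over the `j` strands to the left end of the arc. -/
theorem arc_cap_right (a : Bool) (j : ℕ) :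
    Rewrites K (arcWord a j ++ [⟨j + 1, .cap⟩]) (overpassLeft j) := by
  induction j with
  | zero => exact Rewrites.of_move (.zigzagLeft 0 a)
  | succ j ih =>
    have h1 := (Rewrites.of_move (K := K) (.capSlide (j + 1) true)).context (arcWord a j) []
    have h2 := ((rewrites_isStackRelation K).slide_right a j 0 (.cross false)).context []
      [⟨j + 1, .cap⟩]
    have h3 := ih.context [⟨j, .cross false⟩] []
    rw [arcWord_succ]
    simp only [List.append_assoc, List.nil_append, List.append_nil, List.cons_append, add_zero,
      Bool.not_true] at h1 h2 h3 ⊢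
    exact (h1.trans h2).trans h3

theorem far_over (x : Slice) (hx : x.pos = 0) (hb : x.piece.bot = 2) (m j : ℕ) :
    Rewrites K (overpass (m + 2) j ++ [x]) (x :: overpass (m + x.piece.top) j) := by
  obtain ⟨_, g⟩ := x
  obtain rfl := hx
  induction j with
  | zero => exact Rewrites.refl _
  | succ j ih =>
    have h1 := (Rewrites.commute_symm (K := K) 0 (m + j) g (.cross true)).context
      (overpass (m + 2) j) []
    have h2 := ih.context [] [⟨m + g.top + j, .cross true⟩]
    rw [overpass_succ, overpass_succ]
    simp only [List.append_assoc, List.nil_append, List.append_nil, List.cons_append] at h1 h2 ⊢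
    simp only at hb
    rw [show 0 + g.bot + (m + j) = m + 2 + j by omega,
      show 0 + g.top + (m + j) = m + g.top + j by omega] at h1
    exact h1.trans h2

theorem arc_cap_left (a : Bool) (j : ℕ) :
    Rewrites K (arcWord a (j + 1) ++ [⟨0, .cap⟩]) (overpass 0 j) := by
  have h1 := (far_over (K := K) ⟨0, .cap⟩ rfl rfl 0 j).context [⟨0, .cup a⟩, ⟨1, .cross true⟩] []
  have h2 := (Rewrites.cupSlide_symm (K := K) 0 a true).context [] (⟨0, .cap⟩ :: overpass 0 j)
  have h3 := (Rewrites.of_move (K := K) (.r1Cap 0 false)).context [⟨1, .cup a⟩] (overpass 0 j)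
  have h4 := (Rewrites.of_move (K := K) (.zigzagRight 0 a)).context [] (overpass 0 j)
  simp only [arcWord, overpass_succ']
  simp only [List.nil_append, List.append_nil, List.cons_append, zero_add,
    Bool.not_true, Piece.top] at h1 h2 h3 h4 ⊢
  exact ((h1.trans h2).trans h3).trans h4

/-- The first strand crosses under both legs of the arc; sliding the minimum across it produces a
cancelling pair, after which the arc starts one position further right. -/
theorem arc_cross_left (a : Bool) (j : ℕ) :
    Rewrites K (arcWord a (j + 1) ++ [⟨0, .cross true⟩]) (⟨1, .cup a⟩ :: overpass 2 j) := by
  have h1 := (far_over (K := K) ⟨0, .cross true⟩ rfl rfl 0 j).context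
    [⟨0, .cup a⟩, ⟨1, .cross true⟩] []
  have h2 := (Rewrites.cupSlide_symm (K := K) 0 a true).context []
    (⟨0, .cross true⟩ :: overpass 2 j)
  have h3 := (Rewrites.of_move (K := K) (.r2 0 false)).context [⟨1, .cup a⟩] (overpass 2 j)
  simp only [arcWord, overpass_succ']
  simp only [List.nil_append, List.append_nil, List.cons_append, zero_add,
    Bool.not_true, Bool.not_false, Piece.top] at h1 h2 h3 ⊢
  exact (h1.trans h2).trans h3

/-- All crossings of strands whose number is `n` preserve descending tangles. -/
def CrossClosed (K : SkeinRing A) (n : ℕ) : Prop :=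
  ∀ (l : List Bool) (i : ℕ) (b : Bool), l.length = n → Preserves K [⟨i, .cross b⟩] l

def CapClosed (K : SkeinRing A) (n : ℕ) : Prop :=
  ∀ (l : List Bool) (i : ℕ), l.length = n → Preserves K [⟨i, .cap⟩] l

/-- The bound `m` on the positions allows a use at a stage where crossings at position `0` are not
yet settled. -/
theorem preserves_crosses {n : ℕ} (m : ℕ)
    (h : ∀ (l : List Bool) (i : ℕ) (b : Bool), l.length = n → m ≤ i → Preserves K [⟨i, .cross b⟩] l)
    (u : List Slice) (hu : ∀ x ∈ u, m ≤ x.pos ∧ ∃ b, x.piece = .cross b) (l : List Bool)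
    (hl : l.length = n) : Preserves K u l := by
  induction u generalizing l with
  | nil => exact .nil l
  | cons x u ih =>
    obtain ⟨⟨i, g⟩, rfl⟩ : ∃ y, y = x := ⟨x, rfl⟩
    obtain ⟨hi, b, hb⟩ := hu ⟨i, g⟩ (by simp)
    simp only at hb hi
    subst hb
    refine Preserves.append (u := [⟨i, .cross b⟩]) (h l i b hl hi) fun l' hl' => ?_
    exact ih (fun x hx => hu x (by simp [hx])) l' ((length_of_run_cross hl').2.trans hl)

theorem mem_overpass {m k : ℕ} {x : Slice} (hx : x ∈ overpass m k) :
    m ≤ x.pos ∧ ∃ b, x.piece = .cross b := by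
  simp only [overpass, List.mem_map] at hx
  obtain ⟨t, -, rfl⟩ := hx
  exact ⟨by simp, true, rfl⟩

theorem mem_overpassLeft {k : ℕ} {x : Slice} (hx : x ∈ overpassLeft k) :
    0 ≤ x.pos ∧ ∃ b, x.piece = .cross b := by
  induction k with
  | zero => simp [overpassLeft] at hx
  | succ k ih =>
    rcases List.mem_cons.1 hx with rfl | hx
    · exact ⟨Nat.zero_le _, false, rfl⟩
    · exact ih hx

/-- Relative to the uppermost arc, a maximum closes it to a circle, joins it to a strand, makes a
removable curl at its right end, or misses both its ends and slides below it. Each case leaves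
pieces on the tangle without this arc, which has fewer strands. -/
theorem capClosed_of_smaller (n : ℕ) (h : ∀ m < n, CrossClosed K m) (h' : ∀ m < n, CapClosed K m) :
    CapClosed K n := by
  intro l₀ i hl₀
  refine preserves_of_arcs ?_ ?_
  · rintro rfl l' h
    simp [run, Slice.act, Piece.act] at h
  · intro a j l harc
    obtain ⟨hj, hlen⟩ := le_length_of_run_arcWord harc
    have hcap := fun i => h' l.length (by omega) l i rfl
    have hcross : ∀ u : List Slice, (∀ x ∈ u, 0 ≤ x.pos ∧ ∃ b, x.piece = .cross b) →
        Preserves K u l := fun u hu =>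
      preserves_crosses 0 (fun l' i b hl' _ => h l.length (by omega) l' i b hl') u hu l rfl
    have hright : ∀ j, Preserves K (arcWord a j ++ [⟨j + 1, .cap⟩]) l := fun j =>
      .of_rewrites (arc_cap_right a j) (hcross _ fun _ => mem_overpassLeft)
    rcases i with _ | i
    · rcases j with _ | j
      · exact preserves_circle a l
      · exact .of_rewrites (arc_cap_left a j) (hcross _ fun _ hx => ⟨by simp, (mem_overpass hx).2⟩)
    · rcases lt_trichotomy (i + 1) j with hij | rfl | hij
      · obtain ⟨k, rfl⟩ := Nat.exists_eq_add_of_lt hij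
        have := (rewrites_isStackRelation K).slide_left a i k .cap (pass_cap (i + 1))
        simp only [Piece.bot, Piece.top] at this
        rw [show i + 2 + k = i + 1 + k + 1 by omega] at this
        exact .of_rewrites this (.append (u := [⟨i, .cap⟩]) (hcap i) fun _ _ => .arc _ _ _)
      · have h1 := (Rewrites.of_move (K := K) (.r1Cap (i + 1) true)).context (arcWord a i) []
        rw [arcWord_succ]
        simp only [List.append_assoc, List.append_nil, List.cons_append, List.nil_append] at h1 ⊢
        exact .of_rewrites h1 (hright i)
      · rcases Nat.lt_or_eq_of_le (Nat.lt_succ_iff.1 hij) with hij | rfl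
        · obtain ⟨k, rfl⟩ := Nat.exists_eq_add_of_lt hij
          have := (rewrites_isStackRelation K).slide_right a j k .cap
          exact .of_rewrites this (.append (u := [⟨j + k, .cap⟩]) (hcap _) fun _ _ => .arc _ _ _)
        · exact hright j

theorem preserves_smoothing {l : List Bool} (hcap : CapClosed K l.length) (i : ℕ) :
    Preserves K (smoothing l i) l := by
  unfold smoothing
  split_ifs
  · exact .nil l
  · exact .append (u := [⟨i, .cap⟩]) (hcap l i rfl) fun _ _ => preserves_cup _ _ _

/-- The crossing of one sign may be replaced by that of the other sign. -/
theorem preserves_append_cross {u : List Slice} {l l₀ : List Bool} (hu : run u l = some l₀)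
    (hu' : Preserves K u l) (hcap : CapClosed K l₀.length) (i : ℕ) (b : Bool)
    (h : Preserves K (u ++ [⟨i, .cross (!b)⟩]) l) : Preserves K (u ++ [⟨i, .cross b⟩]) l := by
  intro s l' hs h1
  rw [run_append, hu, Option.bind_some] at h1
  obtain ⟨hi, -⟩ := length_of_run_cross h1
  have hs' := hu' s l₀ hs hu
  obtain ⟨l₁, a, c, l₂, rfl, rfl⟩ := exists_split hi
  rw [run_cross] at h1
  obtain rfl := Option.some.inj h1
  have h2 := h s _ hs (by rw [run_append, hu, Option.bind_some, run_cross])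
  have h3 := preserves_smoothing hcap l₁.length _ _ hs' (run_smoothing l₁ l₂ a c)
  have h4 := app_skein hi hs'.mem_typed
  rw [app_append] at h2 ⊢
  by_cases hb : b = positiveType (l₁ ++ a :: c :: l₂) l₁.length
  · rw [← hb] at h4
    have h5 := congrArg (K.v • ·) h4
    simp only [smul_smul, mul_comm K.v K.vInv, K.vInv_mul, one_smul] at h5
    rw [h5]
    exact .smul _ ((h2.smul _).add (h3.smul _))
  · have hb' : b = !positiveType (l₁ ++ a :: c :: l₂) l₁.length := by
      cases b <;> simp_all
    rw [← hb'] at h4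
    have hb'' : positiveType (l₁ ++ a :: c :: l₂) l₁.length = !b := by rw [hb', Bool.not_not]
    rw [hb''] at h4
    have h5 := congrArg (K.vInv • ·) h4
    simp only [smul_add, smul_smul, K.vInv_mul, one_smul] at h5
    rw [← sub_eq_iff_eq_add] at h5
    rw [← h5, sub_eq_add_neg, ← neg_smul]
    exact (h2.smul _).add (h3.smul _)

/-- A crossing that misses the ends of the uppermost arc slides below it. If it involves an end, at
least one of its two signs simplifies the picture or prolongs the arc, and the skein relation gives
the other sign; the smoothing needs maxima on the same number `n` of strands. -/
theorem crossClosed_of_smaller (n : ℕ) (h : ∀ m < n, CrossClosed K m) (hcap : CapClosed K n) :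
    CrossClosed K n := by
  -- Positive positions come first: a crossing at position `0` is reduced to crossings on equally
  -- many strands at positions at least `2`.
  have hpos : ∀ (l : List Bool) (i : ℕ) (b : Bool), l.length = n → 1 ≤ i →
      Preserves K [⟨i, .cross b⟩] l := by
    intro l₀ i b hl₀ hi
    obtain ⟨i, rfl⟩ := Nat.exists_eq_add_of_le' hi
    refine preserves_of_arcs ?_ ?_
    · rintro rfl l' h
      simp [run, act_succ_nil] at h
    · intro a j l harc
      obtain ⟨hj, hlen⟩ := le_length_of_run_arcWord harc
      have hcross := fun i b => h l.length (by omega) l i b rfl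
      have hflip := fun i b => preserves_append_cross harc (.arc a j l) (hl₀ ▸ hcap) i b
      rcases lt_trichotomy (i + 1) j with hij | rfl | hij
      · obtain ⟨k, rfl⟩ := Nat.exists_eq_add_of_lt hij
        have := (rewrites_isStackRelation K).slide_left a i k (.cross b) (pass_cross (i + 1) b)
        simp only [Piece.bot, Piece.top] at this
        rw [show i + 2 + k = i + 1 + k + 1 by omega] at this
        exact .of_rewrites this
          (.append (u := [⟨i, .cross b⟩]) (hcross i b) fun _ _ => .arc _ _ _)
      · have hfalse : Preserves K (arcWord a (i + 1) ++ [⟨i + 1, .cross false⟩]) l := by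
          have h1 := (Rewrites.of_move (K := K) (.r2 (i + 1) true)).context (arcWord a i) []
          rw [arcWord_succ]
          simp only [List.append_assoc, List.append_nil, List.cons_append, List.nil_append,
            Bool.not_true] at h1 ⊢
          exact .of_rewrites h1 (.arc _ _ _)
        cases b
        · exact hfalse
        · exact hflip _ _ hfalse
      · rcases Nat.lt_or_eq_of_le (Nat.lt_succ_iff.1 hij) with hij | rfl
        · obtain ⟨k, rfl⟩ := Nat.exists_eq_add_of_lt hij
          have := (rewrites_isStackRelation K).slide_right a j k (.cross b)
          exact .of_rewrites this
            (.append (u := [⟨j + k, .cross b⟩]) (hcross _ b) fun _ _ => .arc _ _ _)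
        · have htrue : Preserves K (arcWord a j ++ [⟨j + 1, .cross true⟩]) l := by
            rw [← arcWord_succ]
            exact .arc _ _ _
          cases b
          · exact hflip _ _ htrue
          · exact htrue
  intro l₀ i b hl₀
  rcases i with _ | i
  · refine preserves_of_arcs ?_ ?_
    · rintro rfl l' h
      simp [run, Slice.act, Piece.act] at h
    · intro a j l harc
      obtain ⟨hj, hlen⟩ := le_length_of_run_arcWord harc
      have hflip := fun i b => preserves_append_cross harc (.arc a j l) (hl₀ ▸ hcap) i b
      rcases j with _ | j
      · exact .of_rewrites (.of_move (.r1Cup 0 a b)) (.arc (!a) 0 l)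
      · have htrue : Preserves K (arcWord a (j + 1) ++ [⟨0, .cross true⟩]) l := by
          refine .of_rewrites (arc_cross_left a j) ?_
          refine .append (u := [⟨1, .cup a⟩]) (preserves_cup _ _ _) fun l' hl' => ?_
          refine preserves_crosses 1 hpos _
            (fun x hx => ⟨(Nat.le_succ 1).trans (mem_overpass hx).1, (mem_overpass hx).2⟩) l' ?_
          rw [run_cup 1 a (by omega)] at hl'
          rw [← Option.some.inj hl']
          simp
          omega
        cases b
        · exact hflip _ _ htrue
        · exact htrue
  · exact hpos l₀ (i + 1) b hl₀ (by omega)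

theorem closed_all (n : ℕ) : CrossClosed K n ∧ CapClosed K n := by
  induction n using Nat.strong_induction_on with
  | _ n ih =>
    have hcap := capClosed_of_smaller n (fun m hm => (ih m hm).1) fun m hm => (ih m hm).2
    exact ⟨crossClosed_of_smaller n (fun m hm => (ih m hm).1) hcap, hcap⟩

theorem preserves_of_no_double (u : List Slice) (hu : doubleCount u = 0) (l : List Bool) :
    Preserves K u l := by
  induction u generalizing l with
  | nil => exact .nil l
  | cons x u ih =>
    obtain ⟨i, g⟩ := x
    simp only [doubleCount, List.countP_cons, Nat.add_eq_zero_iff] at hu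
    refine .append (u := [⟨i, g⟩]) ?_ fun l' _ => ih hu.1 l'
    cases g with
    | cup o => exact preserves_cup i o l
    | cap => exact (closed_all l.length).2 l i rfl
    | cross b => exact (closed_all l.length).1 l i b rfl
    | double => simp at hu

theorem exists_cls_eq {w : List Slice} (hw : run w [] = some []) (hw' : doubleCount w = 0) :
    ∃ x y : A, K.cls w = x • K.cls [] + y • K.cls [⟨0, .cup true⟩, ⟨0, .cap⟩] := by
  have := preserves_of_no_double (K := K) w hw' [] _ _ .empty hw
  rw [app_cls, List.nil_append] at this
  exact this.nil

end SkeinRing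

/-! ### Invariants as linear maps on the skein module. -/

namespace SkeinRing

variable {A : Type} [CommRing A] {K : SkeinRing A}

/-- A function of words that satisfies the skein relation and is invariant under the moves. -/
structure Invariant (K : SkeinRing A) {M : Type} [AddCommGroup M] [Module A M]
    (f : List Slice → M) : Prop where
  move : ∀ (p u u' r : List Slice) (l l' : List Bool), run p [] = some l → LocalMove u u' →
    run u l = some l' → f (p ++ u ++ r) = f (p ++ u' ++ r)
  skein : ∀ (p r : List Slice) (l : List Bool) (i : ℕ), run p [] = some l → i + 1 < l.length →
    K.vInv • f (p ++ [⟨i, .cross (positiveType l i)⟩] ++ r)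
      = K.v • f (p ++ [⟨i, .cross (!positiveType l i)⟩] ++ r)
        + K.z • f (p ++ smoothing l i ++ r)
  empty : f [] = 0
  regular : ∀ m : M, K.z • m = 0 → m = 0

variable {M : Type} [AddCommGroup M] [Module A M] {f : List Slice → M}

/-- The skein relation at a curl of the neighbouring strand: both signs of the crossing can be
removed, and the smoothing splits off a circle. This gives the claim multiplied by `z`, and `z` can
be cancelled by `regular`. -/
theorem Invariant.circle (hf : K.Invariant f) {p r : List Slice} {a : Bool} {l : List Bool}
    (hp : run p [] = some (a :: l)) :
    f (p ++ [⟨0, .cup true⟩, ⟨0, .cap⟩] ++ r) = K.δ • f (p ++ r) := by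
  -- The strand is bent by a zigzag in order to have a maximum at which the curl can be placed.
  have hp' : run (p ++ [⟨1, .cup (!a)⟩]) [] = some (a :: (!a) :: a :: l) := by
    simp [run_append, hp, run, act_succ, act_zero, Piece.act]
  have h1 := hf.skein (p ++ [⟨1, .cup (!a)⟩]) (⟨0, .cap⟩ :: r) _ 0 hp' (by simp)
  have h2 : ∀ b, f (p ++ [⟨1, .cup (!a)⟩] ++ [⟨0, .cross b⟩] ++ ⟨0, .cap⟩ :: r) = f (p ++ r) := by
    intro b
    have h3 := hf.move (p ++ [⟨1, .cup (!a)⟩]) _ _ r _ (a :: l) hp' (.r1Cap 0 b) (by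
      simp [run, act_zero, Piece.act])
    have h4 := hf.move p _ _ r _ (a :: l) hp (.zigzagRight 0 (!a)) (by
      simp [run, act_zero, act_succ, Piece.act])
    simp only [List.append_assoc, List.cons_append, List.nil_append, zero_add] at h3 h4 ⊢
    rw [h3, h4]
  have h3 : smoothing (a :: (!a) :: a :: l) 0 = [⟨0, .cap⟩, ⟨0, .cup (!a)⟩] := by
    simp [smoothing]
  have h4 : ∀ o, f (p ++ [⟨0, .cup o⟩, ⟨0, .cap⟩] ++ r)
      = f (p ++ [⟨0, .cup (!o)⟩, ⟨0, .cap⟩] ++ r) := by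
    intro o
    have hp'' : run (p ++ [⟨0, .cup o⟩]) [] = some (o :: (!o) :: a :: l) := by
      simp [run_append, hp, run, act_zero, Piece.act]
    have h5 := hf.move p _ _ (⟨0, .cap⟩ :: r) _ ((!o) :: o :: a :: l) hp (.r1Cup 0 o true) (by
      simp [run, act_zero, Piece.act])
    have h6 := hf.move (p ++ [⟨0, .cup o⟩]) _ _ r _ (a :: l) hp'' (.r1Cap 0 true) (by
      simp [run, act_zero, Piece.act])
    simp only [List.append_assoc, List.cons_append, List.nil_append] at h5 h6 ⊢
    rw [← h5, ← h6]
  have h5 : f (p ++ [⟨1, .cup (!a)⟩] ++ [⟨0, .cap⟩, ⟨0, .cup (!a)⟩] ++ ⟨0, .cap⟩ :: r)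
      = f (p ++ [⟨0, .cup true⟩, ⟨0, .cap⟩] ++ r) := by
    have h6 := hf.move p _ _ ([⟨0, .cup (!a)⟩, ⟨0, .cap⟩] ++ r) _ (a :: l) hp (.zigzagRight 0 (!a))
      (by simp [run, act_zero, act_succ, Piece.act])
    have h7 := h4 false
    simp only [List.append_assoc, List.cons_append, List.nil_append, zero_add, Bool.not_false]
      at h6 h7 ⊢
    rw [h6]
    cases a
    · rfl
    · exact h7
  rw [h2, h2, h3, h5] at h1
  refine sub_eq_zero.1 (hf.regular _ ?_)
  rw [smul_sub, smul_smul, K.z_mul, sub_smul, h1]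
  abel

/-- The linear map on the skein module induced by an invariant. -/
theorem Invariant.exists_linearMap (hf : K.Invariant f) :
    ∃ F : K.Skein →ₗ[A] M, ∀ w, F (K.cls w) = f w := by
  have hw : ∀ w, Finsupp.linearCombination A f (word A w) = f w := fun w => by
    simp [word]
  refine ⟨K.relations.liftQ (Finsupp.linearCombination A f) ?_, fun w => ?_⟩
  · rw [relations, Submodule.span_le]
    intro x hx
    simp only [SetLike.mem_coe, LinearMap.mem_ker]
    cases hx with
    | move p u u' r l l' h1 h2 h3 =>
      rw [map_sub, hw, hw, hf.move p u u' r l l' h1 h2 h3, sub_self]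
    | skein p r l i h1 h2 =>
      rw [map_sub, map_sub, map_smul, map_smul, map_smul, hw, hw, hw, hf.skein p r l i h1 h2]
      abel
    | circle p r l h1 h2 =>
      obtain ⟨a, l, rfl⟩ := List.exists_cons_of_ne_nil h2
      rw [map_sub, map_smul, hw, hw, hf.circle h1, sub_self]
  · rw [cls, Submodule.mkQ_apply, Submodule.liftQ_apply, hw]

/-- Invariants are determined by their value on the unknot. -/
theorem exists_coeff (K : SkeinRing A) {w : List Slice} (hw : run w [] = some [])
    (hw' : doubleCount w = 0) :
    ∃ c : A, ∀ (M : Type) [AddCommGroup M] [Module A M] (f : List Slice → M),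
      K.Invariant f → f w = c • f [⟨0, .cup true⟩, ⟨0, .cap⟩] := by
  obtain ⟨x, y, h⟩ := exists_cls_eq (K := K) hw hw'
  refine ⟨y, fun M _ _ f hf => ?_⟩
  obtain ⟨F, hF⟩ := hf.exists_linearMap
  rw [← hF, h, map_add, map_smul, map_smul, hF, hF, hf.empty, smul_zero, zero_add]

end SkeinRing

/-! ### Evaluation of Laurent polynomials -/

theorem monomial_mul_monomial (a b c d : ℤ) :
    monomial a b * monomial c d = monomial (a + c) (b + d) := by
  simp [monomial, AddMonoidAlgebra.single_mul_single]

theorem monomial_zero : monomial 0 0 = 1 := rfl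

/-- The evaluation of Laurent polynomials at non-zero numbers. -/
noncomputable def evalAt (x y : ℝˣ) : Laurent →+* ℝ :=
  (AddMonoidAlgebra.lift ℤ ℝ (ℤ × ℤ)
    { toFun := fun k => ((x ^ k.toAdd.1 * y ^ k.toAdd.2 : ℝˣ) : ℝ)
      map_one' := by simp
      map_mul' := fun k k' => by
        simp only [toAdd_mul, Prod.fst_add, Prod.snd_add, zpow_add, Units.val_mul]
        ring }).toRingHom

theorem evalAt_apply (x y : ℝˣ) (p : Laurent) :
    evalAt x y p = p.coeff.sum fun k a => (a : ℝ) * ((x : ℝ) ^ k.1 * (y : ℝ) ^ k.2) := by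
  have := AddMonoidAlgebra.lift_apply (R := ℤ) (A := ℝ) (M := ℤ × ℤ)
    { toFun := fun k => ((x ^ k.toAdd.1 * y ^ k.toAdd.2 : ℝˣ) : ℝ)
      map_one' := by simp
      map_mul' := fun k k' => by
        simp only [toAdd_mul, Prod.fst_add, Prod.snd_add, zpow_add, Units.val_mul]
        ring } p
  simpa [evalAt] using this

theorem evalAt_monomial (x y : ℝˣ) (k j : ℤ) :
    evalAt x y (monomial k j) = (x : ℝ) ^ k * (y : ℝ) ^ j := by
  rw [evalAt_apply, monomial, AddMonoidAlgebra.coeff_single, Finsupp.sum_single_index] <;> simp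

/-- Linear independence of characters: the maps `n ↦ t ^ (k n)` are distinct characters of the
monoid `ℕ`. -/
theorem eq_zero_of_sum_zpow {t : ℝ} (ht : 1 < t) (s : Finset ℤ) (a : ℤ → ℝ)
    (h : ∀ n : ℕ, ∑ k ∈ s, a k * (t ^ k) ^ n = 0) : ∀ k ∈ s, a k = 0 := by
  let φ : ℤ → (Multiplicative ℕ →* ℝ) := fun k => (powersHom ℝ) (t ^ k)
  have hφ : Function.Injective φ := by
    intro k k' hk
    have h1 := DFunLike.congr_fun hk (Multiplicative.ofAdd 1)
    simp only [φ, powersHom_apply, toAdd_ofAdd, pow_one] at h1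
    exact zpow_right_injective₀ (by linarith) (by linarith) h1
  have h1 := (linearIndependent_monoidHom (Multiplicative ℕ) ℝ).comp φ hφ
  rw [linearIndependent_iff'] at h1
  refine h1 s a ?_
  funext n
  simpa [φ] using h n.toAdd

/-- The witness is the positive root of `q² - z q - 1`. -/
theorem exists_sub_inv_eq {z : ℝ} (hz : 0 < z) : ∃ q : ℝ, 1 < q ∧ q - q⁻¹ = z := by
  have h0 : Real.sqrt (z ^ 2 + 4) ^ 2 = z ^ 2 + 4 := Real.sq_sqrt (by positivity)
  have h1 : (2 : ℝ) ≤ Real.sqrt (z ^ 2 + 4) := by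
    apply Real.le_sqrt_of_sq_le
    nlinarith
  have h2 : 1 < (z + Real.sqrt (z ^ 2 + 4)) / 2 := by linarith
  refine ⟨_, h2, ?_⟩
  field_simp
  nlinarith

/-- For fixed `q`, varying `n` separates the powers of `v`; then the values `z = 2 ^ n` separate the
powers of `z`. -/
theorem eq_zero_of_evalAt (p : Laurent)
    (h : ∀ (q x y : ℝˣ) (n : ℕ), 1 < (q : ℝ) → (y : ℝ) = q - (q : ℝ)⁻¹ →
      (x : ℝ) = (q : ℝ) ^ (-((n + 1 : ℕ) : ℤ)) → evalAt x y p = 0) : p = 0 := by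
  classical
  set S := p.coeff.support.image Prod.fst with hS
  set T := p.coeff.support.image Prod.snd with hT
  have hsum : ∀ x y : ℝˣ, evalAt x y p
      = ∑ k ∈ S, (∑ j ∈ T, (p.coeff (k, j) : ℝ) * (y : ℝ) ^ j) * (x : ℝ) ^ k := by
    intro x y
    rw [evalAt_apply, Finsupp.sum_of_support_subset (s := S ×ˢ T), Finset.sum_product]
    · refine Finset.sum_congr rfl fun k _ => ?_
      rw [Finset.sum_mul]
      exact Finset.sum_congr rfl fun j _ => by ring
    · intro k hk
      exact Finset.mem_product.2
        ⟨Finset.mem_image_of_mem _ hk, Finset.mem_image_of_mem _ hk⟩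
    · simp
  have h1 : ∀ q : ℝ, 1 < q → ∀ k ∈ S, ∑ j ∈ T, (p.coeff (k, j) : ℝ) * (q - q⁻¹) ^ j = 0 := by
    intro q hq k hk
    have hq0 : q ≠ 0 := by positivity
    have hz0 : q - q⁻¹ ≠ 0 := by
      have : q⁻¹ < 1 := inv_lt_one_of_one_lt₀ hq
      linarith
    -- Exponents are negated because `x = q ^ (-(n + 1))`; the shift from `n` to `n + 1` accounts
    -- for the extra factor `q ^ k`.
    have h2 := eq_zero_of_sum_zpow hq (S.image fun k => -k)
      (fun k => (∑ j ∈ T, (p.coeff (-k, j) : ℝ) * (q - q⁻¹) ^ j) * q ^ k) (fun n => by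
        have h3 := h (Units.mk0 q hq0) (Units.mk0 (q ^ (-((n + 1 : ℕ) : ℤ))) (zpow_ne_zero _ hq0))
          (Units.mk0 _ hz0) n hq rfl rfl
        rw [hsum] at h3
        rw [Finset.sum_image (by simp), ← h3]
        refine Finset.sum_congr rfl fun k _ => ?_
        simp only [neg_neg, Units.val_mk0]
        rw [mul_assoc, ← zpow_natCast, ← zpow_mul, ← zpow_mul, ← zpow_add₀ hq0]
        congr 2
        push_cast
        ring) (-k) (Finset.mem_image_of_mem _ hk)
    simpa [hq0, zpow_ne_zero] using h2
  have h2 : ∀ k ∈ S, ∀ j ∈ T, p.coeff (k, j) = 0 := by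
    intro k hk j hj
    have h3 := eq_zero_of_sum_zpow (t := 2) (by norm_num) T (fun j => (p.coeff (k, j) : ℝ))
      (fun n => by
        obtain ⟨q, hq, hqz⟩ := exists_sub_inv_eq (z := 2 ^ n) (by positivity)
        rw [← h1 q hq k hk, hqz]
        refine Finset.sum_congr rfl fun j _ => ?_
        rw [← zpow_natCast, ← zpow_natCast, ← zpow_mul, ← zpow_mul, mul_comm (n : ℤ)]) j hj
    exact_mod_cast h3
  rw [← AddMonoidAlgebra.coeff_eq_zero]
  ext ⟨k, j⟩
  by_contra hne
  have hmem : (k, j) ∈ p.coeff.support := Finsupp.mem_support_iff.2 hne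
  exact hne (h2 k (Finset.mem_image_of_mem _ hmem) j (Finset.mem_image_of_mem _ hmem))

/-! ### The filtration of the Laurent polynomials -/

/-- The additive map `p ↦ ∑ k, a k j * k ^ m / m!`. -/
noncomputable def momentHom (m : ℕ) (j : ℤ) : Laurent →+ ℚ :=
  (Finsupp.liftAddHom fun k : ℤ × ℤ => if k.2 = j then
    (AddMonoidHom.mulRight ((k.1 : ℚ) ^ m / (m.factorial : ℚ))).comp (Int.castAddHom ℚ)
    else 0).comp AddMonoidAlgebra.coeffAddEquiv.toAddMonoidHom

theorem momentHom_single (m : ℕ) (j : ℤ) (k : ℤ × ℤ) (a : ℤ) :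
    momentHom m j (AddMonoidAlgebra.single k a)
      = if k.2 = j then (a : ℚ) * ((k.1 : ℚ) ^ m / (m.factorial : ℚ)) else 0 := by
  have : momentHom m j (AddMonoidAlgebra.single k a) = Finsupp.liftAddHom (fun k : ℤ × ℤ =>
    if k.2 = j then (AddMonoidHom.mulRight ((k.1 : ℚ) ^ m / (m.factorial : ℚ))).comp
      (Int.castAddHom ℚ) else 0) (Finsupp.single k a) := rfl
  rw [this, Finsupp.liftAddHom_apply_single]
  split_ifs <;> simp

theorem coeffB_eq_momentHom (p : Laurent) (m : ℕ) (j : ℤ) : coeffB p m j = momentHom m j p := by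
  classical
  have h : momentHom m j p = p.coeff.sum fun k a =>
      if k.2 = j then (a : ℚ) * ((k.1 : ℚ) ^ m / (m.factorial : ℚ)) else 0 := by
    conv_lhs => rw [← AddMonoidAlgebra.sum_coeff_single p]
    rw [Finsupp.sum, map_sum]
    exact Finset.sum_congr rfl fun k _ => momentHom_single m j k _
  rw [h, Finsupp.sum_of_support_subset (s := p.coeff.support.image Prod.fst
    ×ˢ insert j (p.coeff.support.image Prod.snd)), Finset.sum_product, coeffB]
  · refine Finset.sum_congr rfl fun k _ => ?_
    simp [mul_div_assoc]
  · intro k hk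
    exact Finset.mem_product.2 ⟨Finset.mem_image_of_mem _ hk,
      Finset.mem_insert_of_mem (Finset.mem_image_of_mem _ hk)⟩
  · simp

/-- The binomial theorem for `(k + a) ^ m / m!`, that is, multiplication of power series by `exp (a
h)`. -/
theorem momentHom_monomial_mul (a b : ℤ) (p : Laurent) (m : ℕ) (j : ℤ) :
    momentHom m j (monomial a b * p)
      = ∑ i ∈ Finset.range (m + 1),
          (a : ℚ) ^ (m - i) / ((m - i).factorial : ℚ) * momentHom i (j - b) p := by
  induction p using AddMonoidAlgebra.induction_linear with
  | zero => simp
  | add p p' h h' => simp only [mul_add, map_add, h, h', Finset.sum_add_distrib]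
  | single k c =>
    rw [monomial, AddMonoidAlgebra.single_mul_single]
    simp only [momentHom_single, one_mul, Prod.snd_add, Prod.fst_add, eq_sub_iff_add_eq,
      add_comm k.2 b]
    split_ifs with h
    · rw [add_comm (a : ℤ) k.1]
      push_cast
      rw [add_pow, Finset.sum_div, Finset.mul_sum]
      refine Finset.sum_congr rfl fun i hi => ?_
      have hi' : i ≤ m := Nat.lt_succ_iff.1 (Finset.mem_range.1 hi)
      rw [Nat.cast_choose ℚ hi']
      have h1 : (m.factorial : ℚ) ≠ 0 := by positivity
      have h2 : (i.factorial : ℚ) ≠ 0 := by positivity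
      have h3 : ((m - i).factorial : ℚ) ≠ 0 := by positivity
      field_simp
    · simp

/-- The Laurent polynomials which, after the substitution `v = exp h`, have only terms of total
degree at least `n` in `h` and `z`. -/
def filtration (n : ℤ) : AddSubgroup Laurent where
  carrier := {p | ∀ (m : ℕ) (j : ℤ), m + j < n → momentHom m j p = 0}
  zero_mem' := fun m j _ => map_zero _
  add_mem' := fun hp hp' m j h => by rw [map_add, hp m j h, hp' m j h, add_zero]
  neg_mem' := fun hp m j h => by rw [map_neg, hp m j h, neg_zero]

theorem monomial_mul_mem_filtration (a b : ℤ) {n : ℤ} {p : Laurent} (hp : p ∈ filtration n) :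
    monomial a b * p ∈ filtration (n + b) := by
  intro m j h
  rw [momentHom_monomial_mul]
  refine Finset.sum_eq_zero fun i hi => ?_
  have := Finset.mem_range.1 hi
  rw [hp i (j - b) (by omega), mul_zero]

/-- The series `exp (a h) - exp (a' h)` has no constant term: the summands with `i = m` cancel, and
the others involve lower moments. -/
theorem monomial_sub_mul_mem_filtration (a a' : ℤ) {n : ℤ} {p : Laurent} (hp : p ∈ filtration n) :
    (monomial a 0 - monomial a' 0) * p ∈ filtration (n + 1) := by
  intro m j h
  rw [sub_mul, map_sub, momentHom_monomial_mul, momentHom_monomial_mul, ← Finset.sum_sub_distrib]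
  refine Finset.sum_eq_zero fun i hi => ?_
  have := Finset.mem_range.1 hi
  rcases Nat.lt_or_eq_of_le (Nat.lt_succ_iff.1 this) with hi | rfl
  · rw [hp i (j - 0) (by omega), mul_zero, mul_zero, sub_zero]
  · simp

theorem one_mem_filtration : (1 : Laurent) ∈ filtration 0 := by
  intro m j h
  rw [← monomial_zero, monomial, momentHom_single, if_neg]
  intro h'
  simp only at h'
  omega

/-- The ring generated by the elements that occur in the skein relation. -/
noncomputable def coeffRing : Subring Laurent :=
  Subring.closure {monomial 1 0, monomial (-1) 0, monomial 0 1,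
    (monomial (-1) 0 - monomial 1 0) * monomial 0 (-1)}

/-- The only generator with a negative power of `z` is `(v⁻¹ - v) / z`, whose numerator gains the
degree that the denominator loses. -/
theorem mul_mem_filtration {a : Laurent} (ha : a ∈ coeffRing) {n : ℤ} {p : Laurent}
    (hp : p ∈ filtration n) : a * p ∈ filtration n := by
  induction ha using Subring.closure_induction generalizing p with
  | mem a ha =>
    simp only [Set.mem_insert_iff, Set.mem_singleton_iff] at ha
    rcases ha with rfl | rfl | rfl | rfl
    · simpa using monomial_mul_mem_filtration 1 0 hp
    · simpa using monomial_mul_mem_filtration (-1) 0 hp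
    · have := monomial_mul_mem_filtration 0 1 hp
      exact fun m j h => this m j (by omega)
    · rw [mul_assoc]
      have := monomial_sub_mul_mem_filtration (-1) 1 (monomial_mul_mem_filtration 0 (-1) hp)
      simpa using this
  | zero => rw [zero_mul]; exact zero_mem _
  | one => rwa [one_mul]
  | add a b _ _ iha ihb => rw [add_mul]; exact add_mem (iha hp) (ihb hp)
  | neg a _ ih => rw [neg_mul]; exact neg_mem (ih hp)
  | mul a b _ _ iha ihb => rw [mul_assoc]; exact iha (ihb hp)

/-- The elements that occur in the skein relation of the HOMFLYPT polynomial. -/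
noncomputable def homflyptRing : SkeinRing coeffRing where
  v := ⟨monomial 1 0, Subring.subset_closure (by simp)⟩
  vInv := ⟨monomial (-1) 0, Subring.subset_closure (by simp)⟩
  z := ⟨monomial 0 1, Subring.subset_closure (by simp)⟩
  δ := ⟨(monomial (-1) 0 - monomial 1 0) * monomial 0 (-1), Subring.subset_closure (by simp)⟩
  vInv_mul := Subtype.ext (by
    show monomial (-1) 0 * monomial 1 0 = 1
    rw [monomial_mul_monomial]; rfl)
  z_mul := Subtype.ext (by
    show monomial 0 1 * ((monomial (-1) 0 - monomial 1 0) * monomial 0 (-1))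
      = monomial (-1) 0 - monomial 1 0
    rw [mul_left_comm, monomial_mul_monomial]
    exact mul_one _)

/-! ### Moves and crossing changes of diagrams -/

theorem doubleCount_append (u u' : List Slice) :
    doubleCount (u ++ u') = doubleCount u + doubleCount u' := by
  simp [doubleCount]

theorem LocalMove.doubleCount_eq {u u' : List Slice} (h : LocalMove u u') :
    doubleCount u = doubleCount u' := by
  cases h with
  | commute i k g h => cases g <;> cases h <;> rfl
  | _ => rfl

theorem doubleCount_smoothing (l : List Bool) (i : ℕ) : doubleCount (smoothing l i) = 0 := by
  unfold smoothing
  split_ifs <;> rfl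

theorem step_cross (t : Trace) (i : ℕ) (b : Bool) :
    t.step ⟨i, .cross b⟩ = t.step ⟨i, .double⟩ := by
  unfold Trace.step
  rcases t.arcs.drop i with _ | ⟨a, _ | ⟨c, B⟩⟩ <;> rfl

theorem components_cross (p r : List Slice) (i : ℕ) (b : Bool) :
    components (p ++ [⟨i, .cross b⟩] ++ r) = components (p ++ [⟨i, .double⟩] ++ r) := by
  simp only [components, List.foldl_append, List.foldl_cons, List.foldl_nil, step_cross]

theorem act_cross (i : ℕ) (b : Bool) (l : List Bool) :
    Slice.act ⟨i, .cross b⟩ l = Slice.act ⟨i, .double⟩ l := by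
  unfold Slice.act
  rcases l.drop i with _ | ⟨a, _ | ⟨c, B⟩⟩ <;> rfl

theorem succ_lt_length_of_run_cross {i : ℕ} {b : Bool} {l l' : List Bool}
    (h : run [⟨i, .cross b⟩] l = some l') : i + 1 < l.length := by
  have hi := pos_le_of_run h
  obtain ⟨l₁, l₂, rfl, rfl⟩ : ∃ l₁ l₂, l = l₁ ++ l₂ ∧ i = l₁.length :=
    ⟨l.take i, l.drop i, by simp, by simp [hi]⟩
  rcases l₂ with _ | ⟨a, _ | ⟨c, l₂⟩⟩
  · simp [run, Slice.act, Piece.act] at h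
  · simp [run, Slice.act, Piece.act] at h
  · simp

theorem run_append_of_eq_some {p : List Slice} {l : List Bool} (hp : run p [] = some l)
    (u r : List Slice) : run (p ++ u ++ r) [] = (run u l).bind (run r) := by
  simp [run_append, hp, List.append_assoc]

theorem exists_isDiagram_iff {w : List Slice} :
    (∃ μ, IsDiagram μ w) ↔ run w [] = some [] ∧ doubleCount w = 0 ∧ w ≠ [] := by
  constructor
  · rintro ⟨μ, ⟨h1, h2⟩, h3⟩
    refine ⟨h1, h3, ?_⟩
    rintro rfl
    exact μ.pos.ne h2
  · rintro ⟨h1, h2, h3⟩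
    exact ⟨⟨_, components_pos h1 h3⟩, ⟨h1, rfl⟩, h2⟩

section Context

variable {p u u' r : List Slice} {l l' : List Bool}

theorem components_move (hp : run p [] = some l) (h : LocalMove u u') (hu : run u l = some l')
    (hw : run (p ++ u ++ r) [] = some []) :
    components (p ++ u ++ r) = components (p ++ u' ++ r) :=
  components_eq_of_sameOp (SameOp.append hp
    (LocalMove.sameOp one_ne_zero h l l' l' hu (h.run_eq hu)) (by rw [hw]; rfl)) hw

theorem isDiagram_move_iff (hp : run p [] = some l) (h : LocalMove u u')
    (hu : run u l = some l') (μ : ℕ+) :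
    IsDiagram μ (p ++ u ++ r) ↔ IsDiagram μ (p ++ u' ++ r) := by
  have h1 : run (p ++ u ++ r) [] = run (p ++ u' ++ r) [] := by
    rw [run_append_of_eq_some hp, run_append_of_eq_some hp, hu, h.run_eq hu]
  have h2 : doubleCount (p ++ u ++ r) = doubleCount (p ++ u' ++ r) := by
    simp only [doubleCount_append, h.doubleCount_eq]
  rw [IsDiagram, IsDiagram, IsSingularDiagram, IsSingularDiagram, ← h1, ← h2]
  refine and_congr_left fun _ => and_congr_right fun h3 => ?_
  rw [components_move hp h hu h3]

theorem isDiagram_cross_iff (p r : List Slice) (i : ℕ) (b c : Bool) (μ : ℕ+) :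
    IsDiagram μ (p ++ [⟨i, .cross b⟩] ++ r) ↔ IsDiagram μ (p ++ [⟨i, .cross c⟩] ++ r) := by
  simp only [IsDiagram, IsSingularDiagram, components_cross, doubleCount_append]
  simp [run_append, run, act_cross, doubleCount]

theorem run_smoothing_eq {i : ℕ} (hi : i + 1 < l.length) (b : Bool) :
    run (smoothing l i) l = run [⟨i, .cross b⟩] l := by
  obtain ⟨l₁, a, c, l₂, rfl, rfl⟩ := exists_split hi
  rw [run_smoothing, run_cross]

theorem exists_isDiagram_smoothing_iff (hp : run p [] = some l) {i : ℕ} (hi : i + 1 < l.length)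
    (b : Bool) : (∃ μ, IsDiagram μ (p ++ smoothing l i ++ r))
      ↔ ∃ μ, IsDiagram μ (p ++ [⟨i, .cross b⟩] ++ r) := by
  -- A smoothing can be the empty stack, so nonemptiness has to come from the part below it, which
  -- carries at least two strands.
  have h : p ≠ [] := by
    rintro rfl
    obtain rfl : [] = l := by simpa [run] using hp
    simp at hi
  rw [exists_isDiagram_iff, exists_isDiagram_iff, run_append_of_eq_some hp,
    run_append_of_eq_some hp, run_smoothing_eq hi b]
  simp only [doubleCount_append, doubleCount_smoothing]
  simp [doubleCount, h]

end Context

/-! ### HOMFLYPT polynomials as functions of diagrams -/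

open Classical in
/-- A family of maps on links as a function of words, which vanishes on the words that are not
diagrams of links. -/
noncomputable def ofLinks {M : Type} [Zero M] (Q : (μ : ℕ+) → Link μ → M) (w : List Slice) : M :=
  if h : ∃ μ, IsDiagram μ w then Q h.choose (Link.mk w h.choose_spec) else 0

theorem IsDiagram.unique {μ μ' : ℕ+} {w : List Slice} (h : IsDiagram μ w) (h' : IsDiagram μ' w) :
    μ = μ' := PNat.eq (h.1.2.symm.trans h'.1.2)

section OfLinks

variable {M : Type} [Zero M] {Q : (μ : ℕ+) → Link μ → M}

theorem ofLinks_eq {μ : ℕ+} {w : List Slice} (h : IsDiagram μ w) :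
    ofLinks Q w = Q μ (Link.mk w h) := by
  have h' : ∃ μ, IsDiagram μ w := ⟨μ, h⟩
  rw [ofLinks, dif_pos h']
  have : ∀ (μ' : ℕ+) (h'' : IsDiagram μ' w), Q μ' (Link.mk w h'') = Q μ (Link.mk w h) := by
    intro μ' h''
    obtain rfl := h.unique h''
    rfl
  exact this _ _

theorem ofLinks_eq_zero {w : List Slice} (h : ¬ ∃ μ, IsDiagram μ w) : ofLinks Q w = 0 :=
  dif_neg h

theorem ofLinks_move {p u u' r : List Slice} {l l' : List Bool} (hp : run p [] = some l)
    (h : LocalMove u u') (hu : run u l = some l') :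
    ofLinks Q (p ++ u ++ r) = ofLinks Q (p ++ u' ++ r) := by
  by_cases hw : ∃ μ, IsDiagram μ (p ++ u ++ r)
  · obtain ⟨μ, hw⟩ := hw
    rw [ofLinks_eq hw, ofLinks_eq ((isDiagram_move_iff hp h hu μ).1 hw)]
    exact congrArg (Q μ) (Quot.sound ⟨p, r, u, u', h, rfl, rfl⟩)
  · rw [ofLinks_eq_zero hw, ofLinks_eq_zero]
    rwa [← exists_congr fun μ => isDiagram_move_iff hp h hu μ]

end OfLinks

theorem coeffRing_smul (a : coeffRing) (p : Laurent) : a • p = (a : Laurent) * p := rfl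

theorem IsHOMFLYPT.invariant {Q : (μ : ℕ+) → Link μ → Laurent} (hQ : IsHOMFLYPT Q) :
    homflyptRing.Invariant (ofLinks Q) where
  move p u u' r l l' hp h hu := ofLinks_move hp h hu
  skein p r l i hp hi := by
    show monomial (-1) 0 * _ = monomial 1 0 * _ + monomial 0 1 * _
    have h0 := exists_isDiagram_smoothing_iff (r := r) hp hi (positiveType l i)
    have h1 := isDiagram_cross_iff p r i (positiveType l i) (!positiveType l i)
    by_cases h : ∃ μ, IsDiagram μ (p ++ [⟨i, .cross (positiveType l i)⟩] ++ r)
    · obtain ⟨μ₀, h2⟩ := h0.2 h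
      obtain ⟨μ, h⟩ := h
      rw [ofLinks_eq h, ofLinks_eq ((h1 μ).1 h), ofLinks_eq h2, ← sub_eq_iff_eq_add']
      exact hQ.1 _ _ _ ⟨p, r, l, i, hp, rfl, rfl, rfl⟩ μ μ₀ h _ h2
    · rw [ofLinks_eq_zero h, ofLinks_eq_zero (mt h0.1 h),
        ofLinks_eq_zero (mt (exists_congr h1).2 h)]
      simp
  empty := by
    refine ofLinks_eq_zero ?_
    rw [exists_isDiagram_iff]
    simp
  regular m h := by
    have h' : monomial 0 1 * m = 0 := h
    have := congrArg (monomial 0 (-1) * ·) h'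
    simpa only [← mul_assoc, monomial_mul_monomial, mul_zero, add_zero, neg_add_cancel,
      monomial_zero, one_mul] using this

theorem IsHOMFLYPT.ofLinks_unknot {Q : (μ : ℕ+) → Link μ → Laurent} (hQ : IsHOMFLYPT Q) :
    ofLinks Q [⟨0, .cup true⟩, ⟨0, .cap⟩] = 1 := (ofLinks_eq _).trans hQ.2

/-- The HOMFLYPT polynomial of a diagram, which is determined by the skein relation. -/
theorem exists_homflypt {w : List Slice} (h : ∃ μ, IsDiagram μ w) :
    ∃ c : coeffRing, ∀ (M : Type) [AddCommGroup M] [Module coeffRing M] (f : List Slice → M),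
      homflyptRing.Invariant f → f w = c • f [⟨0, .cup true⟩, ⟨0, .cap⟩] := by
  obtain ⟨μ, h1, h2⟩ := h
  exact homflyptRing.exists_coeff h1.1 h2

theorem IsHOMFLYPT.unique {P Q : (μ : ℕ+) → Link μ → Laurent} (hP : IsHOMFLYPT P)
    (hQ : IsHOMFLYPT Q) : Q = P := by
  funext μ L
  obtain ⟨⟨w, h⟩, rfl⟩ := Quot.exists_rep L
  obtain ⟨c, hc⟩ := exists_homflypt ⟨μ, h⟩
  have h1 := hc _ _ hP.invariant
  have h2 := hc _ _ hQ.invariant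
  rw [hP.ofLinks_unknot, ofLinks_eq h] at h1
  rw [hQ.ofLinks_unknot, ofLinks_eq h] at h2
  exact h2.trans h1.symm

/-! ### Existence of the HOMFLYPT polynomial -/

/-- The functions of the parameters `(n, q)` of the state sums. -/
def StateSums : Type := ℕ × {q : ℝ // 1 < q} → ℝ

noncomputable instance : CommRing StateSums := inferInstanceAs (CommRing (_ → ℝ))

theorem ne_zero_of_one_lt (q : {q : ℝ // 1 < q}) : (q : ℝ) ≠ 0 := by
  have := q.2
  positivity

theorem sub_inv_ne_zero (q : {q : ℝ // 1 < q}) : (q : ℝ) - (q : ℝ)⁻¹ ≠ 0 := by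
  have h := q.2
  have := inv_lt_one_of_one_lt₀ h
  linarith

/-- The substitution `v = q ^ (-(n + 1))`, `z = q - q⁻¹`. -/
noncomputable def evalStateSums : Laurent →+* StateSums :=
  RingHom.pi fun t : ℕ × {q : ℝ // 1 < q} =>
    evalAt (Units.mk0 (vval (t.1 + 1) t.2) (vval_ne_zero (ne_zero_of_one_lt t.2)))
      (Units.mk0 _ (sub_inv_ne_zero t.2))

theorem evalStateSums_monomial (k j : ℤ) (t : ℕ × {q : ℝ // 1 < q}) :
    evalStateSums (monomial k j) t
      = vval (t.1 + 1) t.2 ^ k * ((t.2 : ℝ) - (t.2 : ℝ)⁻¹) ^ j :=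
  evalAt_monomial _ _ k j

theorem evalStateSums_injective : Function.Injective evalStateSums := by
  rw [injective_iff_map_eq_zero]
  intro p hp
  refine eq_zero_of_evalAt p fun q x y n hq hy hx => ?_
  have h := congrFun hp (n, ⟨q, hq⟩)
  have hx' : x = Units.mk0 (vval (n + 1) q) (vval_ne_zero q.ne_zero) := Units.ext hx
  have hy' : y = Units.mk0 _ (sub_inv_ne_zero ⟨q, hq⟩) := Units.ext hy
  rw [hx', hy']
  exact h

noncomputable instance : Module coeffRing StateSums :=
  Module.compHom StateSums (evalStateSums.comp coeffRing.subtype)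

open Classical in
/-- The state sums of a diagram. -/
noncomputable def stateSums (w : List Slice) : StateSums := fun t =>
  if ∃ μ, IsDiagram μ w then
    stateOp (t.1 + 1) t.2 w [] (fun _ => 1) (Stream'.const 0) else 0

theorem stateSums_eq {w : List Slice} (h : ∃ μ, IsDiagram μ w) (t : ℕ × {q : ℝ // 1 < q}) :
    stateSums w t = stateOp (t.1 + 1) t.2 w [] (fun _ => 1) (Stream'.const 0) := if_pos h

theorem stateSums_eq_zero {w : List Slice} (h : ¬ ∃ μ, IsDiagram μ w) : stateSums w = 0 :=
  funext fun _ => if_neg h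

theorem stateSums_skein {p r : List Slice} {l : List Bool} {i : ℕ} (hp : run p [] = some l)
    (hi : i + 1 < l.length) (t : ℕ × {q : ℝ // 1 < q}) :
    (vval (t.1 + 1) t.2)⁻¹ * stateSums (p ++ [⟨i, .cross (positiveType l i)⟩] ++ r) t
      - vval (t.1 + 1) t.2 * stateSums (p ++ [⟨i, .cross (!positiveType l i)⟩] ++ r) t
      = ((t.2 : ℝ) - (t.2 : ℝ)⁻¹) * stateSums (p ++ smoothing l i ++ r) t := by
  have h0 := exists_isDiagram_smoothing_iff (r := r) hp hi (positiveType l i)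
  have h1 := isDiagram_cross_iff p r i (positiveType l i) (!positiveType l i)
  by_cases h : ∃ μ, IsDiagram μ (p ++ [⟨i, .cross (positiveType l i)⟩] ++ r)
  · rw [stateSums_eq h, stateSums_eq ((exists_congr h1).1 h), stateSums_eq (h0.2 h)]
    have h2 := stateOp_skein (N := t.1 + 1) (ne_zero_of_one_lt t.2) hi
    obtain ⟨l', hl'⟩ : ∃ l', run (smoothing l i) l = some l' := by
      obtain ⟨l₁, a, c, l₂, rfl, rfl⟩ := exists_split hi
      exact ⟨_, run_smoothing _ _ _ _⟩
    have h3 : ∀ u, run u l = some l' → stateOp (t.1 + 1) t.2 (p ++ u ++ r) []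
        = stateOp (t.1 + 1) t.2 r l' * stateOp (t.1 + 1) t.2 u l
          * stateOp (t.1 + 1) t.2 p [] := by
      intro u hu
      have : run (p ++ u) [] = some l' := by simp [run_append, hp, hu]
      rw [stateOp_append _ this, stateOp_append _ hp, mul_assoc]
    rw [h3 _ hl', h3 _ (run_smoothing_eq hi _ ▸ hl'), h3 _ (run_smoothing_eq hi _ ▸ hl')]
    have h4 := congrArg (fun T => (stateOp (t.1 + 1) t.2 r l' * T
      * stateOp (t.1 + 1) t.2 p [] : Op (t.1 + 1)) (fun _ => 1) (Stream'.const 0)) h2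
    simpa only [mul_sub, sub_mul, mul_smul_comm, smul_mul_assoc, LinearMap.sub_apply,
      LinearMap.smul_apply, Pi.sub_apply, Pi.smul_apply, smul_eq_mul] using h4
  · rw [stateSums_eq_zero h, stateSums_eq_zero (mt h0.1 h),
      stateSums_eq_zero (mt (exists_congr h1).2 h)]
    simp only [show (0 : StateSums) t = 0 from rfl, mul_zero, sub_zero]

theorem stateSums_move {p u u' r : List Slice} {l l' : List Bool} (hp : run p [] = some l)
    (h : LocalMove u u') (hu : run u l = some l') :
    stateSums (p ++ u ++ r) = stateSums (p ++ u' ++ r) := by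
  have h1 := exists_congr fun μ => isDiagram_move_iff (r := r) hp h hu μ
  by_cases hw : ∃ μ, IsDiagram μ (p ++ u ++ r)
  · funext t
    rw [stateSums_eq hw, stateSums_eq (h1.1 hw)]
    obtain ⟨-, -, -, h2⟩ := SameOp.append hp (LocalMove.sameOp (N := t.1 + 1)
      (ne_zero_of_one_lt t.2) h l l' l' hu (h.run_eq hu))
      (by rw [(exists_isDiagram_iff.1 hw).1]; rfl)
    rw [h2]
  · rw [stateSums_eq_zero hw, stateSums_eq_zero (mt h1.2 hw)]

theorem stateSums_invariant : homflyptRing.Invariant stateSums where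
  move p u u' r l l' hp h hu := stateSums_move hp h hu
  skein p r l i hp hi := by
    funext t
    have h := stateSums_skein (r := r) hp hi t
    show evalStateSums (monomial (-1) 0) t * _ = evalStateSums (monomial 1 0) t * _
      + evalStateSums (monomial 0 1) t * _
    simp only [evalStateSums_monomial, zpow_neg_one, zpow_one, zpow_zero, mul_one, one_mul]
    linarith
  empty := by
    refine stateSums_eq_zero ?_
    rw [exists_isDiagram_iff]
    simp
  regular m h := by
    funext t
    have h1 : evalStateSums (monomial 0 1) t * m t = 0 := congrFun h t
    rw [evalStateSums_monomial, zpow_zero, zpow_one, one_mul] at h1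
    exact (mul_eq_zero.1 h1).resolve_left (sub_inv_ne_zero t.2)

theorem isDiagram_unknot : IsDiagram 1 [⟨0, .cup true⟩, ⟨0, .cap⟩] := by
  refine ⟨⟨?_, ?_⟩, ?_⟩ <;> decide

/-- The value is the quantum dimension, a nonempty sum of positive powers of `q`; this is why `N = n
+ 1` is used. -/
theorem stateSums_unknot_ne_zero (t : ℕ × {q : ℝ // 1 < q}) :
    stateSums [⟨0, .cup true⟩, ⟨0, .cap⟩] t ≠ 0 := by
  rw [stateSums_eq ⟨1, isDiagram_unknot⟩]
  have h : stateOp (t.1 + 1) t.2 [⟨0, .cup true⟩, ⟨0, .cap⟩] [] (fun _ => 1) (Stream'.const 0)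
      = ∑ x : Fin (t.1 + 1), kappa (t.2 : ℝ) x := by
    simp [stateOp, act_zero, Piece.act, sliceOp_zero, baseOp, capOp_apply, cupOp_apply,
      capWeight, cupWeight]
  rw [h]
  have : (0 : ℝ) < t.2 := lt_trans one_pos t.2.2
  refine (Finset.sum_pos (fun x _ => ?_) Finset.univ_nonempty).ne'
  exact zpow_pos this _

open Classical in
/-- The HOMFLYPT polynomial of a diagram. -/
noncomputable def homflyptOfDiagram (w : List Slice) : Laurent :=
  if h : ∃ μ, IsDiagram μ w then ((exists_homflypt h).choose : Laurent) else 0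

theorem homflyptOfDiagram_spec (w : List Slice) (t : ℕ × {q : ℝ // 1 < q}) :
    stateSums w t = evalStateSums (homflyptOfDiagram w) t
      * stateSums [⟨0, .cup true⟩, ⟨0, .cap⟩] t := by
  by_cases h : ∃ μ, IsDiagram μ w
  · rw [homflyptOfDiagram, dif_pos h]
    exact congrFun ((exists_homflypt h).choose_spec StateSums _ stateSums_invariant) t
  · rw [homflyptOfDiagram, dif_neg h, stateSums_eq_zero h, map_zero]
    exact (zero_mul _).symm

/-- Identities between the chosen coefficients can be tested on state sums, so the choice does no
harm. -/
theorem eq_of_evalStateSums_mul {a b : Laurent}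
    (h : ∀ t, evalStateSums a t * stateSums [⟨0, .cup true⟩, ⟨0, .cap⟩] t
      = evalStateSums b t * stateSums [⟨0, .cup true⟩, ⟨0, .cap⟩] t) : a = b :=
  evalStateSums_injective (funext fun t => mul_right_cancel₀ (stateSums_unknot_ne_zero t) (h t))

theorem homflyptOfDiagram_move {μ : ℕ+} {w w' : List Slice} (h : Move w w')
    (hw : IsDiagram μ w) : homflyptOfDiagram w = homflyptOfDiagram w' := by
  obtain ⟨p, r, u, u', h, rfl, rfl⟩ := h
  have hr := hw.1.1
  rw [List.append_assoc, run_append, Option.bind_eq_some_iff] at hr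
  obtain ⟨l, hp, hr⟩ := hr
  rw [run_append, Option.bind_eq_some_iff] at hr
  obtain ⟨l', hu, -⟩ := hr
  refine eq_of_evalStateSums_mul fun t => ?_
  rw [← homflyptOfDiagram_spec, ← homflyptOfDiagram_spec, stateSums_move hp h hu]

/-- The HOMFLYPT polynomial. -/
noncomputable def homflypt (μ : ℕ+) : Link μ → Laurent :=
  Quot.lift (fun D => homflyptOfDiagram D.1) fun D _ h => homflyptOfDiagram_move h D.2

theorem isHOMFLYPT_homflypt : IsHOMFLYPT homflypt := by
  refine ⟨?_, ?_⟩
  · rintro _ _ _ ⟨p, r, l, i, hp, rfl, rfl, rfl⟩ μ μ₀ h1 h2 h3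
    show monomial (-1) 0 * homflyptOfDiagram _ - monomial 1 0 * homflyptOfDiagram _
      = monomial 0 1 * homflyptOfDiagram _
    have hi : i + 1 < l.length := by
      have h4 := h1.1.1
      rw [run_append_of_eq_some hp, Option.bind_eq_some_iff] at h4
      obtain ⟨l', h4, -⟩ := h4
      exact succ_lt_length_of_run_cross h4
    refine eq_of_evalStateSums_mul fun t => ?_
    have h := stateSums_skein (r := r) hp hi t
    simp only [fun u => homflyptOfDiagram_spec (p ++ u ++ r) t] at h
    have h4 : ∀ a b : StateSums, (a * b) t = a t * b t := fun _ _ => rfl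
    have h5 : ∀ a b : StateSums, (a - b) t = a t - b t := fun _ _ => rfl
    simp only [map_sub, map_mul, h4, h5, evalStateSums_monomial, zpow_neg_one, zpow_one, zpow_zero,
      mul_one, one_mul]
    linarith
  · show homflyptOfDiagram _ = 1
    refine eq_of_evalStateSums_mul fun t => ?_
    rw [← homflyptOfDiagram_spec, map_one]
    exact (one_mul _).symm

/-! ### The extension to singular links -/

/-- The alternating sum of the values of `f` on the resolutions of the singular crossings. -/
noncomputable def extendLaurent (f : List Slice → Laurent) (p : List Slice) :
    List Slice → Laurent
  | [] => f p
  | ⟨i, .double⟩ :: w =>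
      extendLaurent f (p ++ [⟨i, .cross (positiveType ((run p []).getD []) i)⟩]) w
        - extendLaurent f (p ++ [⟨i, .cross (!positiveType ((run p []).getD []) i)⟩]) w
  | x :: w => extendLaurent f (p ++ [x]) w

/-- Resolving a double point keeps the number of components, so all resolutions are diagrams with
the same `μ`, and `φ` commutes with the alternating sum. -/
theorem extend_onDiagrams {P : (μ : ℕ+) → Link μ → Laurent} (φ : Laurent →+ ℚ) {μ : ℕ+}
    {w p : List Slice} (h : IsSingularDiagram μ (p ++ w)) (hp : doubleCount p = 0) :
    extend (onDiagrams fun L : Link μ => φ (P μ L)) p w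
      = φ (extendLaurent (ofLinks P) p w) := by
  induction w generalizing p with
  | nil =>
    rw [List.append_nil] at h
    have h' : IsDiagram μ p := ⟨h, hp⟩
    rw [extend, extendLaurent, onDiagrams, dif_pos h', ofLinks_eq h']
  | cons x w ih =>
    obtain ⟨i, g⟩ := x
    have h1 : ∀ g, g ≠ .double → IsSingularDiagram μ (p ++ [⟨i, g⟩] ++ w) →
        extend (onDiagrams fun L : Link μ => φ (P μ L)) (p ++ [⟨i, g⟩]) w
          = φ (extendLaurent (ofLinks P) (p ++ [⟨i, g⟩]) w) := by
      intro g hg h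
      exact ih h (by rw [doubleCount_append, hp]; simp [doubleCount, hg])
    rw [← List.singleton_append, ← List.append_assoc] at h
    cases g with
    | double =>
      have h2 : ∀ b, IsSingularDiagram μ (p ++ [⟨i, .cross b⟩] ++ w) := by
        intro b
        refine ⟨?_, (components_cross p w i b).trans h.2⟩
        rw [← h.1]
        simp only [run_append, run, act_cross]
      rw [extend, extendLaurent, map_sub, h1 _ (by simp) (h2 _), h1 _ (by simp) (h2 _)]
    | cup o => exact h1 _ (by simp) h
    | cap => exact h1 _ (by simp) h
    | cross b => exact h1 _ (by simp) h

section Skein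

variable {f : List Slice → Laurent}

/-- The skein relation survives the resolution of the later double points: the three diagrams induce
the same orientations above the crossing, so the signs of those resolutions agree. The stack `u`
collects what is already resolved. -/
theorem extendLaurent_skein (hf : homflyptRing.Invariant f) {p : List Slice} {l : List Bool}
    {i : ℕ} (hp : run p [] = some l) (hi : i + 1 < l.length) (w u : List Slice) :
    monomial (-1) 0 * extendLaurent f (p ++ [⟨i, .cross (positiveType l i)⟩] ++ u) w
      = monomial 1 0 * extendLaurent f (p ++ [⟨i, .cross (!positiveType l i)⟩] ++ u) w
        + monomial 0 1 * extendLaurent f (p ++ smoothing l i ++ u) w := by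
  induction w generalizing u with
  | nil => exact hf.skein p u l i hp hi
  | cons x w ih =>
    obtain ⟨j, g⟩ := x
    have h1 : ∀ b, run (p ++ [⟨i, .cross b⟩] ++ u) [] = run (p ++ smoothing l i ++ u) [] := by
      intro b
      rw [run_append_of_eq_some hp, run_append_of_eq_some hp, run_smoothing_eq hi b]
    have h2 := fun g => ih (u ++ [⟨j, g⟩])
    simp only [← List.append_assoc] at h2
    cases g with
    | double =>
      simp only [extendLaurent, h1]
      rw [mul_sub, h2, h2]
      ring
    | cup o => exact h2 _
    | cap => exact h2 _
    | cross b => exact h2 _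

/-- Each double point contributes a factor `v² - 1` or `v z`, both of degree at least one. No number
of components is fixed, because the smoothing `L_0` changes it. -/
theorem extendLaurent_mem_filtration (hf : homflyptRing.Invariant f)
    (h0 : ∀ w, f w ∈ filtration 0) {w p : List Slice} (h : (run (p ++ w) []).isSome) :
    extendLaurent f p w ∈ filtration (doubleCount w) := by
  induction w generalizing p with
  | nil => exact h0 p
  | cons x w ih =>
    obtain ⟨i, g⟩ := x
    rw [← List.singleton_append, ← List.append_assoc] at h
    rw [← List.singleton_append (x := (⟨i, g⟩ : Slice)), doubleCount_append,
      List.singleton_append]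
    cases g with
    | double =>
      have h1 : ∀ b, run (p ++ [⟨i, .double⟩] ++ w) [] = run (p ++ [⟨i, .cross b⟩] ++ w) [] := by
        intro b
        simp only [run_append, run, act_cross]
      obtain ⟨l', h2⟩ := Option.isSome_iff_exists.1 h
      rw [h1 true, List.append_assoc, run_append, Option.bind_eq_some_iff] at h2
      obtain ⟨l, hp, h2⟩ := h2
      rw [run_append, Option.bind_eq_some_iff] at h2
      have hi : i + 1 < l.length := succ_lt_length_of_run_cross h2.choose_spec.1
      have h3 := ih (p := p ++ [⟨i, .cross (!positiveType l i)⟩]) (by rwa [← h1])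
      have h4 := ih (p := p ++ smoothing l i) (by
        rwa [run_append_of_eq_some hp, run_smoothing_eq hi true, ← run_append_of_eq_some hp, ← h1])
      have h5 := extendLaurent_skein hf hp hi w []
      simp only [List.append_nil] at h5
      -- Multiplying by `v` solves the skein relation for the positive resolution.
      have h6 := congrArg (monomial 1 0 * ·) h5
      simp only [mul_add, ← mul_assoc, monomial_mul_monomial] at h6
      norm_num only [monomial_zero, one_mul] at h6
      have h7 := add_mem (monomial_sub_mul_mem_filtration 2 0 h3)
        (monomial_mul_mem_filtration 1 1 h4)
      rw [extendLaurent, hp, Option.getD_some, h6]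
      have h8 : ((doubleCount [⟨i, .double⟩] + doubleCount w : ℕ) : ℤ) = doubleCount w + 1 := by
        simp [doubleCount, add_comm]
      rw [h8]
      convert h7 using 1
      rw [monomial_zero]
      ring
    | cup o => simpa [doubleCount, extendLaurent] using ih h
    | cap => simpa [doubleCount, extendLaurent] using ih h
    | cross b => simpa [doubleCount, extendLaurent] using ih h

end Skein

/-- The polynomial of a diagram is its coefficient relative to the unknot, hence an element of
`coeffRing` times `1`. -/
theorem IsHOMFLYPT.mem_filtration {P : (μ : ℕ+) → Link μ → Laurent} (hP : IsHOMFLYPT P)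
    (w : List Slice) : ofLinks P w ∈ filtration 0 := by
  by_cases h : ∃ μ, IsDiagram μ w
  · obtain ⟨c, hc⟩ := exists_homflypt h
    rw [hc _ _ hP.invariant, hP.ofLinks_unknot, coeffRing_smul]
    exact mul_mem_filtration c.2 one_mem_filtration
  · rw [ofLinks_eq_zero h]
    exact zero_mem _

theorem IsHOMFLYPT.isVassiliev {P : (μ : ℕ+) → Link μ → Laurent} (hP : IsHOMFLYPT P) (μ : ℕ+)
    (m : ℕ) (j : ℤ) : IsVassiliev fun L : Link μ => coeffB (P μ L) m j := by
  -- The order `n` only has to satisfy `m + j < n + 1`; truncation at `0` covers negative `m + j`.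
  refine ⟨(m + j).toNat, fun w hw hd => ?_⟩
  simp only [coeffB_eq_momentHom]
  rw [extend_onDiagrams (momentHom m j) hw rfl]
  have h := extendLaurent_mem_filtration hP.invariant hP.mem_filtration (p := []) (w := w)
    (by rw [List.nil_append, hw.1]; rfl)
  refine h m j ?_
  rw [hd]
  have := Int.self_le_toNat (m + j)
  push_cast
  omega

end OrientedLinks

theorem mainTheorem3 :
    ∃ P : (μ : ℕ+) → OrientedLinks.Link μ → OrientedLinks.Laurent,
      OrientedLinks.IsHOMFLYPT P ∧
      (∀ Q : (μ : ℕ+) → OrientedLinks.Link μ → OrientedLinks.Laurent,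
        OrientedLinks.IsHOMFLYPT Q → Q = P) ∧
      ∀ (μ : ℕ+) (m : ℕ) (j : ℤ),
        OrientedLinks.IsVassiliev (fun L : OrientedLinks.Link μ =>
          OrientedLinks.coeffB (P μ L) m j) :=
  ⟨OrientedLinks.homflypt, OrientedLinks.isHOMFLYPT_homflypt,
    fun _ hQ => OrientedLinks.isHOMFLYPT_homflypt.unique hQ,
    fun μ m j => OrientedLinks.isHOMFLYPT_homflypt.isVassiliev μ m j⟩
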